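/- Let $Z\subset\mathbb{R}^2=\mathbb{C}$ be a two-dimensional lattice (a discrete additive subgroup spanning $\mathbb{C}$ over $\mathbb{R}$), and let $R=(R_n)_{n\ge 0}$ be a random walk on $Z$: $R_0=0$, $R_n\in Z$, the increments $R_{n+1}-R_n$ are independent and identically distributed, and for every $z\in Z$ there is an $n$ with $\mathbb{P}(R_n=z)>0$. Suppose that $R$ is spherical, that is, $R_1$ is bounded, $\mathbb{E}R_1=0$, and $\mathbb{E}\langle R_1,e_i\rangle\langle R_1,e_j\rangle=C\delta_{ij}$ for some constant $C$, where $e_1,e_2$ is the standard basis of $\mathbb{R}^2$. Then the partial sums of $$a(z)=\sum_{n=0}^\infty\bigl(\mathbb{P}(R_n=0)-\mathbb{P}(R_n=z)\bigr)$$ converge for every $z\in Z$ (this defines the harmonic potential $a$ of $R$), and there are real constants $A,B$ such that the following holds for every integer $K\ge 0$. The function $a$ has a high-order expansion of order $K$, that is, there are $\alpha,\lambda\in\mathbb{R}$ and $\alpha_{lk}\in\mathbb{C}$, for finitely many pairs of integers $l,k\ge 0$ with $-1\ge l-k\ge -K$, such that the function $$a_K(z)=\alpha\log|z|+\lambda+\operatorname{Re}\sum_{l,k}\alpha_{lk}\frac{z^l}{|z|^k}\qquad(z\in\mathbb{C}\setminus\{0\})$$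 of a continuous variable satisfies $a(z)=a_K(z)+O(|z|^{-K})$ as $|z|\to\infty$, $z\in Z$. Moreover every such $a_K$ satisfies $$\int_0^{2\pi}a_K(re^{it})\,dt=A\log r+B+O(r^{-K})\qquad(r\to\infty).$$ -/

import Mathlib

open MeasureTheory ProbabilityTheory Filter Topology Asymptotics

namespace PlanarWalk

/-- `R` is a random walk on the lattice `Z ⊆ ℂ`: it starts at `0`, stays in `Z`, has independent
identically distributed increments, and visits every point of `Z` with positive probability. -/
structure IsRandomWalk {Ω : Type*} [MeasurableSpace Ω] (μ : Measure Ω) (Z : Submodule ℤ ℂ)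
    (R : ℕ → Ω → ℂ) : Prop where
  measurable : ∀ n, Measurable (R n)
  start : ∀ ω, R 0 ω = 0
  mem : ∀ n ω, R n ω ∈ Z
  indep : iIndepFun (fun (n : ℕ) (ω : Ω) => R (n + 1) ω - R n ω) μ
  identDistrib : ∀ n,
    IdentDistrib (fun ω => R (n + 1) ω - R n ω) (fun ω => R 1 ω - R 0 ω) μ μ
  reaches : ∀ z ∈ Z, ∃ n, 0 < μ {ω | R n ω = z}

/-- The walk `R` is spherical: its steps are bounded, its drift vanishes, and the matrix of second
moments of a step is a multiple of the identity. The step is represented by `R 1` (as `R 0 = 0`). -/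
structure IsSpherical {Ω : Type*} [MeasurableSpace Ω] (μ : Measure Ω)
    (R : ℕ → Ω → ℂ) : Prop where
  bounded : ∃ M : ℝ, ∀ᵐ ω ∂μ, ‖R 1 ω‖ ≤ M
  balanced : ∫ ω, R 1 ω ∂μ = 0
  isotropic : ∃ C : ℝ, ∫ ω, (R 1 ω).re * (R 1 ω).re ∂μ = C ∧
    ∫ ω, (R 1 ω).im * (R 1 ω).im ∂μ = C ∧ ∫ ω, (R 1 ω).re * (R 1 ω).im ∂μ = 0

/-- `P_n(z)`, the probability that the walk is at `z` at time `n`. -/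
noncomputable def hitProb {Ω : Type*} [MeasurableSpace Ω] (μ : Measure Ω) (R : ℕ → Ω → ℂ)
    (n : ℕ) (z : ℂ) : ℝ :=
  μ.real {ω | R n ω = z}

/-- `a(z) = ∑_{n ≥ 0} (P_n(0) - P_n(z))` for all `z ∈ Z`. The series is the limit of its partial
sums: for a periodic walk it converges only conditionally. -/
def IsHarmonicPotential {Ω : Type*} [MeasurableSpace Ω] (μ : Measure Ω) (Z : Submodule ℤ ℂ)
    (R : ℕ → Ω → ℂ) (a : Z → ℝ) : Prop :=
  ∀ z : Z, Tendsto
    (fun N : ℕ => ∑ n ∈ Finset.range N, (hitProb μ R n 0 - hitProb μ R n (z : ℂ)))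
    atTop (𝓝 (a z))

/-- The data of a finite expression `α log|z| + λ + Re ∑ α_{lk} z^l / |z|^k`;
`coeff (l, k)` is `α_{lk}`. -/
structure Expansion where
  logCoeff : ℝ
  const : ℝ
  coeff : ℕ × ℕ →₀ ℂ

/-- The expression as a function of a continuous variable `z ≠ 0` in the plane. -/
noncomputable def Expansion.eval (E : Expansion) (z : ℂ) : ℝ :=
  E.logCoeff * Real.log ‖z‖ + E.const +
    (∑ p ∈ E.coeff.support, E.coeff p * (z ^ p.1 / ((‖z‖ : ℂ) ^ p.2))).re

/-- `E` is a high-order expansion of order `K` of `a : Z → ℝ`: only terms with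
`-1 ≥ l - k ≥ -K` occur, and `a(z) = E(z) + O(|z|^{-K})` as `z → ∞` in `Z`. -/
structure Expansion.IsExpansionOf (E : Expansion) (K : ℕ) {Z : Submodule ℤ ℂ}
    (a : Z → ℝ) : Prop where
  degrees : ∀ p ∈ E.coeff.support, p.1 + 1 ≤ p.2 ∧ p.2 ≤ p.1 + K
  approx : (fun z : Z => a z - E.eval (z : ℂ)) =O[Bornology.cobounded Z]
    (fun z : Z => (‖(z : ℂ)‖ ^ K)⁻¹)

end PlanarWalk

/-!
The potential is expanded through the walk run in continuous time. Let `φ` be the characteristic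
function of a step and `D` a cell of the dual lattice, of area `V`. Fourier inversion turns the
partial sums of the potential into integrals over `D`, and, since `|φ| < 1` almost everywhere and
`|1 - φ(θ)| ≥ κ |θ|²` on `D`, dominated convergence gives (`IsStepCharFun.tendsto_sum`)
`V a(z) = ∫_D (1 - e^{-i⟨z, θ⟩}) / (1 - φ(θ)) dθ`. Periodicity of the walk does no harm here, nor
below: writing `1 / (1 - φ)` as `∫₀^∞ e^{-t (1 - φ)} dt` turns the right hand side into
`∫₀^∞ (q_t(0) - q_t(z)) dt`, where `q_t` is the heat kernel (times `V`) of the walk with exponential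
waiting times (`IsStepCharFun.integral_heatKernel`).

As the walk is spherical, `φ(θ) = 1 - c |θ|² + O(|θ|³)`. Expanding `e^{-t (1 - φ)}` around
`e^{-c t |θ|²}` gives, uniformly in `z` and up to `O(t^{-K-1})`, `q_t(z) = g_t(z) + p_t(z)`, where
`g_t` is the Gaussian kernel and `p_t` a sum of Gaussian integrals of monomials `t^m θ^a (conj θ)^b`
with `a + b ≥ 3 m`, `m ≥ 1` (`IsStepCharFun.exists_heatKernel_expansion`). At times up to `ε |z|`,
for small `ε`, both `q_t(z)` and `g_t(z)` are exponentially small on the lattice, as the steps are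
bounded (`IsRandomWalk.norm_heatKernel_le_exp`). Comparing with `∫ (g_t(1) - g_t(z)) dt`, a Frullani
integral equal to a multiple of `log |z|` (`integral_gaussInt_sub`), one obtains the logarithm, a
constant, and the integrals of `p_t(z)` over `t ≥ ε |z|`.

The crucial point is that the integrals of `p_t` contain no radial terms. Write a monomial as
`t^m θ^l |θ|^{2 b}`, up to conjugation. The factor `|θ|²` is minus the `t`-derivative of
`e^{-c t |θ|²}`, up to a constant, so integration by parts in time lowers `m` and `b` together, and
the boundary terms at `t = ε |z|` decay rapidly. One ends either with `m = 0` and `b > 0`, where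
only a boundary term is left, or with `b = 0`, where the integral is an explicit multiple of
`z^l / |z|^{2 l - 2 m}` with `l > m ≥ 0`. In the radial case `l = 0` one has `b > m`, so only the
first alternative occurs (`exists_integral_gaussInt_expansion`). Hence `a` has an expansion with
`l ≥ 1` in all homogeneous terms (`exists_nonradial_expansion`), whose mean over a circle is exactly
that of the logarithm and the constant (`Expansion.integral_circle`).

Any other expansion of the same order differs from this one by an expression that is `O(|z|^{-K})`
on the lattice. As the lattice contains points in all directions, the logarithm, the constant and
the homogeneous terms of degree above `-K` of the difference vanish one after the other, and the
difference is `O(|z|^{-K})` on the whole plane (`isBigO_of_isBigO_lattice`).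
-/

namespace PlanarWalk

open scoped RealInnerProductSpace ComplexConjugate

/-! ### Fourier inversion on the lattice -/

/-- The cell `{θ | |⟨b i, θ⟩| ≤ π}`: a fundamental domain, up to a null set, of `2π` times the
lattice dual to the one spanned by `b`. -/
def dualCell (b : Fin 2 → ℂ) : Set ℂ := {θ | ∀ i, |⟪b i, θ⟫| ≤ Real.pi}

/-- The coordinates `θ ↦ (⟨b i, θ⟩)ᵢ` in which the dual cell is a square. -/
noncomputable def dualCoord (b : Module.Basis (Fin 2) ℝ ℂ) : ℂ ≃L[ℝ] (Fin 2 → ℝ) :=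
  (LinearMap.linearEquivOfInjective
    (LinearMap.pi fun i => (innerₛₗ ℝ (b i) : ℂ →ₗ[ℝ] ℝ)) (by
      rw [← LinearMap.ker_eq_bot, LinearMap.ker_eq_bot']
      intro θ h
      have hi : ∀ i, ⟪b i, θ⟫ = 0 := fun i => congrFun h i
      have : ⟪∑ i, b.repr θ i • b i, θ⟫ = 0 := by
        simp only [sum_inner, real_inner_smul_left, hi, mul_zero, Finset.sum_const_zero]
      rwa [b.sum_repr, inner_self_eq_zero] at this)
    (by simp)).toContinuousLinearEquiv

theorem dualCoord_apply (b : Module.Basis (Fin 2) ℝ ℂ) (θ : ℂ) (i : Fin 2) :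
    dualCoord b θ i = ⟪b i, θ⟫ := by
  simp [dualCoord]

theorem dualCell_eq_preimage (b : Module.Basis (Fin 2) ℝ ℂ) :
    dualCell b = dualCoord b ⁻¹' Set.pi Set.univ fun _ => Set.Icc (-Real.pi) Real.pi := by
  ext θ
  simp only [dualCell, Set.mem_ofPred_eq, Set.mem_preimage, Set.mem_univ_pi, dualCoord_apply,
    Set.mem_Icc, abs_le]

theorem isCompact_dualCell (b : Module.Basis (Fin 2) ℝ ℂ) : IsCompact (dualCell b) := by
  rw [dualCell_eq_preimage]
  exact (dualCoord b).toHomeomorph.isCompact_preimage.2 (isCompact_univ_pi fun _ => isCompact_Icc)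

theorem dualCell_mem_nhds (b : Module.Basis (Fin 2) ℝ ℂ) : dualCell b ∈ 𝓝 (0 : ℂ) := by
  rw [dualCell_eq_preimage]
  refine (dualCoord b).continuous.continuousAt.preimage_mem_nhds ?_
  rw [map_zero]
  exact set_pi_mem_nhds Set.finite_univ fun i _ =>
    Icc_mem_nhds (by simpa using Real.pi_pos) (by simpa using Real.pi_pos)

theorem integral_exp_int_mul (m : ℤ) :
    ∫ s in Set.Icc (-Real.pi) Real.pi, Complex.exp ((m * s : ℝ) * Complex.I) =
      if m = 0 then (2 * Real.pi : ℂ) else 0 := by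
  rw [integral_Icc_eq_integral_Ioc,
    ← intervalIntegral.integral_of_le (by linarith [Real.pi_pos])]
  split_ifs with h
  · simp only [h, Int.cast_zero, zero_mul, Complex.ofReal_zero, Complex.exp_zero,
      intervalIntegral.integral_const]
    simp
    ring
  · have hm : (m : ℂ) * Complex.I ≠ 0 := by simp [h]
    have := integral_exp_mul_complex (a := -Real.pi) (b := Real.pi) hm
    rw [show (fun s : ℝ => Complex.exp ((m * s : ℝ) * Complex.I)) =
      fun s : ℝ => Complex.exp (m * Complex.I * s) by ext s; congr 1; push_cast; ring, this]
    have : Complex.exp (m * Complex.I * (Real.pi : ℝ)) =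
        Complex.exp (m * Complex.I * ((-Real.pi : ℝ) : ℂ)) := by
      rw [Complex.exp_eq_exp_iff_exists_int]
      exact ⟨m, by push_cast; ring⟩
    rw [this, sub_self, zero_div]

/-- Orthogonality of the characters of the lattice on the dual cell. -/
theorem setIntegral_dualCell_exp (b : Module.Basis (Fin 2) ℝ ℂ) (m : Fin 2 → ℤ) :
    ∫ θ in dualCell b, Complex.exp (⟪∑ i, m i • b i, θ⟫ * Complex.I) =
      if m = 0 then ((volume.real (dualCell b) : ℝ) : ℂ) else 0 := by
  split_ifs with h
  · simp [h, Measure.real]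
  · let T := dualCoord b
    have hT : MeasurableEmbedding T := T.toHomeomorph.measurableEmbedding
    let ν : Measure (Fin 2 → ℝ) := Measure.map T volume
    obtain ⟨c, hν⟩ : ∃ c : NNReal, ν = c • volume :=
      ⟨_, Measure.isAddLeftInvariant_eq_smul ν volume⟩
    have key : ∀ θ, Complex.exp (⟪∑ i, m i • b i, θ⟫ * Complex.I) =
        ∏ i, Complex.exp ((m i * T θ i : ℝ) * Complex.I) := by
      intro θ
      rw [← Complex.exp_sum, ← Finset.sum_mul, ← Complex.ofReal_sum, sum_inner]
      congr 4
      ext i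
      rw [dualCoord_apply, ← Int.cast_smul_eq_zsmul ℝ, real_inner_smul_left]
    simp_rw [key, dualCell_eq_preimage]
    rw [← hT.setIntegral_map (μ := volume)
      (g := fun x => ∏ i, Complex.exp ((m i * x i : ℝ) * Complex.I))]
    change ∫ x in _, _ ∂ν = 0
    rw [hν, Measure.restrict_smul, integral_smul_nnreal_measure, volume_pi,
      Measure.restrict_pi_pi,
      integral_fintype_prod_eq_prod (f := fun i s => Complex.exp ((m i * s : ℝ) * Complex.I))]
    simp_rw [integral_exp_int_mul]
    obtain ⟨i, hi⟩ := Function.ne_iff.1 h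
    rw [Finset.prod_eq_zero (Finset.mem_univ i) (if_neg hi), smul_zero]

section Walk

variable {Ω : Type*} [MeasurableSpace Ω] {μ : Measure Ω}

theorem IsRandomWalk.charFun_map [IsProbabilityMeasure μ] {Z : Submodule ℤ ℂ} {R : ℕ → Ω → ℂ}
    (hR : IsRandomWalk μ Z R) (n : ℕ) (θ : ℂ) :
    charFun (μ.map (R n)) θ = charFun (μ.map (R 1)) θ ^ n := by
  have h : R n = fun ω => ∑ i : Fin n, (R (i + 1) ω - R i ω) := by
    ext ω
    rw [Fin.sum_univ_eq_sum_range (fun i => R (i + 1) ω - R i ω),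
      Finset.sum_range_sub (fun i => R i ω), hR.start, sub_zero]
  have h1 : R 1 = fun ω => R 1 ω - R 0 ω := by ext ω; simp [hR.start]
  have hind := hR.indep.precomp (g := fun i : Fin n => (i : ℕ)) Fin.val_injective
  have hm : ∀ i : Fin n, AEMeasurable (fun ω => R (i + 1) ω - R i ω) μ := fun i =>
    ((hR.measurable _).sub (hR.measurable _)).aemeasurable
  rw [h, hind.charFun_map_fun_sum_eq_prod hm, Finset.prod_apply,
    Finset.prod_congr rfl fun i _ => by rw [(hR.identDistrib i).map_eq, ← h1]]
  simp

/-- Fourier inversion on the lattice. -/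
theorem IsRandomWalk.hitProb_eq_integral [IsProbabilityMeasure μ] {Z : Submodule ℤ ℂ}
    {R : ℕ → Ω → ℂ} (hR : IsRandomWalk μ Z R) (b : Module.Basis (Fin 2) ℝ ℂ)
    (hb : Submodule.span ℤ (Set.range b) = Z) (n : ℕ) (z : ℂ) (hz : z ∈ Z) :
    ((volume.real (dualCell b) * hitProb μ R n z : ℝ) : ℂ) =
      ∫ θ in dualCell b, Complex.exp (-⟪z, θ⟫ * Complex.I) * charFun (μ.map (R 1)) θ ^ n := by
  have hDfin : volume (dualCell b) ≠ ⊤ := (isCompact_dualCell b).measure_lt_top.ne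
  have : IsFiniteMeasure (volume.restrict (dualCell b)) :=
    ⟨by simpa using hDfin.lt_top⟩
  have hmeas : ∀ ω, R n ω - z ∈ Z := fun ω => Z.sub_mem (hR.mem n ω) hz
  have hcell : ∀ ω, ∫ θ in dualCell b, Complex.exp (⟪R n ω - z, θ⟫ * Complex.I) =
      Set.indicator {ω | R n ω = z} (fun _ => ((volume.real (dualCell b) : ℝ) : ℂ)) ω := by
    intro ω
    have := hmeas ω
    rw [← hb, Submodule.mem_span_range_iff_exists_fun] at this
    obtain ⟨m, hm⟩ := this
    rw [← hm, setIntegral_dualCell_exp]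
    by_cases h : m = 0
    · have h0 : R n ω = z := by
        rw [← sub_eq_zero, ← hm, h]; simp
      rw [if_pos h, Set.indicator_of_mem (by exact h0)]
    · rw [if_neg h, Set.indicator_of_notMem]
      intro h0
      apply h
      have h1 : R n ω = z := h0
      rw [h1, sub_self] at hm
      have := Fintype.linearIndependent_iff.1 (b.linearIndependent.restrict_scalars
        (R := ℤ) (by intro x y hxy; simpa using hxy)) m hm
      exact funext this
  have hpoint : ∀ θ, Complex.exp (-⟪z, θ⟫ * Complex.I) * charFun (μ.map (R 1)) θ ^ n =
      ∫ ω, Complex.exp (⟪R n ω - z, θ⟫ * Complex.I) ∂μ := by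
    intro θ
    rw [← hR.charFun_map, charFun_apply, integral_map (hR.measurable n).aemeasurable
      (by fun_prop), ← integral_const_mul]
    congr 1
    ext ω
    rw [← Complex.exp_add, inner_sub_left]
    congr 1
    push_cast
    ring
  simp_rw [hpoint]
  rw [integral_integral_swap]
  · simp_rw [hcell]
    rw [integral_indicator_const (s := {ω | R n ω = z}) _
      (hR.measurable n (measurableSet_singleton z))]
    rw [hitProb, Complex.real_smul]
    push_cast
    ring
  · refine Integrable.of_bound (C := 1) (Measurable.aestronglyMeasurable ?_) ?_
    · have := hR.measurable n
      simp only [Function.uncurry_def]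
      fun_prop
    · refine Eventually.of_forall fun p => ?_
      simp only [Function.uncurry_def]
      rw [Complex.norm_exp_ofReal_mul_I]
end Walk

/-! ### Taylor expansion of the characteristic function -/

/-- Taylor's formula for the exponential, with a remainder that does not grow in the left
half-plane. -/
theorem norm_exp_sub_sum_le_pow_mul_max (n : ℕ) (w : ℂ) :
    ‖Complex.exp w - ∑ i ∈ Finset.range n, w ^ i / (i.factorial : ℂ)‖ ≤
      ‖w‖ ^ n * max 1 (Real.exp w.re) := by
  induction n generalizing w with
  | zero => simp [Complex.norm_exp]
  | succ n ih =>
    have hd : ∀ v : ℂ, HasDerivAt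
        (fun v => Complex.exp v - ∑ i ∈ Finset.range (n + 1), v ^ i / (i.factorial : ℂ))
        (Complex.exp v - ∑ i ∈ Finset.range n, v ^ i / (i.factorial : ℂ)) v := by
      intro v
      refine (Complex.hasDerivAt_exp v).sub ?_
      simp_rw [Finset.sum_range_succ']
      simp only [pow_zero, Nat.factorial_zero, Nat.cast_one, div_one]
      refine HasDerivAt.add_const 1 ?_
      have : ∀ i ∈ Finset.range n, HasDerivAt
          (fun v : ℂ => v ^ (i + 1) / ((i + 1).factorial : ℂ)) (v ^ i / (i.factorial : ℂ)) v := by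
        intro i _
        convert! (hasDerivAt_pow (i + 1) v).div_const ((i + 1).factorial : ℂ) using 1
        rw [Nat.factorial_succ]
        have h1 : ((i + 1 : ℕ) : ℂ) ≠ 0 := by exact_mod_cast Nat.succ_ne_zero i
        have h2 : (i.factorial : ℂ) ≠ 0 := by exact_mod_cast i.factorial_ne_zero
        push_cast at h1 ⊢
        field_simp
      simpa using HasDerivAt.fun_sum this
    have hg : ∀ s ∈ Set.Icc (0 : ℝ) 1, HasDerivWithinAt (fun s : ℝ =>
        Complex.exp (s * w) - ∑ i ∈ Finset.range (n + 1), (s * w) ^ i / (i.factorial : ℂ))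
        ((Complex.exp (s * w) - ∑ i ∈ Finset.range n, (s * w) ^ i / (i.factorial : ℂ)) * w)
        (Set.Icc 0 1) s := by
      intro s _
      have h1 : HasDerivAt (fun s : ℝ => (s : ℂ) * w) w s := by
        simpa using (Complex.ofRealCLM.hasDerivAt (x := s)).mul_const w
      exact ((hd (s * w)).comp s h1).hasDerivWithinAt
    have hb : ∀ s ∈ Set.Ico (0 : ℝ) 1,
        ‖(Complex.exp (s * w) - ∑ i ∈ Finset.range n, (s * w) ^ i / (i.factorial : ℂ)) * w‖ ≤
          ‖w‖ ^ (n + 1) * max 1 (Real.exp w.re) := by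
      intro s hs
      rw [norm_mul, pow_succ, mul_right_comm]
      refine mul_le_mul_of_nonneg_right ((ih _).trans ?_) (norm_nonneg _)
      refine mul_le_mul (pow_le_pow_left₀ (norm_nonneg _) ?_ _) ?_ (by positivity) (by positivity)
      · rw [norm_mul, Complex.norm_real, Real.norm_of_nonneg hs.1]
        exact mul_le_of_le_one_left (norm_nonneg _) hs.2.le
      · refine max_le (le_max_left _ _) ?_
        rw [Complex.re_ofReal_mul]
        rcases le_total w.re 0 with h | h
        · exact le_max_of_le_left (Real.exp_le_one_iff.2 (mul_nonpos_of_nonneg_of_nonpos hs.1 h))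
        · exact le_max_of_le_right (Real.exp_le_exp.2 (mul_le_of_le_one_left h hs.2.le))
    have := norm_image_sub_le_of_norm_deriv_le_segment' hg hb 1 (by simp)
    simpa [Finset.sum_range_succ'] using this

/-- The functions on the plane that are polynomials in `θ` and `conj θ` without terms of degree
less than `d`. -/
def polyOrder (d : ℕ) : Submodule ℂ (ℂ → ℂ) :=
  Submodule.span ℂ {f | ∃ a b : ℕ, d ≤ a + b ∧ f = fun θ => θ ^ a * conj θ ^ b}

theorem monomial_mem_polyOrder {d a b : ℕ} (h : d ≤ a + b) :
    (fun θ : ℂ => θ ^ a * conj θ ^ b) ∈ polyOrder d :=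
  Submodule.subset_span ⟨a, b, h, rfl⟩

theorem polyOrder_mul {d d' : ℕ} {f g : ℂ → ℂ} (hf : f ∈ polyOrder d) (hg : g ∈ polyOrder d') :
    f * g ∈ polyOrder (d + d') := by
  have h : polyOrder d * polyOrder d' ≤ polyOrder (d + d') := by
    rw [polyOrder, polyOrder, Submodule.span_mul_span]
    refine Submodule.span_le.2 ?_
    rintro _ ⟨_, ⟨a, b, h, rfl⟩, _, ⟨a', b', h', rfl⟩, rfl⟩
    have : (fun θ : ℂ => θ ^ (a + a') * conj θ ^ (b + b')) ∈ polyOrder (d + d') :=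
      monomial_mem_polyOrder (by omega)
    refine Set.mem_of_eq_of_mem ?_ this
    ext θ
    simp only [Pi.mul_apply]
    ring
  exact h (Submodule.mul_mem_mul hf hg)

theorem polyOrder_pow {d : ℕ} {f : ℂ → ℂ} (hf : f ∈ polyOrder d) (n : ℕ) :
    f ^ n ∈ polyOrder (n * d) := by
  induction n with
  | zero => simpa [Pi.one_def] using monomial_mem_polyOrder (d := 0) (a := 0) (b := 0) le_rfl
  | succ n ih =>
    rw [pow_succ, Nat.succ_mul]
    exact polyOrder_mul ih hf

theorem continuous_of_mem_polyOrder {d : ℕ} {f : ℂ → ℂ} (hf : f ∈ polyOrder d) :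
    Continuous f := by
  induction hf using Submodule.span_induction with
  | mem f h =>
    obtain ⟨a, b, -, rfl⟩ := h
    fun_prop
  | zero => exact continuous_const
  | add f g _ _ hf hg => exact hf.add hg
  | smul c f _ hf => exact hf.const_smul c

section Law

variable {ν : Measure ℂ} [IsProbabilityMeasure ν] {M : ℝ}

theorem integrable_of_bounded_law (hM : ∀ᵐ x ∂ν, ‖x‖ ≤ M) {E : Type*} [NormedAddCommGroup E]
    {f : ℂ → E} (hf : Continuous f) : Integrable f ν := by
  obtain ⟨B, hB⟩ := (isCompact_closedBall (0 : ℂ) M).exists_bound_of_continuousOn hf.continuousOn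
  refine Integrable.of_bound hf.aestronglyMeasurable B ?_
  filter_upwards [hM] with x hx
  exact hB x (by simpa using hx)

theorem integral_inner_pow_mem_polyOrder (hM : ∀ᵐ x ∂ν, ‖x‖ ≤ M) (k : ℕ) :
    (fun θ : ℂ => ∫ x, ((⟪x, θ⟫ : ℝ) : ℂ) ^ k ∂ν) ∈ polyOrder k := by
  have h : (fun θ : ℂ => ∫ x, ((⟪x, θ⟫ : ℝ) : ℂ) ^ k ∂ν) = ∑ i ∈ Finset.range (k + 1),
      ((∫ x, (conj x / 2) ^ i * (x / 2) ^ (k - i) ∂ν) * (k.choose i : ℂ)) •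
        fun θ : ℂ => θ ^ i * conj θ ^ (k - i) := by
    ext θ
    have h1 : ∀ x : ℂ, ((⟪x, θ⟫ : ℝ) : ℂ) = conj x / 2 * θ + x / 2 * conj θ := by
      intro x
      apply Complex.ext <;> simp [Complex.inner] <;> ring
    simp_rw [h1, add_pow]
    rw [integral_finsetSum _ fun i _ => integrable_of_bounded_law hM (by fun_prop)]
    simp only [Finset.sum_apply, Pi.smul_apply, smul_eq_mul]
    refine Finset.sum_congr rfl fun i _ => ?_
    rw [← integral_mul_const, ← integral_mul_const]
    congr 1
    ext x
    ring
  rw [h]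
  refine Submodule.sum_mem _ fun i hi => Submodule.smul_mem _ _ (monomial_mem_polyOrder ?_)
  have := Finset.mem_range_succ_iff.1 hi
  omega

/-- The Taylor expansion of the characteristic function of an isotropic bounded law with mean `0`
and covariance `2 c` times the identity. -/
theorem charFun_expansion (hM : ∀ᵐ x ∂ν, ‖x‖ ≤ M) {c : ℝ} (h1 : ∀ θ : ℂ, ∫ x, ⟪x, θ⟫ ∂ν = 0)
    (h2 : ∀ θ : ℂ, ∫ x, ⟪x, θ⟫ ^ 2 ∂ν = 2 * c * ‖θ‖ ^ 2) (L : ℕ) (hL : 3 ≤ L) :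
    ∃ E ∈ polyOrder 3, ∀ θ : ℂ, ‖charFun ν θ - 1 + c * ‖θ‖ ^ 2 - E θ‖ ≤ M ^ L * ‖θ‖ ^ L := by
  have hM0 : 0 ≤ M := by
    obtain ⟨x, hx⟩ := hM.exists
    exact (norm_nonneg x).trans hx
  let m : ℕ → ℂ → ℂ := fun k θ => ∫ x, ((⟪x, θ⟫ : ℝ) : ℂ) ^ k ∂ν
  refine ⟨∑ k ∈ Finset.range (L - 3), (Complex.I ^ (k + 3) / ((k + 3).factorial : ℂ)) • m (k + 3),
    Submodule.sum_mem _ fun k _ => Submodule.smul_mem _ _ ?_, fun θ => ?_⟩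
  · refine Submodule.span_mono ?_ (integral_inner_pow_mem_polyOrder hM (k + 3))
    rintro f ⟨a, b, hab, rfl⟩
    exact ⟨a, b, by omega, rfl⟩
  · have e1 : m 1 θ = 0 := by
      have := congrArg (fun r : ℝ => (r : ℂ)) (h1 θ)
      simpa only [m, pow_one, integral_complex_ofReal, Complex.ofReal_zero] using this
    have e2 : m 2 θ = 2 * c * ‖θ‖ ^ 2 := by
      have := congrArg (fun r : ℝ => (r : ℂ)) (h2 θ)
      simp only [m, ← Complex.ofReal_pow, integral_complex_ofReal]
      rw [this]
      push_cast
      ring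
    have e0 : m 0 θ = 1 := by simp [m]
    have hsum : charFun ν θ - 1 + c * ‖θ‖ ^ 2 - (∑ k ∈ Finset.range (L - 3),
        (Complex.I ^ (k + 3) / ((k + 3).factorial : ℂ)) • m (k + 3)) θ =
        ∫ x, (Complex.exp (⟪x, θ⟫ * Complex.I) -
          ∑ k ∈ Finset.range L, (⟪x, θ⟫ * Complex.I) ^ k / (k.factorial : ℂ)) ∂ν := by
      rw [integral_sub (integrable_of_bounded_law hM (by fun_prop))
        (integrable_of_bounded_law hM (by fun_prop)),
        integral_finsetSum _ fun i _ => integrable_of_bounded_law hM (by fun_prop), ← charFun_apply]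
      have : ∀ k, ∫ x, (⟪x, θ⟫ * Complex.I) ^ k / (k.factorial : ℂ) ∂ν =
          Complex.I ^ k / (k.factorial : ℂ) * m k θ := by
        intro k
        rw [← integral_const_mul]
        congr 1
        ext x
        ring
      simp_rw [this]
      obtain ⟨L', rfl⟩ := Nat.exists_eq_add_of_le' hL
      rw [Finset.sum_range_succ', Finset.sum_range_succ', Finset.sum_range_succ', e0, e1, e2]
      simp only [Nat.add_sub_cancel, Finset.sum_apply, Pi.smul_apply, smul_eq_mul]
      norm_num [Nat.factorial]
      ring
    rw [hsum]
    refine (norm_integral_le_of_norm_le_const (C := M ^ L * ‖θ‖ ^ L) ?_).trans (by simp)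
    filter_upwards [hM] with x hx
    refine (norm_exp_sub_sum_le_pow_mul_max L _).trans ?_
    have : max 1 (Real.exp ((⟪x, θ⟫ : ℝ) * Complex.I).re) = 1 := by simp
    rw [this, mul_one, ← mul_pow, norm_mul, Complex.norm_I, mul_one, Complex.norm_real]
    exact pow_le_pow_left₀ (norm_nonneg _) ((norm_inner_le_norm x θ).trans
      (mul_le_mul_of_nonneg_right hx (norm_nonneg _))) _

end Law

/-! ### The characteristic function of a spherical walk -/

theorem exists_bound_of_mem_polyOrder {d : ℕ} {f : ℂ → ℂ} (hf : f ∈ polyOrder d) {S : Set ℂ}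
    (hS : IsCompact S) : ∃ B, 0 ≤ B ∧ ∀ θ ∈ S, ‖f θ‖ ≤ B * ‖θ‖ ^ d := by
  induction hf using Submodule.span_induction with
  | mem f h =>
    obtain ⟨a, b, hab, rfl⟩ := h
    obtain ⟨B, hB⟩ := hS.exists_bound_of_continuousOn
      (f := fun θ : ℂ => (‖θ‖ : ℝ) ^ (a + b - d)) (by fun_prop)
    refine ⟨max B 0, le_max_right _ _, fun θ hθ => ?_⟩
    have h1 := hB θ hθ
    rw [Real.norm_of_nonneg (by positivity)] at h1
    rw [norm_mul, norm_pow, norm_pow, RCLike.norm_conj, ← pow_add,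
      show a + b = (a + b - d) + d by omega, pow_add]
    exact mul_le_mul_of_nonneg_right (h1.trans (le_max_left _ _)) (by positivity)
  | zero => exact ⟨0, le_rfl, by simp⟩
  | add f g _ _ hf hg =>
    obtain ⟨B, hB, h⟩ := hf
    obtain ⟨B', hB', h'⟩ := hg
    refine ⟨B + B', by positivity, fun θ hθ => (norm_add_le _ _).trans ?_⟩
    rw [add_mul]
    exact add_le_add (h θ hθ) (h' θ hθ)
  | smul c f _ hf =>
    obtain ⟨B, hB, h⟩ := hf
    refine ⟨‖c‖ * B, by positivity, fun θ hθ => ?_⟩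
    rw [Pi.smul_apply, norm_smul, mul_assoc]
    exact mul_le_mul_of_nonneg_left (h θ hθ) (norm_nonneg _)

/-- The properties of the characteristic function `φ` of a step, and of the dual cell `D`, on which
the expansion of the potential depends. -/
structure IsStepCharFun (φ : ℂ → ℂ) (D : Set ℂ) (c κ : ℝ) : Prop where
  continuous : Continuous φ
  norm_le : ∀ θ, ‖φ θ‖ ≤ 1
  isCompact : IsCompact D
  mem_nhds : D ∈ 𝓝 (0 : ℂ)
  pos : 0 < κ
  le : κ ≤ c
  re_ge : ∀ θ ∈ D, κ * ‖θ‖ ^ 2 ≤ 1 - (φ θ).re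
  expansion : ∀ L : ℕ, 3 ≤ L → ∃ E ∈ polyOrder 3, ∃ B, 0 ≤ B ∧
    ∀ θ, ‖φ θ - 1 + c * ‖θ‖ ^ 2 - E θ‖ ≤ B * ‖θ‖ ^ L

/-- If a characteristic function has modulus `1` at `θ`, the corresponding character is almost
surely constant. -/
theorem ae_exp_eq_charFun {ν : Measure ℂ} [IsProbabilityMeasure ν] {θ : ℂ}
    (h : ‖charFun ν θ‖ = 1) : ∀ᵐ x ∂ν, Complex.exp (⟪x, θ⟫ * Complex.I) = charFun ν θ := by
  set w := charFun ν θ with hw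
  have hint : Integrable (fun x : ℂ => Complex.exp (⟪x, θ⟫ * Complex.I)) ν :=
    Integrable.of_bound (by fun_prop) 1
      (Eventually.of_forall fun x => (Complex.norm_exp_ofReal_mul_I _).le)
  have hint2 : Integrable (fun x : ℂ => Complex.exp (⟪x, θ⟫ * Complex.I) * conj w) ν :=
    hint.mul_const _
  have hint3 : Integrable (fun x : ℂ => (Complex.exp (⟪x, θ⟫ * Complex.I) * conj w).re) ν :=
    hint2.re
  have hre : ∀ x : ℂ, ‖Complex.exp (⟪x, θ⟫ * Complex.I) * conj w‖ = 1 := by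
    intro x
    rw [norm_mul, Complex.norm_exp_ofReal_mul_I, RCLike.norm_conj, h, one_mul]
  have h0 : ∫ x, (1 - (Complex.exp (⟪x, θ⟫ * Complex.I) * conj w).re) ∂ν = 0 := by
    have h3 : ∫ x, (Complex.exp (⟪x, θ⟫ * Complex.I) * conj w).re ∂ν = 1 := by
      have := integral_re hint2
      simp only [RCLike.re_eq_complex_re] at this
      rw [this, integral_mul_const, ← charFun_apply, ← hw, Complex.mul_conj,
        Complex.normSq_eq_norm_sq, h]
      simp
    rw [integral_sub (integrable_const _) hint3, h3]
    simp
  have hnn : 0 ≤ fun x : ℂ => 1 - (Complex.exp (⟪x, θ⟫ * Complex.I) * conj w).re := fun x =>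
    sub_nonneg.2 ((Complex.re_le_norm _).trans (hre x).le)
  rw [integral_eq_zero_iff_of_nonneg hnn ((integrable_const _).sub hint3)] at h0
  filter_upwards [h0] with x hx
  have hx1 : (Complex.exp (⟪x, θ⟫ * Complex.I) * conj w).re = 1 := by
    have : 1 - (Complex.exp (⟪x, θ⟫ * Complex.I) * conj w).re = 0 := hx
    linarith
  have hx2 : Complex.exp (⟪x, θ⟫ * Complex.I) * conj w = 1 := by
    have h4 := Complex.sq_norm (Complex.exp (⟪x, θ⟫ * Complex.I) * conj w)
    rw [Complex.normSq_apply, hx1, hre x] at h4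
    exact Complex.ext hx1 (by rw [Complex.one_im]; nlinarith)
  calc Complex.exp (⟪x, θ⟫ * Complex.I)
      = Complex.exp (⟪x, θ⟫ * Complex.I) * (conj w * w) := by
        rw [Complex.conj_mul', h]; simp
    _ = w := by rw [← mul_assoc, hx2, one_mul]

/-- A characteristic function that expands as `1 - c |θ|² + O(|θ|³)` with `c > 0` has modulus `1`
only on a null set: the set is a subgroup in which `0` is isolated. -/
theorem ae_norm_charFun_lt_one {ν : Measure ℂ} [IsProbabilityMeasure ν] {δ : ℝ} (hδ : 0 < δ)
    (h : ∀ θ : ℂ, ‖θ‖ < δ → ‖charFun ν θ‖ = 1 → θ = 0) :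
    ∀ᵐ θ : ℂ, ‖charFun ν θ‖ < 1 := by
  have hdiff : ∀ θ ∈ {θ | ‖charFun ν θ‖ = 1}, ∀ θ' ∈ {θ | ‖charFun ν θ‖ = 1}, θ ≠ θ' →
      δ ≤ ‖θ - θ'‖ := by
    intro θ hθ θ' hθ' hne
    by_contra! hlt
    refine hne (sub_eq_zero.1 (h _ hlt ?_))
    have : charFun ν (θ - θ') = ∫ _, charFun ν θ * conj (charFun ν θ') ∂ν := by
      rw [charFun_apply]
      refine integral_congr_ae ?_
      filter_upwards [ae_exp_eq_charFun hθ, ae_exp_eq_charFun hθ'] with x h1 h2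
      rw [← h1, ← h2, ← Complex.exp_conj, ← Complex.exp_add, inner_sub_right]
      congr 1
      simp
      ring
    rw [this, integral_const]
    simp only [probReal_univ, one_smul, norm_mul, RCLike.norm_conj]
    rw [show ‖charFun ν θ‖ = 1 from hθ, show ‖charFun ν θ'‖ = 1 from hθ', one_mul]
  have hcount : {θ | ‖charFun ν θ‖ = 1}.Countable := by
    refine Set.PairwiseDisjoint.countable_of_isOpen (s := fun θ => Metric.ball θ (δ / 2))
      (fun θ hθ θ' hθ' hne => ?_) (fun _ _ => Metric.isOpen_ball)
      (fun θ _ => ⟨θ, Metric.mem_ball_self (by positivity)⟩)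
    refine Metric.ball_disjoint_ball ?_
    rw [dist_eq_norm]
    linarith [hdiff θ hθ θ' hθ' hne]
  have := hcount.ae_notMem volume
  filter_upwards [this] with θ hθ
  refine lt_of_le_of_ne ?_ hθ
  simpa using norm_charFun_le (μ := ν) θ

section Walk

variable {Ω : Type*} [MeasurableSpace Ω] {μ : Measure Ω} {Z : Submodule ℤ ℂ} {R : ℕ → Ω → ℂ}

theorem IsSpherical.ae_norm_le (hR : IsRandomWalk μ Z R) (hS : IsSpherical μ R) :
    ∃ M : ℝ, 0 < M ∧ ∀ᵐ x ∂(μ.map (R 1)), ‖x‖ ≤ M := by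
  obtain ⟨M, hM⟩ := hS.bounded
  refine ⟨max M 1, by positivity, ?_⟩
  rw [ae_map_iff (hR.measurable 1).aemeasurable
    (measurableSet_le measurable_norm measurable_const)]
  filter_upwards [hM] with ω h
  exact h.trans (le_max_left _ _)

variable [IsProbabilityMeasure μ]

/-- On the dual cell the characteristic function of a step takes the value `1` at `0` only, because
the walk reaches every point of the lattice. -/
theorem IsRandomWalk.eq_zero_of_charFun_eq_one (hR : IsRandomWalk μ Z R)
    (b : Module.Basis (Fin 2) ℝ ℂ) (hb : Submodule.span ℤ (Set.range b) = Z) {θ : ℂ}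
    (hθ : θ ∈ dualCell b) (h : charFun (μ.map (R 1)) θ = 1) : θ = 0 := by
  refine InnerProductSpace.ext_inner_left_basis b fun i => ?_
  rw [inner_zero_right]
  have hz : b i ∈ Z := hb ▸ Submodule.subset_span ⟨i, rfl⟩
  obtain ⟨n, hn⟩ := hR.reaches _ hz
  have hprob : IsProbabilityMeasure (μ.map (R n)) :=
    Measure.isProbabilityMeasure_map (hR.measurable n).aemeasurable
  have h1 : charFun (μ.map (R n)) θ = 1 := by rw [hR.charFun_map, h, one_pow]
  have h2 := ae_of_ae_map (hR.measurable n).aemeasurable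
    (ae_exp_eq_charFun (ν := μ.map (R n)) (θ := θ) (by rw [h1, norm_one]))
  rw [h1] at h2
  obtain ⟨ω, hω1, hω2⟩ : ∃ ω, R n ω = b i ∧ Complex.exp (⟪R n ω, θ⟫ * Complex.I) = 1 := by
    by_contra! hcon
    refine hn.ne' (measure_mono_null (fun ω hω => ?_) (ae_iff.1 h2))
    exact hcon ω hω
  rw [hω1, Complex.exp_eq_one_iff] at hω2
  obtain ⟨k, hk⟩ := hω2
  have hk' : ⟪b i, θ⟫ = k * (2 * Real.pi) := by
    have : ((⟪b i, θ⟫ : ℝ) : ℂ) = ((k * (2 * Real.pi) : ℝ) : ℂ) := by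
      refine mul_right_cancel₀ Complex.I_ne_zero ?_
      rw [hk]; push_cast; ring
    exact_mod_cast this
  have hle := hθ i
  rw [hk'] at hle ⊢
  have hk0 : k = 0 := by
    by_contra hne
    have h1 : (1 : ℝ) ≤ |(k : ℝ)| := by exact_mod_cast Int.one_le_abs hne
    rw [abs_mul, abs_of_pos Real.two_pi_pos] at hle
    nlinarith [Real.pi_pos]
  simp [hk0]

theorem IsSpherical.integral_inner (hR : IsRandomWalk μ Z R) (hS : IsSpherical μ R) :
    (∀ θ : ℂ, ∫ x, ⟪x, θ⟫ ∂(μ.map (R 1)) = 0) ∧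
      ∃ c : ℝ, ∀ θ : ℂ, ∫ x, ⟪x, θ⟫ ^ 2 ∂(μ.map (R 1)) = 2 * c * ‖θ‖ ^ 2 := by
  have hprob : IsProbabilityMeasure (μ.map (R 1)) :=
    Measure.isProbabilityMeasure_map (hR.measurable 1).aemeasurable
  obtain ⟨M, -, hM⟩ := hS.ae_norm_le hR
  have hint : ∀ {f : ℂ → ℝ}, Continuous f → Integrable (fun ω => f (R 1 ω)) μ := fun hf =>
    (integrable_map_measure hf.aestronglyMeasurable (hR.measurable 1).aemeasurable).1
      (integrable_of_bounded_law hM hf)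
  have hin : ∀ x θ : ℂ, ⟪x, θ⟫ = x.re * θ.re + x.im * θ.im := fun x θ => by
    simp [Complex.inner]; ring
  constructor
  · intro θ
    rw [integral_map (hR.measurable 1).aemeasurable (by fun_prop)]
    have hintR : Integrable (R 1) μ :=
      (integrable_map_measure (by fun_prop) (hR.measurable 1).aemeasurable).1
        (integrable_of_bounded_law hM continuous_id)
    have := _root_.integral_inner (𝕜 := ℝ) hintR θ
    simp_rw [real_inner_comm θ]
    rw [this, hS.balanced, inner_zero_right]
  · obtain ⟨C, hC1, hC2, hC3⟩ := hS.isotropic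
    refine ⟨C / 2, fun θ => ?_⟩
    rw [integral_map (hR.measurable 1).aemeasurable (by fun_prop)]
    have : ∀ ω, ⟪R 1 ω, θ⟫ ^ 2 = (R 1 ω).re * (R 1 ω).re * θ.re ^ 2 +
        (R 1 ω).im * (R 1 ω).im * θ.im ^ 2 + (R 1 ω).re * (R 1 ω).im * (2 * θ.re * θ.im) := by
      intro ω; rw [hin]; ring
    simp_rw [this]
    have i1 := hint (f := fun x => x.re * x.re) (by fun_prop)
    have i2 := hint (f := fun x => x.im * x.im) (by fun_prop)
    have i3 := hint (f := fun x => x.re * x.im) (by fun_prop)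
    have i12 : Integrable (fun ω => (R 1 ω).re * (R 1 ω).re * θ.re ^ 2 +
        (R 1 ω).im * (R 1 ω).im * θ.im ^ 2) μ := (i1.mul_const _).add (i2.mul_const _)
    rw [integral_add i12 (i3.mul_const _),
      integral_add (i1.mul_const _) (i2.mul_const _), integral_mul_const, integral_mul_const,
      integral_mul_const, hC1, hC2, hC3, ← Complex.normSq_eq_norm_sq, Complex.normSq_apply]
    ring

/-- Near `0` the quadratic term of `φ` dominates; elsewhere in the dual cell `Re (1 - φ)` is
positive, as the walk reaches all lattice points, hence bounded below by compactness. -/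
theorem IsSpherical.isStepCharFun (hR : IsRandomWalk μ Z R) (hS : IsSpherical μ R)
    (b : Module.Basis (Fin 2) ℝ ℂ) (hb : Submodule.span ℤ (Set.range b) = Z) :
    (∃ c κ, IsStepCharFun (charFun (μ.map (R 1))) (dualCell b) c κ) ∧
      ∀ᵐ θ : ℂ, ‖charFun (μ.map (R 1)) θ‖ < 1 := by
  have hprob : IsProbabilityMeasure (μ.map (R 1)) :=
    Measure.isProbabilityMeasure_map (hR.measurable 1).aemeasurable
  obtain ⟨M, hM0, hM⟩ := hS.ae_norm_le hR
  obtain ⟨h1, c, h2⟩ := hS.integral_inner hR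
  set φ := charFun (μ.map (R 1)) with hφ
  have hcont : Continuous φ := by fun_prop
  have hle : ∀ θ, ‖φ θ‖ ≤ 1 := fun θ => by simpa using norm_charFun_le (μ := μ.map (R 1)) θ
  have hone : ∀ θ ∈ dualCell b, φ θ = 1 → θ = 0 := fun θ hθ h =>
    hR.eq_zero_of_charFun_eq_one b hb hθ h
  obtain ⟨ε, hε, hball⟩ := Metric.mem_nhds_iff.1 (dualCell_mem_nhds b)
  have hc : 0 < c := by
    have hε2 : ((ε / 2 : ℝ) : ℂ) ∈ dualCell b := hball (by
      rw [mem_ball_zero_iff, Complex.norm_real, Real.norm_of_nonneg (by positivity)]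
      linarith)
    set θ : ℂ := ((ε / 2 : ℝ) : ℂ) with hθ
    have hθ0 : θ ≠ 0 := by rw [hθ]; exact_mod_cast (half_pos hε).ne'
    have hθn : 0 < ‖θ‖ := norm_pos_iff.2 hθ0
    have hnn : 0 ≤ 2 * c * ‖θ‖ ^ 2 := h2 θ ▸ integral_nonneg fun x => sq_nonneg _
    by_contra! hc
    have hzero : ∫ x, ⟪x, θ⟫ ^ 2 ∂(μ.map (R 1)) = 0 := by
      rw [h2]
      nlinarith [sq_nonneg ‖θ‖]
    have hcts : Continuous fun x : ℂ => ⟪x, θ⟫ ^ 2 :=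
      (continuous_id.inner (𝕜 := ℝ) (continuous_const (y := θ))).pow 2
    rw [integral_eq_zero_iff_of_nonneg (fun x => sq_nonneg _)
      (integrable_of_bounded_law hM hcts)] at hzero
    refine hθ0 (hone θ hε2 ?_)
    rw [hφ, charFun_apply]
    have : ∫ x, Complex.exp (⟪x, θ⟫ * Complex.I) ∂(μ.map (R 1)) = ∫ _, (1 : ℂ) ∂(μ.map (R 1)) := by
      refine integral_congr_ae ?_
      filter_upwards [hzero] with x hx
      have : ⟪x, θ⟫ = 0 := by simpa using hx
      simp [this]
    rw [this]
    simp
  have hexp : ∀ L : ℕ, 3 ≤ L → ∃ E ∈ polyOrder 3, ∃ B, 0 ≤ B ∧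
      ∀ θ, ‖φ θ - 1 + c * ‖θ‖ ^ 2 - E θ‖ ≤ B * ‖θ‖ ^ L := fun L hL => by
    obtain ⟨E, hE, h⟩ := charFun_expansion hM h1 h2 L hL
    exact ⟨E, hE, M ^ L, by positivity, h⟩
  -- near `0` the quadratic term dominates
  obtain ⟨δ, hδ, hnear⟩ : ∃ δ > 0, ∀ θ : ℂ, ‖θ‖ < δ →
      ‖φ θ - 1 + c * ‖θ‖ ^ 2‖ ≤ c / 2 * ‖θ‖ ^ 2 ∧ c * ‖θ‖ ^ 2 ≤ 1 := by
    obtain ⟨E, hE, B, hB, h⟩ := hexp 3 le_rfl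
    obtain ⟨B', hB', h'⟩ := exists_bound_of_mem_polyOrder hE (isCompact_closedBall (0 : ℂ) 1)
    have hpos : 0 < B + B' + 1 := by positivity
    refine ⟨min (min 1 c⁻¹) (c / 2 / (B + B' + 1)), by positivity, fun θ hθ => ?_⟩
    have t1 : ‖θ‖ < 1 := hθ.trans_le ((min_le_left _ _).trans (min_le_left _ _))
    have t2 : ‖θ‖ < c⁻¹ := hθ.trans_le ((min_le_left _ _).trans (min_le_right _ _))
    have t3 : ‖θ‖ < c / 2 / (B + B' + 1) := hθ.trans_le (min_le_right _ _)
    rw [lt_div_iff₀ hpos] at t3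
    have hn := norm_nonneg θ
    constructor
    · have e1 : ‖φ θ - 1 + c * ‖θ‖ ^ 2‖ ≤ ‖φ θ - 1 + c * ‖θ‖ ^ 2 - E θ‖ + ‖E θ‖ := by
        have := norm_add_le (φ θ - 1 + c * ‖θ‖ ^ 2 - E θ) (E θ)
        rwa [sub_add_cancel] at this
      have e2 := h θ
      have e3 := h' θ (by simpa using t1.le)
      have e4 : (B + B') * ‖θ‖ ≤ c / 2 := by nlinarith
      calc _ ≤ (B + B') * ‖θ‖ * ‖θ‖ ^ 2 := by
            rw [show (B + B') * ‖θ‖ * ‖θ‖ ^ 2 = B * ‖θ‖ ^ 3 + B' * ‖θ‖ ^ 3 by ring]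
            linarith
        _ ≤ _ := mul_le_mul_of_nonneg_right e4 (by positivity)
    · have : c * ‖θ‖ ≤ 1 := by
        have := mul_le_mul_of_nonneg_left t2.le hc.le
        rwa [mul_inv_cancel₀ hc.ne'] at this
      nlinarith
  have hnear_re : ∀ θ : ℂ, ‖θ‖ < δ → c / 2 * ‖θ‖ ^ 2 ≤ 1 - (φ θ).re := by
    intro θ hθ
    have := (Complex.abs_re_le_norm _).trans (hnear θ hθ).1
    have h3 := (abs_le.1 this).2
    have h4 : (φ θ - 1 + c * ‖θ‖ ^ 2).re = (φ θ).re - 1 + c * ‖θ‖ ^ 2 := by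
      rw [← Complex.ofReal_pow, ← Complex.ofReal_mul, Complex.add_re, Complex.sub_re,
        Complex.ofReal_re, Complex.one_re]
    rw [h4] at h3
    linarith
  refine ⟨?_, ae_norm_charFun_lt_one hδ fun θ hθ h => ?_⟩
  · -- away from `0` the real part of `1 - φ` is bounded below by compactness
    have hcomp : IsCompact (dualCell b \ Metric.ball 0 δ) :=
      (isCompact_dualCell b).diff Metric.isOpen_ball
    obtain ⟨m, hm, hfar⟩ : ∃ m > 0, ∀ θ ∈ dualCell b \ Metric.ball 0 δ, m ≤ 1 - (φ θ).re := by
      rcases (dualCell b \ Metric.ball 0 δ).eq_empty_or_nonempty with he | hne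
      · exact ⟨1, one_pos, by simp [he]⟩
      · obtain ⟨θ₀, hθ₀, hmin⟩ := hcomp.exists_isMinOn hne
          (f := fun θ => 1 - (φ θ).re) (by fun_prop)
        refine ⟨1 - (φ θ₀).re, ?_, hmin⟩
        have hre := (Complex.re_le_norm (φ θ₀)).trans (hle θ₀)
        refine lt_of_le_of_ne (sub_nonneg.2 hre) fun heq => ?_
        have hre1 : (φ θ₀).re = 1 := by linarith
        have him : (φ θ₀).im = 0 := by
          have := Complex.sq_norm (φ θ₀)
          rw [Complex.normSq_apply, hre1] at this
          nlinarith [hle θ₀, norm_nonneg (φ θ₀)]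
        have := hone θ₀ hθ₀.1 (Complex.ext hre1 him)
        exact hθ₀.2 (by simp [this, hδ])
    obtain ⟨B, hB⟩ := (isCompact_dualCell b).exists_bound_of_continuousOn
      (f := fun θ : ℂ => ‖θ‖ ^ 2) (by fun_prop)
    refine ⟨c, min (c / 2) (m / max B 1), hcont, hle, isCompact_dualCell b, dualCell_mem_nhds b,
      by positivity, (min_le_left _ _).trans (by linarith), fun θ hθ => ?_, hexp⟩
    by_cases hlt : ‖θ‖ < δ
    · exact (mul_le_mul_of_nonneg_right (min_le_left _ _) (by positivity)).trans (hnear_re θ hlt)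
    · have h5 := hfar θ ⟨hθ, by simpa using hlt⟩
      have h6 := hB θ hθ
      rw [Real.norm_of_nonneg (by positivity)] at h6
      refine le_trans ?_ h5
      calc min (c / 2) (m / max B 1) * ‖θ‖ ^ 2 ≤ m / max B 1 * max B 1 :=
            mul_le_mul (min_le_right _ _) (h6.trans (le_max_left _ _)) (by positivity)
              (by positivity)
        _ = m := div_mul_cancel₀ _ (by positivity)
  · obtain ⟨h3, h4⟩ := hnear θ hθ
    have h5 : ‖φ θ‖ ≤ ‖φ θ - 1 + c * ‖θ‖ ^ 2‖ + ‖1 - (c * ‖θ‖ ^ 2 : ℂ)‖ := by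
      have := norm_add_le (φ θ - 1 + c * ‖θ‖ ^ 2) (1 - (c * ‖θ‖ ^ 2 : ℂ))
      rwa [show φ θ - 1 + c * ‖θ‖ ^ 2 + (1 - (c * ‖θ‖ ^ 2 : ℂ)) = φ θ by ring] at this
    have h6 : ‖1 - (c * ‖θ‖ ^ 2 : ℂ)‖ = 1 - c * ‖θ‖ ^ 2 := by
      rw [show 1 - (c * ‖θ‖ ^ 2 : ℂ) = ((1 - c * ‖θ‖ ^ 2 : ℝ) : ℂ) by push_cast; ring,
        Complex.norm_real, Real.norm_of_nonneg (by linarith)]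
    rw [h, h6] at h5
    by_contra hne
    have := norm_pos_iff.2 hne
    have : 0 < c * ‖θ‖ ^ 2 := by positivity
    linarith

end Walk

/-! ### Gaussian Fourier integrals -/

theorem integral_norm_pow_mul_exp (k : ℕ) {s : ℝ} (hs : 0 < s) :
    ∫ θ : ℂ, ‖θ‖ ^ k * Real.exp (-s * ‖θ‖ ^ 2) =
      Real.pi * Real.Gamma (((k : ℝ) + 2) / 2) * s ^ (-((k : ℝ) + 2) / 2) := by
  have := Complex.integral_rpow_mul_exp_neg_mul_rpow (p := 2) (q := k) (b := s) (by norm_num)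
    (by have : (0 : ℝ) ≤ k := k.cast_nonneg
        linarith) hs
  simp only [Real.rpow_natCast, Real.rpow_two] at this
  rw [this]
  ring

theorem integrable_norm_pow_mul_exp (k : ℕ) {s : ℝ} (hs : 0 < s) :
    Integrable fun θ : ℂ => ‖θ‖ ^ k * Real.exp (-s * ‖θ‖ ^ 2) := by
  refine Integrable.of_integral_ne_zero ?_
  rw [integral_norm_pow_mul_exp k hs]
  have : 0 < Real.Gamma (((k : ℝ) + 2) / 2) := Real.Gamma_pos_of_pos (by positivity)
  have := Real.pi_pos
  positivity

/-- The Fourier integral of `θ ^ l |θ| ^ (2 b)` against the Gaussian `exp (-τ |θ|²)`. -/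
noncomputable def gaussInt (l b : ℕ) (τ : ℝ) (z : ℂ) : ℂ :=
  ∫ θ : ℂ, θ ^ l * (‖θ‖ : ℂ) ^ (2 * b) * Complex.exp (-⟪z, θ⟫ * Complex.I - τ * ‖θ‖ ^ 2)

theorem norm_gaussInt_integrand (l b : ℕ) (τ : ℝ) (z θ : ℂ) :
    ‖θ ^ l * (‖θ‖ : ℂ) ^ (2 * b) * Complex.exp (-⟪z, θ⟫ * Complex.I - τ * ‖θ‖ ^ 2)‖ =
      ‖θ‖ ^ (l + 2 * b) * Real.exp (-τ * ‖θ‖ ^ 2) := by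
  rw [norm_mul, norm_mul, norm_pow, norm_pow, Complex.norm_real, norm_norm, Complex.norm_exp,
    pow_add]
  congr 2
  rw [← Complex.ofReal_pow, ← Complex.ofReal_mul, ← Complex.ofReal_neg]
  simp only [Complex.sub_re, Complex.ofReal_re, Complex.re_ofReal_mul, Complex.I_re]
  ring

theorem integrable_gaussInt_integrand (l b : ℕ) {τ : ℝ} (hτ : 0 < τ) (z : ℂ) :
    Integrable fun θ : ℂ =>
      θ ^ l * (‖θ‖ : ℂ) ^ (2 * b) * Complex.exp (-⟪z, θ⟫ * Complex.I - τ * ‖θ‖ ^ 2) := by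
  refine (integrable_norm_pow_mul_exp (l + 2 * b) hτ).mono' (by fun_prop) ?_
  exact Eventually.of_forall fun θ => (norm_gaussInt_integrand l b τ z θ).le

theorem norm_gaussInt_le (l b : ℕ) :
    ∃ C, 0 ≤ C ∧ ∀ τ : ℝ, 0 < τ → ∀ z, ‖gaussInt l b τ z‖ ≤
      C * τ ^ (-((l + 2 * b : ℕ) + 2 : ℝ) / 2) := by
  have : 0 < Real.Gamma ((((l + 2 * b : ℕ) : ℝ) + 2) / 2) := Real.Gamma_pos_of_pos (by positivity)
  refine ⟨Real.pi * Real.Gamma ((((l + 2 * b : ℕ) : ℝ) + 2) / 2), by positivity,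
    fun τ hτ z => ?_⟩
  rw [← integral_norm_pow_mul_exp _ hτ]
  refine (norm_integral_le_integral_norm _).trans_eq ?_
  simp_rw [norm_gaussInt_integrand]

theorem hasDerivAt_gaussInt (l b : ℕ) {τ : ℝ} (hτ : 0 < τ) (z : ℂ) :
    HasDerivAt (fun τ => gaussInt l b τ z) (-gaussInt l (b + 1) τ z) τ := by
  have hmem : Set.Ioi (τ / 2) ∈ 𝓝 τ := Ioi_mem_nhds (by linarith)
  have := (hasDerivAt_integral_of_dominated_loc_of_deriv_le (μ := volume) (x₀ := τ)
    (F := fun (τ : ℝ) (θ : ℂ) =>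
      θ ^ l * (‖θ‖ : ℂ) ^ (2 * b) * Complex.exp (-⟪z, θ⟫ * Complex.I - τ * ‖θ‖ ^ 2))
    (F' := fun (τ : ℝ) (θ : ℂ) => -(θ ^ l * (‖θ‖ : ℂ) ^ (2 * (b + 1)) *
      Complex.exp (-⟪z, θ⟫ * Complex.I - τ * ‖θ‖ ^ 2)))
    (bound := fun θ => ‖θ‖ ^ (l + 2 * (b + 1)) * Real.exp (-(τ / 2) * ‖θ‖ ^ 2))
    hmem (Eventually.of_forall fun τ => by fun_prop) (integrable_gaussInt_integrand l b hτ z)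
    (by fun_prop) (Eventually.of_forall fun θ s hs => ?_)
    (integrable_norm_pow_mul_exp _ (half_pos hτ)) (Eventually.of_forall fun θ s _ => ?_)).2
  · rwa [integral_neg] at this
  · rw [norm_neg, norm_gaussInt_integrand]
    have : τ / 2 < s := hs
    gcongr
  · have h1 : HasDerivAt (fun s : ℝ => -⟪z, θ⟫ * Complex.I - (s : ℂ) * ‖θ‖ ^ 2)
        (-(‖θ‖ : ℂ) ^ 2) s := by
      simpa using ((Complex.ofRealCLM.hasDerivAt (x := s)).mul_const
        ((‖θ‖ : ℂ) ^ 2)).const_sub (-⟪z, θ⟫ * Complex.I)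
    convert! (h1.cexp.const_mul (θ ^ l * (‖θ‖ : ℂ) ^ (2 * b))) using 1
    ring

theorem gaussInt_zero_zero {τ : ℝ} (hτ : 0 < τ) (z : ℂ) :
    gaussInt 0 0 τ z = Real.pi / τ * Complex.exp (-(‖z‖ ^ 2 / (4 * τ))) := by
  have := GaussianFourier.integral_cexp_neg_mul_sq_norm_add (V := ℂ) (b := (τ : ℂ))
    (by simpa using hτ) (-Complex.I) z
  rw [Complex.finrank_real_complex] at this
  simp only [gaussInt, pow_zero, mul_zero, one_mul]
  rw [show ((2 : ℕ) : ℂ) / 2 = 1 by norm_num, Complex.cpow_one] at this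
  convert! this using 2
  · ext θ; congr 1; ring
  · congr 1
    rw [neg_sq, Complex.I_sq]
    ring

/-- Integration by parts along `∂/∂x + i ∂/∂y`, which annihilates `θ ^ l`. -/
theorem gaussInt_succ_zero (l : ℕ) {τ : ℝ} (hτ : 0 < τ) (z : ℂ) :
    gaussInt (l + 1) 0 τ z = -Complex.I * z / (2 * τ) * gaussInt l 0 τ z := by
  let f : ℂ → ℂ := fun θ => θ ^ l * Complex.exp (-⟪z, θ⟫ * Complex.I - τ * ‖θ‖ ^ 2)
  let f' : ℂ → ℂ → ℂ := fun v θ => (l * θ ^ (l - 1) * v +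
    θ ^ l * (-⟪z, v⟫ * Complex.I - τ * (2 * ⟪θ, v⟫))) *
      Complex.exp (-⟪z, θ⟫ * Complex.I - τ * ‖θ‖ ^ 2)
  have hf : ∀ v θ, HasLineDerivAt ℝ f (f' v θ) θ v := by
    intro v θ
    have h1 : HasDerivAt (fun t : ℝ => θ + (t : ℂ) * v) v (0 : ℝ) := by
      simpa using ((Complex.ofRealCLM.hasDerivAt (x := (0 : ℝ))).mul_const v).const_add θ
    have h2 : HasDerivAt (fun t : ℝ => (-⟪z, θ⟫ * Complex.I - τ * ‖θ‖ ^ 2) +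
        (t : ℂ) * (-⟪z, v⟫ * Complex.I - τ * (2 * ⟪θ, v⟫)) + (t : ℂ) ^ 2 * (-τ * ‖v‖ ^ 2))
        (-⟪z, v⟫ * Complex.I - τ * (2 * ⟪θ, v⟫)) (0 : ℝ) := by
      have h3 := (Complex.ofRealCLM.hasDerivAt (x := (0 : ℝ)))
      have := ((h3.mul_const (-⟪z, v⟫ * Complex.I - τ * (2 * ⟪θ, v⟫))).const_add
        (-⟪z, θ⟫ * Complex.I - τ * ‖θ‖ ^ 2)).add ((h3.pow 2).mul_const (-τ * ‖v‖ ^ 2 : ℂ))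
      convert! this using 1
      simp
    have h4 := (h1.pow l).mul h2.cexp
    unfold HasLineDerivAt
    have e1 : (fun t : ℝ => f (θ + t • v)) = fun t : ℝ => (θ + (t : ℂ) * v) ^ l *
        Complex.exp ((-⟪z, θ⟫ * Complex.I - τ * ‖θ‖ ^ 2) +
        (t : ℂ) * (-⟪z, v⟫ * Complex.I - τ * (2 * ⟪θ, v⟫)) + (t : ℂ) ^ 2 * (-τ * ‖v‖ ^ 2)) := by
      ext t
      simp only [f, Complex.real_smul]
      congr 2
      have h5 : ‖θ + (t : ℂ) * v‖ ^ 2 = ‖θ‖ ^ 2 + 2 * t * ⟪θ, v⟫ + t ^ 2 * ‖v‖ ^ 2 := by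
        rw [← Complex.real_smul, norm_add_sq_real, real_inner_smul_right, norm_smul, mul_pow,
          Real.norm_eq_abs, sq_abs]
        ring
      have h6 : ⟪z, θ + (t : ℂ) * v⟫ = ⟪z, θ⟫ + t * ⟪z, v⟫ := by
        rw [← Complex.real_smul, inner_add_right, real_inner_smul_right]
      rw [← Complex.ofReal_pow, h5, h6]
      push_cast
      ring
    rw [e1]
    convert! h4 using 1
    simp only [f', Complex.ofReal_zero, zero_mul, add_zero, ne_eq, OfNat.ofNat_ne_zero,
      not_false_eq_true, zero_pow, Pi.pow_apply]
    ring
  have hg : ∀ (k : ℕ), Integrable fun θ : ℂ =>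
      θ ^ k * Complex.exp (-⟪z, θ⟫ * Complex.I - τ * ‖θ‖ ^ 2) := fun k => by
    simpa using integrable_gaussInt_integrand k 0 hτ z
  have hin : ∀ x y : ℂ, ⟪x, y⟫ = x.re * y.re + x.im * y.im := fun x y => by
    simp [Complex.inner]; ring
  have hf'int : ∀ v, Integrable (f' v) := by
    intro v
    have hc : Integrable fun θ : ℂ => (⟪θ, v⟫ : ℂ) *
        (θ ^ l * Complex.exp (-⟪z, θ⟫ * Complex.I - τ * ‖θ‖ ^ 2)) := by
      refine ((hg (l + 1)).norm.const_mul ‖v‖).mono' (by fun_prop)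
        (Eventually.of_forall fun θ => ?_)
      rw [norm_mul, norm_mul, norm_mul, pow_succ' θ l, norm_mul θ, Complex.norm_real]
      have := norm_inner_le_norm (𝕜 := ℝ) θ v
      calc _ ≤ (‖θ‖ * ‖v‖) * (‖θ ^ l‖ *
            ‖Complex.exp (-⟪z, θ⟫ * Complex.I - τ * ‖θ‖ ^ 2)‖) := by gcongr
        _ = _ := by ring
    convert! (((hg (l - 1)).const_mul (l * v)).add
      ((hg l).const_mul (-⟪z, v⟫ * Complex.I))).sub (hc.const_mul (2 * τ)) using 1
    ext θ
    simp only [f', Pi.add_apply, Pi.sub_apply]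
    ring
  have hzero : ∀ v, ∫ θ, f' v θ = 0 := by
    intro v
    have := integral_bilinear_hasLineDerivAt_right_eq_neg_left_of_integrable (μ := volume)
      (f := fun _ : ℂ => (1 : ℂ)) (f' := fun _ => 0) (g := f) (g' := f' v) (v := v)
      (B := ContinuousLinearMap.mul ℝ ℂ) (by simp) (by simpa using hf'int v)
      (by simpa [f] using hg l) (fun x _ => by
        unfold HasLineDerivAt; exact hasDerivAt_const _ _) (fun x _ => hf v x)
    simpa using this
  have hsum : ∀ θ, f' 1 θ + Complex.I * f' Complex.I θ =
      -Complex.I * z * (θ ^ l * Complex.exp (-⟪z, θ⟫ * Complex.I - τ * ‖θ‖ ^ 2)) -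
        2 * τ * (θ ^ (l + 1) * Complex.exp (-⟪z, θ⟫ * Complex.I - τ * ‖θ‖ ^ 2)) := by
    intro θ
    simp only [f']
    have e1 : (⟪z, 1⟫ : ℂ) + Complex.I * ⟪z, Complex.I⟫ = z := by
      apply Complex.ext <;> simp [hin]
    have e2 : (⟪θ, 1⟫ : ℂ) + Complex.I * ⟪θ, Complex.I⟫ = θ := by
      apply Complex.ext <;> simp [hin]
    linear_combination (-Complex.I * θ ^ l * Complex.exp (-⟪z, θ⟫ * Complex.I - τ * ‖θ‖ ^ 2)) * e1 -
      (2 * τ * θ ^ l * Complex.exp (-⟪z, θ⟫ * Complex.I - τ * ‖θ‖ ^ 2)) * e2 +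
      l * θ ^ (l - 1) * Complex.exp (-⟪z, θ⟫ * Complex.I - τ * ‖θ‖ ^ 2) * Complex.I_sq
  have h0 : ∫ θ, (f' 1 θ + Complex.I * f' Complex.I θ) = 0 := by
    rw [integral_add (hf'int 1) ((hf'int _).const_mul _), integral_const_mul, hzero, hzero]
    simp
  simp_rw [hsum] at h0
  rw [integral_sub ((hg l).const_mul _) ((hg (l + 1)).const_mul _), integral_const_mul,
    integral_const_mul] at h0
  have hτ' : (τ : ℂ) ≠ 0 := by exact_mod_cast hτ.ne'
  simp only [gaussInt, mul_zero, pow_zero, mul_one]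
  rw [div_mul_eq_mul_div, eq_div_iff (mul_ne_zero two_ne_zero hτ')]
  linear_combination -h0

theorem gaussInt_zero_right (l : ℕ) {τ : ℝ} (hτ : 0 < τ) (z : ℂ) :
    gaussInt l 0 τ z =
      (-Complex.I * z / (2 * τ)) ^ l * (Real.pi / τ * Complex.exp (-(‖z‖ ^ 2 / (4 * τ)))) := by
  induction l with
  | zero => rw [gaussInt_zero_zero hτ, pow_zero, one_mul]
  | succ l ih => rw [gaussInt_succ_zero l hτ, ih, pow_succ']; ring

/-! ### Rapid decay -/

/-- The function decays at infinity faster than any power of `‖z‖`. -/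
def RapidDecay (f : ℂ → ℂ) : Prop :=
  ∀ N : ℕ, f =O[Bornology.cobounded ℂ] fun z => (‖z‖ ^ N)⁻¹

theorem RapidDecay.add {f g : ℂ → ℂ} (hf : RapidDecay f) (hg : RapidDecay g) :
    RapidDecay fun z => f z + g z := fun N => (hf N).add (hg N)

theorem RapidDecay.const_mul {f : ℂ → ℂ} (hf : RapidDecay f) (c : ℂ) :
    RapidDecay fun z => c * f z := fun N => (hf N).const_mul_left c

/-- A polynomially bounded multiple of an exponentially small function decays rapidly. -/
theorem rapidDecay_of_norm_le {f : ℂ → ℂ} {C η ρ : ℝ} {k : ℕ} (hη : 0 < η)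
    (h : ∀ z, ρ ≤ ‖z‖ → ‖f z‖ ≤ C * (1 + ‖z‖) ^ k * Real.exp (-η * ‖z‖)) : RapidDecay f := by
  intro N
  have h1 : (fun z : ℂ => C * (1 + ‖z‖) ^ k * Real.exp (-η * ‖z‖)) =O[Bornology.cobounded ℂ]
      fun z => (‖z‖ ^ N)⁻¹ := by
    have h2 : (fun x : ℝ => C * (1 + x) ^ k * Real.exp (-η * x)) =O[atTop]
        fun x : ℝ => (x ^ N)⁻¹ := by
      have e1 : (fun x : ℝ => C * (1 + x) ^ k) =O[atTop] fun x : ℝ => x ^ k := by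
        refine IsBigO.const_mul_left (IsBigO.pow ?_ k) C
        refine IsBigO.of_bound 2 ?_
        filter_upwards [eventually_ge_atTop 1] with x hx
        rw [Real.norm_of_nonneg (by linarith), Real.norm_of_nonneg (by linarith)]
        linarith
      have e2 : (fun x : ℝ => Real.exp (-η * x)) =O[atTop] fun x : ℝ => (x ^ (k + N))⁻¹ := by
        have := (isLittleO_pow_exp_pos_mul_atTop (k + N) hη).isBigO.inv_rev (by
          filter_upwards [eventually_gt_atTop 0] with x hx h0
          exact absurd h0 (by positivity))
        refine this.congr_left fun x => ?_
        rw [← Real.exp_neg, neg_mul]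
      refine (e1.mul e2).trans_eventuallyEq ?_
      filter_upwards [eventually_gt_atTop 0] with x hx
      rw [pow_add]
      field_simp
    exact h2.comp_tendsto tendsto_norm_cobounded_atTop
  refine IsBigO.trans (IsBigO.of_bound 1 ?_) h1
  have : ∀ᶠ z : ℂ in Bornology.cobounded ℂ, ρ ≤ ‖z‖ :=
    tendsto_norm_cobounded_atTop.eventually_ge_atTop ρ
  filter_upwards [this] with z hz
  rw [one_mul]
  exact (h z hz).trans (le_abs_self _)

/-- The functions of `τ` and `z` spanned by `z ^ l |z| ^ i τ ^ (-j) exp (-|z|² / 4τ)`. -/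
noncomputable def heatSpan : Submodule ℂ (ℝ → ℂ → ℂ) :=
  Submodule.span ℂ {f | ∃ l i j : ℕ, f = fun (τ : ℝ) (z : ℂ) =>
    z ^ l * (‖z‖ : ℂ) ^ i * ((τ : ℂ)⁻¹) ^ j * Complex.exp (-(‖z‖ ^ 2 / (4 * τ)))}

theorem exists_hasDerivAt_of_mem_heatSpan {f : ℝ → ℂ → ℂ} (hf : f ∈ heatSpan) :
    ∃ g ∈ heatSpan, ∀ τ : ℝ, 0 < τ → ∀ z, HasDerivAt (fun τ => f τ z) (g τ z) τ := by
  induction hf using Submodule.span_induction with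
  | mem f h =>
    obtain ⟨l, i, j, rfl⟩ := h
    refine ⟨(-(j : ℂ)) • (fun (τ : ℝ) (z : ℂ) =>
        z ^ l * (‖z‖ : ℂ) ^ i * ((τ : ℂ)⁻¹) ^ (j + 1) * Complex.exp (-(‖z‖ ^ 2 / (4 * τ)))) +
      (1 / 4 : ℂ) • (fun (τ : ℝ) (z : ℂ) =>
        z ^ l * (‖z‖ : ℂ) ^ (i + 2) * ((τ : ℂ)⁻¹) ^ (j + 2) * Complex.exp (-(‖z‖ ^ 2 / (4 * τ)))),
      Submodule.add_mem _ (Submodule.smul_mem _ _ (Submodule.subset_span ⟨l, i, j + 1, rfl⟩))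
        (Submodule.smul_mem _ _ (Submodule.subset_span ⟨l, i + 2, j + 2, rfl⟩)),
      fun τ hτ z => ?_⟩
    have hτ' : (τ : ℂ) ≠ 0 := by exact_mod_cast hτ.ne'
    have h1 : HasDerivAt (fun τ : ℝ => (τ : ℂ)⁻¹) (-((τ : ℂ)⁻¹) ^ 2) τ := by
      convert! (Complex.ofRealCLM.hasDerivAt (x := τ)).inv hτ' using 1
      simp [div_eq_mul_inv]
    have h2 := ((h1.pow j).const_mul (z ^ l * (‖z‖ : ℂ) ^ i)).mul
      (h1.const_mul (-(‖z‖ : ℂ) ^ 2 / 4)).cexp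
    have e : ∀ τ : ℝ, (-((‖z‖ : ℂ) ^ 2 / (4 * τ))) = -(‖z‖ : ℂ) ^ 2 / 4 * (τ : ℂ)⁻¹ := fun τ => by
      rw [mul_comm (4 : ℂ), div_mul_eq_div_div]; ring
    simp only [Pi.add_apply, Pi.smul_apply, smul_eq_mul, e]
    convert! h2 using 1
    simp only [Pi.pow_apply]
    rcases j with _ | j
    · simp
      ring
    · simp
      ring
  | zero => exact ⟨0, Submodule.zero_mem _, fun τ _ z => hasDerivAt_const _ _⟩
  | add f g _ _ hf hg =>
    obtain ⟨f', hf', h⟩ := hf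
    obtain ⟨g', hg', h'⟩ := hg
    exact ⟨f' + g', Submodule.add_mem _ hf' hg', fun τ hτ z => (h τ hτ z).add (h' τ hτ z)⟩
  | smul c f _ hf =>
    obtain ⟨f', hf', h⟩ := hf
    exact ⟨c • f', Submodule.smul_mem _ _ hf', fun τ hτ z => (h τ hτ z).const_mul c⟩

theorem norm_le_of_mem_heatSpan {f : ℝ → ℂ → ℂ} (hf : f ∈ heatSpan) :
    ∃ C : ℝ, 0 ≤ C ∧ ∃ k : ℕ, ∀ τ : ℝ, 1 ≤ τ → ∀ z,
      ‖f τ z‖ ≤ C * (1 + ‖z‖) ^ k * Real.exp (-(‖z‖ ^ 2 / (4 * τ))) := by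
  induction hf using Submodule.span_induction with
  | mem f h =>
    obtain ⟨l, i, j, rfl⟩ := h
    refine ⟨1, zero_le_one, l + i, fun τ hτ z => ?_⟩
    have e1 : ‖((τ : ℂ)⁻¹) ^ j‖ ≤ 1 := by
      rw [norm_pow, norm_inv, Complex.norm_real, Real.norm_of_nonneg (by linarith)]
      exact pow_le_one₀ (by positivity) (inv_le_one_of_one_le₀ hτ)
    have e2 : ‖Complex.exp (-(‖z‖ ^ 2 / (4 * τ)))‖ = Real.exp (-(‖z‖ ^ 2 / (4 * τ))) := by
      rw [Complex.norm_exp, ← Complex.ofReal_re (-(‖z‖ ^ 2 / (4 * τ)))]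
      push_cast
      rfl
    rw [norm_mul, norm_mul, norm_mul, e2, norm_pow, norm_pow, Complex.norm_real, norm_norm,
      ← pow_add, one_mul]
    refine mul_le_mul_of_nonneg_right ?_ (Real.exp_nonneg _)
    have e3 : ‖z‖ ^ (l + i) ≤ (1 + ‖z‖) ^ (l + i) :=
      pow_le_pow_left₀ (norm_nonneg _) (by linarith) _
    calc _ ≤ (1 + ‖z‖) ^ (l + i) * 1 := by gcongr
      _ = _ := mul_one _
  | zero => exact ⟨0, le_rfl, 0, by simp⟩
  | add f g _ _ hf hg =>
    obtain ⟨C, hC, k, h⟩ := hf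
    obtain ⟨C', hC', k', h'⟩ := hg
    refine ⟨C + C', by positivity, k + k', fun τ hτ z => (norm_add_le _ _).trans ?_⟩
    rw [add_mul, add_mul]
    have h1 : (1 : ℝ) ≤ 1 + ‖z‖ := by linarith [norm_nonneg z]
    refine add_le_add ((h τ hτ z).trans ?_) ((h' τ hτ z).trans ?_)
    · gcongr
      omega
    · gcongr
      omega
  | smul c f _ hf =>
    obtain ⟨C, hC, k, h⟩ := hf
    refine ⟨‖c‖ * C, by positivity, k, fun τ hτ z => ?_⟩
    rw [Pi.smul_apply, Pi.smul_apply, norm_smul, mul_assoc, mul_assoc, ← mul_assoc C]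
    exact mul_le_mul_of_nonneg_left (h τ hτ z) (norm_nonneg _)

theorem exists_mem_heatSpan_gaussInt (l b : ℕ) :
    ∃ f ∈ heatSpan, ∀ τ : ℝ, 0 < τ → ∀ z, gaussInt l b τ z = f τ z := by
  induction b with
  | zero =>
    refine ⟨((-Complex.I / 2) ^ l * Real.pi) • fun (τ : ℝ) (z : ℂ) => z ^ l * (‖z‖ : ℂ) ^ 0 *
      ((τ : ℂ)⁻¹) ^ (l + 1) * Complex.exp (-(‖z‖ ^ 2 / (4 * τ))),
      Submodule.smul_mem _ _ (Submodule.subset_span ⟨l, 0, l + 1, rfl⟩), fun τ hτ z => ?_⟩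
    rw [gaussInt_zero_right l hτ]
    simp only [Pi.smul_apply, smul_eq_mul]
    rw [div_eq_mul_inv _ (2 * (τ : ℂ)), mul_inv]
    ring
  | succ b ih =>
    obtain ⟨f, hf, h⟩ := ih
    obtain ⟨g, hg, h'⟩ := exists_hasDerivAt_of_mem_heatSpan hf
    refine ⟨-g, Submodule.neg_mem _ hg, fun τ hτ z => ?_⟩
    have h1 : HasDerivAt (fun τ => gaussInt l b τ z) (g τ z) τ := by
      refine (h' τ hτ z).congr_of_eventuallyEq ?_
      filter_upwards [Ioi_mem_nhds hτ] with s hs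
      exact h s hs z
    have := h1.unique (hasDerivAt_gaussInt l b hτ z)
    simp [this]

theorem norm_gaussInt_le_exp (l b : ℕ) :
    ∃ C : ℝ, 0 ≤ C ∧ ∃ k : ℕ, ∀ τ : ℝ, 1 ≤ τ → ∀ z,
      ‖gaussInt l b τ z‖ ≤ C * (1 + ‖z‖) ^ k * Real.exp (-(‖z‖ ^ 2 / (4 * τ))) := by
  obtain ⟨f, hf, h⟩ := exists_mem_heatSpan_gaussInt l b
  obtain ⟨C, hC, k, hk⟩ := norm_le_of_mem_heatSpan hf
  refine ⟨C, hC, k, fun τ hτ z => ?_⟩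
  rw [h τ (by linarith)]
  exact hk τ hτ z

/-- Along `τ = ε |z|` the Gaussian integrals decay rapidly. -/
theorem rapidDecay_gaussInt (l b m : ℕ) {ε : ℝ} (hε : 0 < ε) (c : ℝ) (hc : 0 < c) :
    RapidDecay fun z => ((ε * ‖z‖ : ℝ) : ℂ) ^ m * gaussInt l b (c * (ε * ‖z‖)) z := by
  obtain ⟨C, hC, k, h⟩ := norm_gaussInt_le_exp l b
  refine rapidDecay_of_norm_le (C := ε ^ m * C) (η := (4 * c * ε)⁻¹) (ρ := (c * ε)⁻¹ + 1)
    (k := m + k) (by positivity) fun z hz => ?_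
  have hz0 : 0 < ‖z‖ := lt_of_lt_of_le (by positivity) hz
  have h1 : 1 ≤ c * (ε * ‖z‖) := by
    have : c * ε * (c * ε)⁻¹ ≤ c * ε * ‖z‖ := by gcongr; linarith
    rw [mul_inv_cancel₀ (by positivity)] at this
    linarith
  rw [norm_mul, norm_pow, Complex.norm_real, Real.norm_of_nonneg (by positivity)]
  have h2 := h _ h1 z
  rw [show -(‖z‖ ^ 2 / (4 * (c * (ε * ‖z‖)))) = -(4 * c * ε)⁻¹ * ‖z‖ by field_simp] at h2
  have h3 : (ε * ‖z‖) ^ m ≤ ε ^ m * (1 + ‖z‖) ^ m := by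
    rw [mul_pow]
    gcongr
    linarith
  calc _ ≤ (ε ^ m * (1 + ‖z‖) ^ m) * (C * (1 + ‖z‖) ^ k * Real.exp (-(4 * c * ε)⁻¹ * ‖z‖)) := by
        gcongr
    _ = _ := by rw [pow_add]; ring

/-! ### Integrals over time of the Gaussian integrals -/

theorem continuousOn_gaussInt (l b m : ℕ) {c : ℝ} (hc : 0 < c) (z : ℂ) :
    ContinuousOn (fun t : ℝ => (t : ℂ) ^ m * gaussInt l b (c * t) z) (Set.Ioi 0) := by
  intro t ht
  have h1 : ContinuousAt (fun τ => gaussInt l b τ z) (c * t) :=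
    (hasDerivAt_gaussInt l b (mul_pos hc ht) z).continuousAt
  have h2 : ContinuousAt (fun t : ℝ => c * t) t := by fun_prop
  exact ((by fun_prop : ContinuousAt (fun t : ℝ => (t : ℂ) ^ m) t).mul
    (ContinuousAt.comp (f := fun t : ℝ => c * t) h1 h2)).continuousWithinAt

theorem norm_pow_mul_gaussInt_le (l b m : ℕ) {c : ℝ} (hc : 0 < c) :
    ∃ C, 0 ≤ C ∧ ∀ t : ℝ, 0 < t → ∀ z, ‖(t : ℂ) ^ m * gaussInt l b (c * t) z‖ ≤
      C * t ^ ((m : ℝ) - (l + 2 * b + 2 : ℕ) / 2) := by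
  obtain ⟨C, hC, h⟩ := norm_gaussInt_le l b
  refine ⟨C * c ^ (-((l + 2 * b : ℕ) + 2 : ℝ) / 2), by positivity, fun t ht z => ?_⟩
  rw [norm_mul, norm_pow, Complex.norm_real, Real.norm_of_nonneg ht.le]
  refine (mul_le_mul_of_nonneg_left (h (c * t) (mul_pos hc ht) z) (by positivity)).trans_eq ?_
  rw [Real.mul_rpow hc.le ht.le, Real.rpow_sub ht, Real.rpow_natCast, neg_div, Real.rpow_neg ht.le]
  push_cast
  field_simp

theorem integrableOn_pow_mul_gaussInt {l b m : ℕ} (h : 2 * m < l + 2 * b) {c T : ℝ} (hc : 0 < c)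
    (hT : 0 < T) (z : ℂ) :
    IntegrableOn (fun t : ℝ => (t : ℂ) ^ m * gaussInt l b (c * t) z) (Set.Ioi T) := by
  obtain ⟨C, hC, hle⟩ := norm_pow_mul_gaussInt_le l b m hc
  have h1 : (m : ℝ) - (l + 2 * b + 2 : ℕ) / 2 < -1 := by
    have : (2 * m : ℝ) < l + 2 * b := by exact_mod_cast h
    push_cast
    linarith
  refine ((integrableOn_Ioi_rpow_of_lt h1 hT).const_mul C).mono'
    (((continuousOn_gaussInt l b m hc z).mono
      (Set.Ioi_subset_Ioi hT.le)).aestronglyMeasurable measurableSet_Ioi) ?_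
  filter_upwards [ae_restrict_mem measurableSet_Ioi] with t ht
  exact hle t (hT.trans ht) z

theorem tendsto_pow_mul_gaussInt {l b m : ℕ} (h : 2 * m < l + 2 * b + 2) {c : ℝ} (hc : 0 < c)
    (z : ℂ) : Tendsto (fun t : ℝ => (t : ℂ) ^ m * gaussInt l b (c * t) z) atTop (𝓝 0) := by
  obtain ⟨C, hC, hle⟩ := norm_pow_mul_gaussInt_le l b m hc
  have h1 : 0 < (l + 2 * b + 2 : ℕ) / 2 - (m : ℝ) := by
    have : (2 * m : ℝ) < l + 2 * b + 2 := by exact_mod_cast h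
    push_cast
    linarith
  have h2 := (tendsto_rpow_neg_atTop h1).const_mul C
  rw [mul_zero] at h2
  refine squeeze_zero_norm' ?_ h2
  filter_upwards [eventually_gt_atTop 0] with t ht
  rw [neg_sub]
  exact hle t ht z

/-- Integration by parts in `t`, lowering the power of `|θ|²`. -/
theorem integral_pow_mul_gaussInt_succ {l b m : ℕ} (h : 2 * m < l + 2 * (b + 1)) {c T : ℝ}
    (hc : 0 < c) (hT : 0 < T) (z : ℂ) :
    ∫ t in Set.Ioi T, (t : ℂ) ^ m * gaussInt l (b + 1) (c * t) z =
      m / c * (∫ t in Set.Ioi T, (t : ℂ) ^ (m - 1) * gaussInt l b (c * t) z) +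
        (c : ℂ)⁻¹ * ((T : ℂ) ^ m * gaussInt l b (c * T) z) := by
  have hc' : (c : ℂ) ≠ 0 := by exact_mod_cast hc.ne'
  have i1 := integrableOn_pow_mul_gaussInt h hc hT z
  have i2 : IntegrableOn (fun t : ℝ => (m : ℂ) * ((t : ℂ) ^ (m - 1) * gaussInt l b (c * t) z))
      (Set.Ioi T) := by
    rcases m with _ | m
    · simp
    · exact (integrableOn_pow_mul_gaussInt (by omega) hc hT z).const_mul _
  have hd : ∀ t ∈ Set.Ici T, HasDerivAt (fun t : ℝ => (t : ℂ) ^ m * gaussInt l b (c * t) z)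
      (m * ((t : ℂ) ^ (m - 1) * gaussInt l b (c * t) z) -
        c * ((t : ℂ) ^ m * gaussInt l (b + 1) (c * t) z)) t := by
    intro t ht
    have ht0 : 0 < t := hT.trans_le ht
    have h1 : HasDerivAt (fun t : ℝ => c * t) c t := by simpa using (hasDerivAt_id t).const_mul c
    have h2 := (hasDerivAt_gaussInt l b (mul_pos hc ht0) z).scomp t h1
    have h3 := ((Complex.ofRealCLM.hasDerivAt (x := t)).pow m).mul h2
    convert! h3 using 1
    simp
    ring
  have key := integral_Ioi_of_hasDerivAt_of_tendsto' hd (i2.sub (i1.const_mul (c : ℂ)))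
    (tendsto_pow_mul_gaussInt (by omega) hc z)
  rw [integral_sub i2 (i1.const_mul _), integral_const_mul, integral_const_mul] at key
  field_simp
  linear_combination -key

/-- The profile in time of the Gaussian integrals with `b = 0`, in the scale of `|z|²`. -/
noncomputable def heatProfile (l m : ℕ) (c u : ℝ) : ℝ :=
  u ^ m * ((c * u) ^ (l + 1))⁻¹ * Real.exp (-(1 / (4 * c * u)))

theorem heatProfile_nonneg (l m : ℕ) {c u : ℝ} (hc : 0 < c) (hu : 0 < u) :
    0 ≤ heatProfile l m c u := by
  unfold heatProfile
  positivity

theorem heatProfile_le_pow (l m : ℕ) {c : ℝ} (hc : 0 < c) (N : ℕ) :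
    ∃ C, 0 ≤ C ∧ ∀ u : ℝ, 0 < u → heatProfile l m c u ≤ C * u ^ (m + N) := by
  refine ⟨(N + l + 1).factorial * (4 * c) ^ (N + l + 1) * (c ^ (l + 1))⁻¹, by positivity,
    fun u hu => ?_⟩
  have h1 := Real.pow_div_factorial_le_exp (x := 1 / (4 * c * u)) (by positivity) (N + l + 1)
  have h2 : Real.exp (-(1 / (4 * c * u))) ≤ (N + l + 1).factorial * (4 * c * u) ^ (N + l + 1) := by
    rw [Real.exp_neg]
    refine (inv_anti₀ (by positivity) h1).trans_eq ?_
    rw [inv_div, one_div, inv_pow, div_inv_eq_mul]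
  unfold heatProfile
  refine (mul_le_mul_of_nonneg_left h2 (by positivity)).trans_eq ?_
  have h3 : u ^ (N + l + 1) = u ^ N * u ^ (l + 1) := by rw [← pow_add]; ring_nf
  rw [mul_pow (4 * c) u, mul_pow c u, h3, mul_inv, pow_add u m N]
  field_simp

theorem integrableOn_heatProfile {l m : ℕ} (h : m < l) {c : ℝ} (hc : 0 < c) :
    IntegrableOn (heatProfile l m c) (Set.Ioi 0) := by
  have hcts : ContinuousOn (heatProfile l m c) (Set.Ioi 0) := by
    intro u hu
    have hu' : 0 < u := hu
    have h1 : (c * u) ^ (l + 1) ≠ 0 := by positivity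
    have h2 : 4 * c * u ≠ 0 := by positivity
    unfold heatProfile
    refine ContinuousAt.continuousWithinAt ?_
    fun_prop (disch := assumption)
  rw [← Set.Ioc_union_Ioi_eq_Ioi zero_le_one, integrableOn_union]
  constructor
  · obtain ⟨C, hC, hle⟩ := heatProfile_le_pow l m hc 0
    refine IntegrableOn.of_bound (by simp) ((hcts.mono Set.Ioc_subset_Ioi_self).aestronglyMeasurable
      measurableSet_Ioc) C ?_
    filter_upwards [ae_restrict_mem measurableSet_Ioc] with u hu
    rw [Real.norm_of_nonneg (heatProfile_nonneg l m hc hu.1)]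
    refine (hle u hu.1).trans (mul_le_of_le_one_right hC (pow_le_one₀ hu.1.le hu.2))
  · have h2 : IntegrableOn (fun u : ℝ => (c ^ (l + 1))⁻¹ * u ^ (-2 : ℝ)) (Set.Ioi 1) :=
      (integrableOn_Ioi_rpow_of_lt (by norm_num) one_pos).const_mul _
    refine h2.mono' ((hcts.mono (Set.Ioi_subset_Ioi zero_le_one)).aestronglyMeasurable
      measurableSet_Ioi) ?_
    filter_upwards [ae_restrict_mem measurableSet_Ioi] with u hu
    have hu1 : 1 < u := hu
    have hu0 : 0 < u := one_pos.trans hu1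
    rw [Real.norm_of_nonneg (heatProfile_nonneg l m hc hu0)]
    unfold heatProfile
    have h3 : Real.exp (-(1 / (4 * c * u))) ≤ 1 := Real.exp_le_one_iff.2 (by
      rw [neg_nonpos]; positivity)
    have h4 : u ^ m * u ^ 2 ≤ u ^ (l + 1) := by
      rw [← pow_add]; exact pow_le_pow_right₀ hu1.le (by omega)
    have h5 : u ^ m * (u ^ (l + 1))⁻¹ ≤ (u ^ 2)⁻¹ := by
      rw [← div_eq_mul_inv, div_le_iff₀ (by positivity), ← div_eq_inv_mul,
        le_div_iff₀ (by positivity)]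
      exact h4
    rw [Real.rpow_neg hu0.le, Real.rpow_two, mul_pow, mul_inv]
    calc _ ≤ u ^ m * ((c ^ (l + 1))⁻¹ * (u ^ (l + 1))⁻¹) * 1 := by gcongr
      _ = (c ^ (l + 1))⁻¹ * (u ^ m * (u ^ (l + 1))⁻¹) := by ring
      _ ≤ _ := by gcongr

theorem rapidDecay_integral_heatProfile (l m : ℕ) {c ε : ℝ} (hc : 0 < c)
    (hε : 0 < ε) :
    RapidDecay fun z => ((∫ u in Set.Ioc 0 (ε / ‖z‖), heatProfile l m c u : ℝ) : ℂ) := by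
  intro N
  obtain ⟨C, hC, hle⟩ := heatProfile_le_pow l m hc N
  refine IsBigO.of_bound (C * ε ^ (m + N + 1)) ?_
  have : ∀ᶠ z : ℂ in Bornology.cobounded ℂ, 1 ≤ ‖z‖ :=
    tendsto_norm_cobounded_atTop.eventually_ge_atTop 1
  filter_upwards [this] with z hz
  have hz0 : 0 < ‖z‖ := by linarith
  have hpos : 0 < ε / ‖z‖ := by positivity
  rw [Complex.norm_real]
  have h1 := norm_setIntegral_le_of_norm_le_const (μ := volume) (s := Set.Ioc 0 (ε / ‖z‖))
    (f := heatProfile l m c) (C := C * (ε / ‖z‖) ^ (m + N)) (by simp) (fun u hu => by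
      rw [Real.norm_of_nonneg (heatProfile_nonneg l m hc hu.1)]
      refine (hle u hu.1).trans ?_
      have := hu.1.le
      gcongr
      exact hu.2)
  refine h1.trans ?_
  rw [Real.volume_real_Ioc_of_le hpos.le, sub_zero, mul_assoc, ← pow_succ, div_pow,
    Real.norm_of_nonneg (by positivity), mul_assoc, div_eq_mul_inv]
  gcongr
  omega

theorem integral_pow_mul_gaussInt_zero {l m : ℕ} {c ε : ℝ} (hc : 0 < c) (hε : 0 < ε)
    {z : ℂ} (hz : z ≠ 0) (h : m < l) :
    ∫ t in Set.Ioi (ε * ‖z‖), (t : ℂ) ^ m * gaussInt l 0 (c * t) z =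
      (-Complex.I / 2) ^ l * Real.pi * (z ^ l / (‖z‖ : ℂ) ^ (2 * l - 2 * m)) *
        ((∫ u in Set.Ioi (ε / ‖z‖), heatProfile l m c u : ℝ) : ℂ) := by
  have hz0 : 0 < ‖z‖ := norm_pos_iff.2 hz
  have h1 := integral_comp_mul_left_Ioi' (fun t : ℝ => (t : ℂ) ^ m * gaussInt l 0 (c * t) z)
    (ε / ‖z‖) (b := ‖z‖ ^ 2) (by positivity)
  rw [show ‖z‖ ^ 2 * (ε / ‖z‖) = ε * ‖z‖ by field_simp] at h1
  rw [← h1, ← integral_complex_ofReal, ← integral_const_mul, Complex.real_smul,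
    ← integral_const_mul]
  refine setIntegral_congr_fun measurableSet_Ioi fun u hu => ?_
  have hu0 : 0 < u := (div_pos hε hz0).trans hu
  have hz' : (‖z‖ : ℂ) ≠ 0 := by exact_mod_cast hz0.ne'
  have hc' : (c : ℂ) ≠ 0 := by exact_mod_cast hc.ne'
  have hu' : (u : ℂ) ≠ 0 := by exact_mod_cast hu0.ne'
  rw [gaussInt_zero_right l (by positivity)]
  unfold heatProfile
  push_cast
  rw [show -((‖z‖ : ℂ) ^ 2 / (4 * (c * (‖z‖ ^ 2 * u)))) = -(1 / (4 * c * u)) by field_simp]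
  obtain ⟨d, rfl⟩ := Nat.exists_eq_add_of_lt h
  rw [show 2 * (m + d + 1) - 2 * m = 2 * d + 2 by omega]
  rw [show -Complex.I * z / (2 * (c * ((‖z‖ : ℂ) ^ 2 * u))) =
    -Complex.I / 2 * z * (((c : ℂ) * (u : ℂ))⁻¹ * ((‖z‖ : ℂ) ^ 2)⁻¹) by field_simp,
    mul_pow _ (((c : ℂ) * (u : ℂ))⁻¹ * ((‖z‖ : ℂ) ^ 2)⁻¹), mul_pow _ z, mul_pow _ ((_ : ℂ) ^ 2)⁻¹,
    inv_pow, inv_pow]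
  generalize (-Complex.I / 2) ^ (m + d + 1) = A
  generalize z ^ (m + d + 1) = B
  field_simp
  ring

/-- The contribution of one monomial `t ^ m θ ^ l |θ| ^ (2 b)` to the potential is homogeneous of
degree `2 m - l - 2 b`, up to a rapidly decaying error. It vanishes if it is radial, `l = 0`: then
`m < b`, and integration by parts reduces `m` to `0`, where only a boundary term is left. -/
theorem exists_integral_gaussInt_expansion {c ε : ℝ} (hc : 0 < c) (hε : 0 < ε) (b : ℕ) :
    ∀ l m : ℕ, 2 * m < l + 2 * b → ∃ β : ℂ, (l = 0 → β = 0) ∧ RapidDecay fun z =>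
      (∫ t in Set.Ioi (ε * ‖z‖), (t : ℂ) ^ m * gaussInt l b (c * t) z) -
        β * (z ^ l / (‖z‖ : ℂ) ^ (2 * l + 2 * b - 2 * m)) := by
  have hne : ∀ᶠ z : ℂ in Bornology.cobounded ℂ, 1 ≤ ‖z‖ :=
    tendsto_norm_cobounded_atTop.eventually_ge_atTop 1
  induction b with
  | zero =>
    intro l m h
    have hml : m < l := by omega
    set G : ℂ := ((∫ u in Set.Ioi 0, heatProfile l m c u : ℝ) : ℂ) with hG
    refine ⟨(-Complex.I / 2) ^ l * Real.pi * G, fun h0 => by omega, fun N => ?_⟩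
    have hr := rapidDecay_integral_heatProfile l m hc hε N
    -- the power of `z` in front is at most `1` in absolute value
    have hbd : (fun z : ℂ => -((-Complex.I / 2) ^ l * Real.pi *
        (z ^ l / (‖z‖ : ℂ) ^ (2 * l - 2 * m)))) =O[Bornology.cobounded ℂ] fun _ => (1 : ℝ) := by
      refine IsBigO.neg_left (IsBigO.const_mul_left (IsBigO.of_bound 1 ?_) _)
      filter_upwards [hne] with z hz
      rw [norm_div, norm_pow, norm_pow, Complex.norm_real, norm_norm, norm_one, mul_one]
      exact div_le_one_of_le₀ (pow_le_pow_right₀ hz (by omega)) (by positivity)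
    refine ((hbd.mul hr).congr' ?_ ?_)
    · filter_upwards [hne] with z hz
      have hz0 : z ≠ 0 := norm_pos_iff.1 (by linarith)
      have hsplit : G = ((∫ u in Set.Ioc 0 (ε / ‖z‖), heatProfile l m c u : ℝ) : ℂ) +
          ((∫ u in Set.Ioi (ε / ‖z‖), heatProfile l m c u : ℝ) : ℂ) := by
        rw [hG, ← Complex.ofReal_add, ← setIntegral_union Set.Ioc_disjoint_Ioi_same
          measurableSet_Ioi ((integrableOn_heatProfile hml hc).mono_set Set.Ioc_subset_Ioi_self)
          ((integrableOn_heatProfile hml hc).mono_set (Set.Ioi_subset_Ioi (by positivity))),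
          Set.Ioc_union_Ioi_eq_Ioi (by positivity)]
      rw [integral_pow_mul_gaussInt_zero hc hε hz0 hml, hsplit, mul_zero, add_zero]
      ring
    · exact Eventually.of_forall fun z => by simp
  | succ b ih =>
    intro l m h
    have hbdry := (rapidDecay_gaussInt l b m hε c hc).const_mul (c : ℂ)⁻¹
    rcases m with _ | m
    · refine ⟨0, fun _ => rfl, fun N => (hbdry N).congr' ?_ EventuallyEq.rfl⟩
      filter_upwards [hne] with z hz
      rw [integral_pow_mul_gaussInt_succ h hc (by positivity) z]
      simp
    · obtain ⟨β, hβ, hr⟩ := ih l m (by omega)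
      refine ⟨(m + 1 : ℕ) / c * β, fun h0 => by rw [hβ h0, mul_zero], fun N =>
        (((hr.const_mul ((m + 1 : ℕ) / c)).add hbdry) N).congr' ?_ EventuallyEq.rfl⟩
      filter_upwards [hne] with z hz
      rw [integral_pow_mul_gaussInt_succ h hc (by positivity) z,
        show 2 * l + 2 * (b + 1) - 2 * (m + 1) = 2 * l + 2 * b - 2 * m by omega,
        Nat.add_sub_cancel]
      ring

/-! ### The heat kernel in continuous time -/

/-- The heat kernel at time `t` of the walk with characteristic function `φ` run in continuous time
with unit jump rate, multiplied by the area of the dual cell `D`. -/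
noncomputable def heatKernel (φ : ℂ → ℂ) (D : Set ℂ) (t : ℝ) (z : ℂ) : ℂ :=
  ∫ θ in D, Complex.exp (-⟪z, θ⟫ * Complex.I) * Complex.exp (-(t * (1 - φ θ)))

theorem norm_exp_neg_inner_mul_I (z θ : ℂ) : ‖Complex.exp (-⟪z, θ⟫ * Complex.I)‖ = 1 := by
  rw [← Complex.ofReal_neg, Complex.norm_exp_ofReal_mul_I]

theorem norm_one_sub_exp_neg_inner_le (z θ : ℂ) :
    ‖1 - Complex.exp (-⟪z, θ⟫ * Complex.I)‖ ≤ ‖z‖ * ‖θ‖ := by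
  rw [norm_sub_rev]
  have h := norm_exp_sub_sum_le_pow_mul_max 1 (-⟪z, θ⟫ * Complex.I)
  have h1 : (-(⟪z, θ⟫ : ℂ) * Complex.I).re = 0 := by simp
  rw [h1] at h
  simp only [Finset.range_one, Finset.sum_singleton, pow_zero, Nat.factorial_zero, Nat.cast_one,
    div_one, pow_one, Real.exp_zero, max_self, mul_one, norm_mul, norm_neg, Complex.norm_I,
    Complex.norm_real] at h
  exact h.trans (norm_inner_le_norm z θ)

theorem integrableOn_inv_norm {D : Set ℂ} (hD : IsCompact D) :
    IntegrableOn (fun θ : ℂ => ‖θ‖⁻¹) D := by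
  have h1 : Integrable fun θ : ℂ => ‖θ‖ ^ (-1 : ℝ) * Real.exp (-‖θ‖ ^ (1 : ℝ)) := by
    refine Integrable.of_integral_ne_zero ?_
    rw [Complex.integral_rpow_mul_exp_neg_rpow le_rfl (by norm_num)]
    have : 0 < Real.Gamma ((-1 + 2 : ℝ) / 1) := Real.Gamma_pos_of_pos (by norm_num)
    have := Real.pi_pos
    positivity
  obtain ⟨B, hB⟩ := hD.isBounded.exists_norm_le
  refine ((h1.integrableOn (s := D)).const_mul (Real.exp B)).mono'
    (by fun_prop) ?_
  filter_upwards [ae_restrict_mem hD.measurableSet] with θ hθ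
  rw [Real.norm_of_nonneg (by positivity), Real.rpow_neg_one, Real.rpow_one, mul_left_comm,
    ← Real.exp_add]
  exact le_mul_of_one_le_right (by positivity) (Real.one_le_exp (by linarith [hB θ hθ]))

section

variable {φ : ℂ → ℂ} {D : Set ℂ} {c κ : ℝ}

theorem IsStepCharFun.isFiniteMeasure (h : IsStepCharFun φ D c κ) :
    IsFiniteMeasure (volume.restrict D) :=
  ⟨by simpa using h.isCompact.measure_lt_top⟩

theorem IsStepCharFun.re_pos (h : IsStepCharFun φ D c κ) {θ : ℂ} (hθ : θ ∈ D) (h0 : θ ≠ 0) :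
    0 < (1 - φ θ).re := by
  have h1 := h.re_ge θ hθ
  have h2 := h.pos
  have h3 : 0 < ‖θ‖ := norm_pos_iff.2 h0
  rw [Complex.sub_re, Complex.one_re]
  exact lt_of_lt_of_le (by positivity) h1

theorem norm_exp_neg_mul_one_sub (φ : ℂ → ℂ) (t : ℝ) (θ : ℂ) :
    ‖Complex.exp (-(t * (1 - φ θ)))‖ = Real.exp (-(1 - φ θ).re * t) := by
  rw [Complex.norm_exp, Complex.neg_re, Complex.re_ofReal_mul]
  ring_nf

theorem IsStepCharFun.integrableOn_heatKernel (h : IsStepCharFun φ D c κ) (t : ℝ) (z : ℂ) :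
    IntegrableOn (fun θ => Complex.exp (-⟪z, θ⟫ * Complex.I) * Complex.exp (-(t * (1 - φ θ))))
      D := by
  have := h.continuous
  exact ContinuousOn.integrableOn_compact h.isCompact (by fun_prop)

theorem IsStepCharFun.div_norm_le (h : IsStepCharFun φ D c κ) (z : ℂ) {θ : ℂ} (hθ : θ ∈ D)
    (h0 : θ ≠ 0) : ‖1 - Complex.exp (-⟪z, θ⟫ * Complex.I)‖ / (1 - φ θ).re ≤
      ‖z‖ / κ * ‖θ‖⁻¹ := by
  have h3 : 0 < ‖θ‖ := norm_pos_iff.2 h0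
  have h4 := h.pos
  have h1 := h.re_ge θ hθ
  have h2 := h.re_pos hθ h0
  rw [Complex.sub_re, Complex.one_re] at h2 ⊢
  rw [div_le_iff₀ h2]
  refine (norm_one_sub_exp_neg_inner_le z θ).trans ?_
  calc ‖z‖ * ‖θ‖ = ‖z‖ / κ * ‖θ‖⁻¹ * (κ * ‖θ‖ ^ 2) := by field_simp
    _ ≤ _ := by gcongr

/-- The partial sums of the potential kernel, in Fourier variables, converge. -/
theorem IsStepCharFun.tendsto_sum (h : IsStepCharFun φ D c κ) (hlt : ∀ᵐ θ : ℂ, ‖φ θ‖ < 1)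
    (z : ℂ) : Tendsto (fun N : ℕ => ∑ n ∈ Finset.range N,
      ((∫ θ in D, Complex.exp (-⟪(0 : ℂ), θ⟫ * Complex.I) * φ θ ^ n) -
        ∫ θ in D, Complex.exp (-⟪z, θ⟫ * Complex.I) * φ θ ^ n)) atTop
      (𝓝 (∫ θ in D, (1 - Complex.exp (-⟪z, θ⟫ * Complex.I)) / (1 - φ θ))) := by
  have hcts := h.continuous
  have hint : ∀ (w : ℂ) (n : ℕ), IntegrableOn
      (fun θ => Complex.exp (-⟪w, θ⟫ * Complex.I) * φ θ ^ n) D := fun w n =>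
    ContinuousOn.integrableOn_compact h.isCompact (by fun_prop)
  have hsum : ∀ N : ℕ, (∑ n ∈ Finset.range N,
      ((∫ θ in D, Complex.exp (-⟪(0 : ℂ), θ⟫ * Complex.I) * φ θ ^ n) -
        ∫ θ in D, Complex.exp (-⟪z, θ⟫ * Complex.I) * φ θ ^ n)) =
      ∫ θ in D, (1 - Complex.exp (-⟪z, θ⟫ * Complex.I)) * ∑ n ∈ Finset.range N, φ θ ^ n := by
    intro N
    simp_rw [Finset.mul_sum]
    rw [integral_finsetSum _ fun n _ =>
      ContinuousOn.integrableOn_compact h.isCompact (by fun_prop)]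
    refine Finset.sum_congr rfl fun n _ => ?_
    rw [← integral_sub (hint 0 n) (hint z n)]
    congr 1
    ext θ
    simp
    ring
  simp_rw [hsum]
  have hne0 : ∀ᵐ θ : ℂ, θ ≠ 0 := by
    simpa using (Set.countable_singleton (0 : ℂ)).ae_notMem volume
  refine tendsto_integral_of_dominated_convergence (fun θ => 2 * (‖z‖ / κ * ‖θ‖⁻¹))
    (fun N => by fun_prop)
    (((integrableOn_inv_norm h.isCompact).const_mul _).const_mul _) (fun N => ?_) ?_
  · filter_upwards [ae_restrict_mem h.isCompact.measurableSet, ae_restrict_of_ae hne0]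
      with θ hθ h0
    have hre := h.re_pos hθ h0
    have hφ1 : φ θ ≠ 1 := fun hcon => by simp [hcon] at hre
    rw [geom_sum_eq hφ1, ← neg_sub 1, ← neg_sub 1 (φ θ), neg_div_neg_eq, norm_mul, norm_div,
      mul_div_assoc', mul_comm, mul_div_assoc]
    have h1 : ‖1 - φ θ ^ N‖ ≤ 2 := by
      refine (norm_sub_le _ _).trans ?_
      rw [norm_one, norm_pow]
      linarith [pow_le_one₀ (norm_nonneg _) (h.norm_le θ) (n := N)]
    refine mul_le_mul h1 (le_trans ?_ (h.div_norm_le z hθ h0)) (by positivity) (by norm_num)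
    exact div_le_div_of_nonneg_left (norm_nonneg _) hre (Complex.re_le_norm _)
  · filter_upwards [ae_restrict_of_ae hlt] with θ hθ
    rw [div_eq_mul_inv]
    exact ((hasSum_geometric_of_norm_lt_one hθ).tendsto_sum_nat).const_mul _

/-- The potential kernel as an integral over time of the heat kernel. -/
theorem IsStepCharFun.integral_heatKernel (h : IsStepCharFun φ D c κ) (z : ℂ) :
    IntegrableOn (fun t => heatKernel φ D t 0 - heatKernel φ D t z) (Set.Ioi 0) ∧
      ∫ t in Set.Ioi 0, (heatKernel φ D t 0 - heatKernel φ D t z) =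
        ∫ θ in D, (1 - Complex.exp (-⟪z, θ⟫ * Complex.I)) / (1 - φ θ) := by
  have hcts := h.continuous
  have hne0 : ∀ᵐ θ : ℂ, θ ≠ 0 := by
    simpa using (Set.countable_singleton (0 : ℂ)).ae_notMem volume
  have hfin := h.isFiniteMeasure
  let F : ℝ × ℂ → ℂ := fun p =>
    (1 - Complex.exp (-⟪z, p.2⟫ * Complex.I)) * Complex.exp (-(p.1 * (1 - φ p.2)))
  have hF : Continuous F := by fun_prop
  have hinner : ∀ θ ∈ D, θ ≠ 0 → IntegrableOn (fun t => F (t, θ)) (Set.Ioi 0) ∧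
      ∫ t in Set.Ioi 0, F (t, θ) = (1 - Complex.exp (-⟪z, θ⟫ * Complex.I)) / (1 - φ θ) := by
    intro θ hθ h0
    have hre : (-(1 - φ θ)).re < 0 := by rw [Complex.neg_re]; linarith [h.re_pos hθ h0]
    have e : ∀ t : ℝ, F (t, θ) = (1 - Complex.exp (-⟪z, θ⟫ * Complex.I)) *
        Complex.exp (-(1 - φ θ) * t) := fun t => by
      simp only [F]; congr 2; ring
    simp_rw [e]
    refine ⟨(integrableOn_exp_mul_complex_Ioi hre 0).const_mul _, ?_⟩
    rw [integral_const_mul, integral_exp_mul_complex_Ioi hre, Complex.ofReal_zero, mul_zero,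
      Complex.exp_zero, neg_div_neg_eq, mul_one_div]
  have hint : Integrable F ((volume.restrict (Set.Ioi 0)).prod (volume.restrict D)) := by
    rw [integrable_prod_iff' hF.aestronglyMeasurable]
    constructor
    · filter_upwards [ae_restrict_mem h.isCompact.measurableSet, ae_restrict_of_ae hne0]
        with θ hθ h0
      exact (hinner θ hθ h0).1
    · refine ((integrableOn_inv_norm h.isCompact).const_mul (‖z‖ / κ)).mono'
        (AEStronglyMeasurable.norm hF.aestronglyMeasurable).prod_swap.integral_prod_right' ?_
      filter_upwards [ae_restrict_mem h.isCompact.measurableSet, ae_restrict_of_ae hne0]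
        with θ hθ h0
      rw [Real.norm_of_nonneg (integral_nonneg fun t => norm_nonneg _)]
      refine le_trans (le_of_eq ?_) (h.div_norm_le z hθ h0)
      simp only [F, norm_mul, norm_exp_neg_mul_one_sub]
      rw [integral_const_mul, integral_exp_mul_Ioi (by linarith [h.re_pos hθ h0]), mul_zero,
        Real.exp_zero, neg_div_neg_eq, mul_one_div]
  have hker : ∀ t : ℝ, heatKernel φ D t 0 - heatKernel φ D t z = ∫ θ in D, F (t, θ) := by
    intro t
    rw [heatKernel, heatKernel, ← integral_sub (h.integrableOn_heatKernel t 0)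
      (h.integrableOn_heatKernel t z)]
    congr 1
    ext θ
    simp only [F, inner_zero_left, Complex.ofReal_zero, neg_zero, zero_mul, Complex.exp_zero]
    ring
  simp_rw [hker]
  refine ⟨hint.integral_prod_left, ?_⟩
  rw [integral_integral_swap hint]
  refine integral_congr_ae ?_
  filter_upwards [ae_restrict_mem h.isCompact.measurableSet, ae_restrict_of_ae hne0] with θ hθ h0
  exact (hinner θ hθ h0).2

theorem IsStepCharFun.continuous_heatKernel (h : IsStepCharFun φ D c κ) (z : ℂ) :
    Continuous fun t => heatKernel φ D t z := by
  have hcts := h.continuous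
  unfold heatKernel
  exact continuous_parametric_integral_of_continuous (by fun_prop) h.isCompact

end

section Walk

variable {Ω : Type*} [MeasurableSpace Ω] {μ : Measure Ω} {Z : Submodule ℤ ℂ} {R : ℕ → Ω → ℂ}

theorem IsRandomWalk.ae_norm_le (hR : IsRandomWalk μ Z R) {M : ℝ}
    (hM : ∀ᵐ x ∂(μ.map (R 1)), ‖x‖ ≤ M) (n : ℕ) : ∀ᵐ ω ∂μ, ‖R n ω‖ ≤ n * M := by
  induction n with
  | zero => simp [hR.start]
  | succ n ih =>
    have h1 : ∀ᵐ ω ∂μ, ‖R 1 ω - R 0 ω‖ ≤ M := by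
      filter_upwards [ae_of_ae_map (hR.measurable 1).aemeasurable hM] with ω hω
      rwa [hR.start, sub_zero]
    have h2 := (hR.identDistrib n).symm.ae_snd (p := fun x => ‖x‖ ≤ M)
      (measurableSet_le measurable_norm measurable_const) h1
    filter_upwards [ih, h2] with ω h3 h4
    have h5 : R (n + 1) ω = R n ω + (R (n + 1) ω - R n ω) := by ring
    rw [h5]
    refine (norm_add_le _ _).trans ?_
    push_cast
    linarith

variable [IsProbabilityMeasure μ]

theorem IsRandomWalk.hitProb_le_exp (hR : IsRandomWalk μ Z R) {M : ℝ} (hM0 : 0 < M)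
    (hM : ∀ᵐ x ∂(μ.map (R 1)), ‖x‖ ≤ M) (n : ℕ) (z : ℂ) :
    hitProb μ R n z ≤ Real.exp (n - ‖z‖ / M) := by
  by_cases hz : ‖z‖ ≤ n * M
  · have h1 : hitProb μ R n z ≤ 1 := measureReal_le_one
    refine h1.trans (Real.one_le_exp ?_)
    rw [sub_nonneg, div_le_iff₀ hM0]
    exact hz
  · have h0 : μ {ω | R n ω = z} = 0 := by
      refine measure_mono_null (fun ω hω => ?_) (ae_iff.1 (hR.ae_norm_le hM n))
      rw [Set.mem_ofPred_eq] at hω ⊢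
      rwa [hω]
    rw [hitProb, Measure.real, h0]
    simpa using Real.exp_nonneg _

/-- The heat kernel is a Poissonian mixture of the laws of the walk, so a walk with bounded steps
is unlikely to be far away after a short time. -/
theorem IsRandomWalk.norm_heatKernel_le_exp (hR : IsRandomWalk μ Z R)
    (b : Module.Basis (Fin 2) ℝ ℂ) (hb : Submodule.span ℤ (Set.range b) = Z) {M : ℝ}
    (hM0 : 0 < M) (hM : ∀ᵐ x ∂(μ.map (R 1)), ‖x‖ ≤ M) {t : ℝ} (ht : 0 ≤ t) {z : ℂ} (hz : z ∈ Z) :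
    ‖heatKernel (charFun (μ.map (R 1))) (dualCell b) t z‖ ≤
      volume.real (dualCell b) * Real.exp (2 * t - ‖z‖ / M) := by
  have hprob : IsProbabilityMeasure (μ.map (R 1)) :=
    Measure.isProbabilityMeasure_map (hR.measurable 1).aemeasurable
  set φ := charFun (μ.map (R 1)) with hφ
  have hcts : Continuous φ := by fun_prop
  have hle : ∀ θ, ‖φ θ‖ ≤ 1 := fun θ => by simpa using norm_charFun_le (μ := μ.map (R 1)) θ
  have hcomp := isCompact_dualCell b
  set V := volume.real (dualCell b) with hV
  have hfin : IsFiniteMeasure (volume.restrict (dualCell b)) :=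
    ⟨by simpa using hcomp.measure_lt_top⟩
  have hs : HasSum (fun n : ℕ => ∫ θ in dualCell b, Complex.exp (-⟪z, θ⟫ * Complex.I) *
      (Complex.exp (-t) * ((t * φ θ) ^ n / (n.factorial : ℂ))))
      (heatKernel φ (dualCell b) t z) := by
    refine hasSum_integral_of_dominated_convergence
      (fun n _ => Real.exp (-t) * (t ^ n / n.factorial)) (fun n => by fun_prop)
      (fun n => Eventually.of_forall fun θ => ?_)
      (Eventually.of_forall fun θ => ?_) ?_ (Eventually.of_forall fun θ => ?_)
    · rw [norm_mul, norm_exp_neg_inner_mul_I, one_mul, norm_mul, ← Complex.ofReal_neg,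
        Complex.norm_exp_ofReal, norm_div, norm_pow, norm_mul, Complex.norm_real,
        Complex.norm_natCast, Real.norm_of_nonneg ht]
      have : t * ‖φ θ‖ ≤ t := mul_le_of_le_one_right ht (hle θ)
      gcongr
    · exact (Real.summable_pow_div_factorial t).mul_left _
    · exact integrable_const _
    · have h1 := (NormedSpace.expSeries_div_hasSum_exp (t * φ θ)).mul_left
        (Complex.exp (-⟪z, θ⟫ * Complex.I) * Complex.exp (-t))
      rw [← Complex.exp_eq_exp_ℂ] at h1
      convert! h1 using 1
      · ext n; ring
      · rw [mul_assoc, ← Complex.exp_add (-(t : ℂ))]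
        congr 2
        ring
  have hterm : ∀ n : ℕ, ∫ θ in dualCell b, Complex.exp (-⟪z, θ⟫ * Complex.I) *
      (Complex.exp (-t) * ((t * φ θ) ^ n / (n.factorial : ℂ))) =
      ((Real.exp (-t) * (t ^ n / n.factorial) * (V * hitProb μ R n z) : ℝ) : ℂ) := by
    intro n
    rw [Complex.ofReal_mul, hR.hitProb_eq_integral b hb n z hz, ← integral_const_mul]
    congr 1
    ext θ
    push_cast
    ring
  simp_rw [hterm] at hs
  have hmaj : HasSum (fun n : ℕ => V * Real.exp (-t - ‖z‖ / M) *
      ((t * Real.exp 1) ^ n / n.factorial)) (V * Real.exp (-t - ‖z‖ / M) *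
        Real.exp (t * Real.exp 1)) := by
    have := (NormedSpace.expSeries_div_hasSum_exp (t * Real.exp 1)).mul_left
      (V * Real.exp (-t - ‖z‖ / M))
    rwa [← Real.exp_eq_exp_ℝ] at this
  have hVnn : 0 ≤ V := measureReal_nonneg
  rw [← hs.tsum_eq]
  refine (tsum_of_norm_bounded hmaj fun n => ?_).trans ?_
  · have hp : 0 ≤ hitProb μ R n z := measureReal_nonneg
    rw [Complex.norm_real, Real.norm_of_nonneg (by positivity)]
    have h1 := hR.hitProb_le_exp hM0 hM n z
    calc _ ≤ Real.exp (-t) * (t ^ n / n.factorial) * (V * Real.exp (n - ‖z‖ / M)) := by gcongr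
      _ = _ := by
        rw [mul_pow, ← Real.exp_nat_mul, mul_one, Real.exp_sub, Real.exp_sub]
        ring
  · rw [mul_assoc, ← Real.exp_add]
    have h1 : Real.exp 1 ≤ 3 := Real.exp_one_lt_three.le
    have h2 : t * Real.exp 1 ≤ t * 3 := by gcongr
    gcongr
    linarith

end Walk

/-! ### Local expansion of the heat kernel -/

/-- The functions spanned by `t ^ m θ ^ a (conj θ) ^ b` with `m ≥ m₀` and `a + b ≥ 3 m`. Multiplied
by a Gaussian `exp (-c t |θ|²)`, they are the terms of the local expansion of the heat kernel. -/
def timePoly (m₀ : ℕ) : Submodule ℂ (ℝ → ℂ → ℂ) :=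
  Submodule.span ℂ {f | ∃ m a b : ℕ, m₀ ≤ m ∧ 3 * m ≤ a + b ∧
    f = fun (t : ℝ) (θ : ℂ) => (t : ℂ) ^ m * (θ ^ a * conj θ ^ b)}

/-- The Fourier integral of `Q t` against `exp (-c t |θ|²)`. -/
noncomputable def polyInt (Q : ℝ → ℂ → ℂ) (c t : ℝ) (z : ℂ) : ℂ :=
  ∫ θ : ℂ, Q t θ * Complex.exp (-⟪z, θ⟫ * Complex.I - (c * t : ℝ) * ‖θ‖ ^ 2)

theorem norm_exp_gauss (τ : ℝ) (z θ : ℂ) :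
    ‖Complex.exp (-⟪z, θ⟫ * Complex.I - τ * ‖θ‖ ^ 2)‖ = Real.exp (-τ * ‖θ‖ ^ 2) := by
  simpa using norm_gaussInt_integrand 0 0 τ z θ

theorem mul_mem_timePoly {m₀ m : ℕ} (hm : m₀ ≤ m) {f : ℂ → ℂ} (hf : f ∈ polyOrder (3 * m)) :
    (fun (t : ℝ) (θ : ℂ) => (t : ℂ) ^ m * f θ) ∈ timePoly m₀ := by
  induction hf using Submodule.span_induction with
  | mem f h =>
    obtain ⟨a, b, hab, rfl⟩ := h
    exact Submodule.subset_span ⟨m, a, b, hm, hab, rfl⟩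
  | zero => simpa [Pi.zero_def] using Submodule.zero_mem (timePoly m₀)
  | add f g _ _ hf hg =>
    convert! Submodule.add_mem _ hf hg using 1
    ext t θ
    simp [mul_add]
  | smul a f _ hf =>
    convert! Submodule.smul_mem _ a hf using 1
    ext t θ
    simp only [Pi.smul_apply, smul_eq_mul]
    ring

theorem timePoly_mono {m₀ m₁ : ℕ} (h : m₀ ≤ m₁) : timePoly m₁ ≤ timePoly m₀ := by
  refine Submodule.span_mono ?_
  rintro f ⟨m, a, b, hm, hab, rfl⟩
  exact ⟨m, a, b, h.trans hm, hab, rfl⟩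

theorem integrable_timePoly {Q : ℝ → ℂ → ℂ} (hQ : Q ∈ timePoly 0) {c t : ℝ} (hc : 0 < c)
    (ht : 0 < t) (z : ℂ) :
    Integrable fun θ => Q t θ * Complex.exp (-⟪z, θ⟫ * Complex.I - (c * t : ℝ) * ‖θ‖ ^ 2) := by
  induction hQ using Submodule.span_induction with
  | mem f h =>
    obtain ⟨m, a, b, -, -, rfl⟩ := h
    refine ((integrable_norm_pow_mul_exp (a + b) (mul_pos hc ht)).const_mul (t ^ m)).mono'
      (by fun_prop) (Eventually.of_forall fun θ => le_of_eq ?_)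
    rw [norm_mul, norm_exp_gauss, norm_mul, norm_mul, norm_pow, norm_pow, norm_pow,
      RCLike.norm_conj, Complex.norm_real, Real.norm_of_nonneg ht.le, pow_add]
    ring
  | zero => simp
  | add f g _ _ hf hg =>
    convert! hf.add hg using 1
    ext θ
    simp [add_mul]
  | smul a f _ hf =>
    convert! hf.const_mul a using 1
    ext θ
    simp only [Pi.smul_apply, smul_eq_mul]
    ring

/-- Away from the origin in Fourier space the terms of the expansion are negligible. -/
theorem exists_setIntegral_timePoly_le {Q : ℝ → ℂ → ℂ} (hQ : Q ∈ timePoly 0) {c δ : ℝ} (hc : 0 < c)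
    (hδ : 0 < δ) {S : Set ℂ} (hS : MeasurableSet S) (hSδ : ∀ θ ∈ S, δ ≤ ‖θ‖) (N : ℕ) :
    ∃ C : ℝ, 0 ≤ C ∧ ∀ t : ℝ, 1 ≤ t → ∀ z, ‖∫ θ in S, Q t θ *
      Complex.exp (-⟪z, θ⟫ * Complex.I - (c * t : ℝ) * ‖θ‖ ^ 2)‖ ≤ C * (t ^ N)⁻¹ := by
  induction hQ using Submodule.span_induction with
  | mem f h =>
    obtain ⟨m, a, b, -, -, rfl⟩ := h
    set k := a + b + 2 * (m + N) with hk
    have hG : 0 < Real.Gamma (((k : ℝ) + 2) / 2) := Real.Gamma_pos_of_pos (by positivity)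
    have hpi := Real.pi_pos
    refine ⟨(δ ^ (2 * (m + N)))⁻¹ * (Real.pi * Real.Gamma (((k : ℝ) + 2) / 2)) *
      c ^ (-((k : ℝ) + 2) / 2), by positivity, fun t ht z => ?_⟩
    have ht0 : 0 < t := by linarith
    have hint := (integrable_norm_pow_mul_exp k (mul_pos hc ht0)).const_mul
      (t ^ m * (δ ^ (2 * (m + N)))⁻¹)
    have h1 : ‖∫ θ in S, (t : ℂ) ^ m * (θ ^ a * conj θ ^ b) *
        Complex.exp (-⟪z, θ⟫ * Complex.I - (c * t : ℝ) * ‖θ‖ ^ 2)‖ ≤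
        ∫ θ : ℂ, t ^ m * (δ ^ (2 * (m + N)))⁻¹ * (‖θ‖ ^ k * Real.exp (-(c * t) * ‖θ‖ ^ 2)) := by
      refine (norm_integral_le_of_norm_le hint.integrableOn ?_).trans
        (setIntegral_le_integral hint (Eventually.of_forall fun θ => by positivity))
      filter_upwards [ae_restrict_mem hS] with θ hθ
      rw [norm_mul, norm_exp_gauss, norm_mul, norm_mul, norm_pow, norm_pow, norm_pow,
        RCLike.norm_conj, Complex.norm_real, Real.norm_of_nonneg ht0.le, ← pow_add,
        ← mul_assoc (t ^ m * (δ ^ (2 * (m + N)))⁻¹)]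
      refine mul_le_mul_of_nonneg_right ?_ (Real.exp_nonneg _)
      have h2 : 1 ≤ (δ ^ (2 * (m + N)))⁻¹ * ‖θ‖ ^ (2 * (m + N)) := by
        rw [← div_eq_inv_mul, one_le_div (by positivity)]
        exact pow_le_pow_left₀ hδ.le (hSδ θ hθ) _
      calc t ^ m * ‖θ‖ ^ (a + b) ≤ t ^ m * ‖θ‖ ^ (a + b) *
            ((δ ^ (2 * (m + N)))⁻¹ * ‖θ‖ ^ (2 * (m + N))) :=
            le_mul_of_one_le_right (by positivity) h2
        _ = _ := by rw [hk, pow_add ‖θ‖ (a + b)]; ring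
    refine h1.trans ?_
    rw [integral_const_mul, integral_norm_pow_mul_exp k (mul_pos hc ht0),
      Real.mul_rpow hc.le ht0.le]
    have h3 : t ^ (-((k : ℝ) + 2) / 2) ≤ (t ^ m * t ^ N)⁻¹ := by
      rw [← pow_add, ← Real.rpow_natCast, ← Real.rpow_neg ht0.le]
      refine Real.rpow_le_rpow_of_exponent_le ht ?_
      rw [hk]
      push_cast
      have : (0 : ℝ) ≤ a := a.cast_nonneg
      have : (0 : ℝ) ≤ b := b.cast_nonneg
      linarith
    calc _ = (δ ^ (2 * (m + N)))⁻¹ * (Real.pi * Real.Gamma (((k : ℝ) + 2) / 2)) *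
          c ^ (-((k : ℝ) + 2) / 2) * (t ^ m * t ^ (-((k : ℝ) + 2) / 2)) := by ring
      _ ≤ (δ ^ (2 * (m + N)))⁻¹ * (Real.pi * Real.Gamma (((k : ℝ) + 2) / 2)) *
          c ^ (-((k : ℝ) + 2) / 2) * (t ^ m * (t ^ m * t ^ N)⁻¹) := by gcongr
      _ = _ := by
        congr 1
        field_simp
  | zero => exact ⟨0, le_rfl, by simp⟩
  | add f g hf' hg' hf hg =>
    obtain ⟨C, hC, h⟩ := hf
    obtain ⟨C', hC', h'⟩ := hg
    refine ⟨C + C', by positivity, fun t ht z => ?_⟩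
    have ht0 : 0 < t := by linarith
    simp only [Pi.add_apply, add_mul]
    rw [integral_add (integrable_timePoly hf' hc ht0 z).integrableOn
      (integrable_timePoly hg' hc ht0 z).integrableOn]
    exact (norm_add_le _ _).trans (add_le_add (h t ht z) (h' t ht z))
  | smul a f _ hf =>
    obtain ⟨C, hC, h⟩ := hf
    refine ⟨‖a‖ * C, by positivity, fun t ht z => ?_⟩
    simp only [Pi.smul_apply, smul_eq_mul, mul_assoc]
    rw [integral_const_mul, norm_mul]
    refine mul_le_mul_of_nonneg_left ?_ (norm_nonneg _)
    exact h t ht z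

theorem exists_pow_sub_pow_le {X : Type*} {S : Set X} {f g : X → ℂ} {r : X → ℝ} {B b₁ b₂ : ℝ}
    (hB : 0 ≤ B) (hb₁ : 0 ≤ b₁) (hr : ∀ x, 0 ≤ r x) (h : ∀ x ∈ S, ‖f x - g x‖ ≤ B * r x)
    (hf : ∀ x ∈ S, ‖f x‖ ≤ b₁) (hg : ∀ x ∈ S, ‖g x‖ ≤ b₂) (m : ℕ) :
    ∃ C, 0 ≤ C ∧ ∀ x ∈ S, ‖f x ^ m - g x ^ m‖ ≤ C * r x := by
  induction m with
  | zero => exact ⟨0, le_rfl, by simp⟩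
  | succ m ih =>
    obtain ⟨C, hC, hm⟩ := ih
    refine ⟨b₁ * C + B * |b₂| ^ m, by positivity, fun x hx => ?_⟩
    have e : f x ^ (m + 1) - g x ^ (m + 1) =
        f x * (f x ^ m - g x ^ m) + (f x - g x) * g x ^ m := by ring
    rw [e]
    refine (norm_add_le _ _).trans ?_
    rw [norm_mul, norm_mul, norm_pow, add_mul, mul_assoc, mul_right_comm B]
    have h1 := hf x hx
    have h2 := hm x hx
    have h3 := h x hx
    have h4 : ‖g x‖ ≤ |b₂| := (hg x hx).trans (le_abs_self _)
    have h5 := hr x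
    gcongr

/-- The local expansion of the heat kernel: an Edgeworth expansion, uniform in space. -/
theorem IsStepCharFun.exists_heatKernel_expansion {φ : ℂ → ℂ} {D : Set ℂ} {c κ : ℝ}
    (h : IsStepCharFun φ D c κ) (K : ℕ) (hK : 1 ≤ K) :
    ∃ Q ∈ timePoly 1, ∃ C : ℝ, 0 ≤ C ∧ ∀ t : ℝ, 1 ≤ t → ∀ z,
      ‖heatKernel φ D t z - gaussInt 0 0 (c * t) z - polyInt Q c t z‖ ≤ C * (t ^ (K + 1))⁻¹ := by
  have hcts := h.continuous
  have hκ := h.pos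
  have hc : 0 < c := hκ.trans_le h.le
  have hDm := h.isCompact.measurableSet
  obtain ⟨E, hE, B, hB, hEB⟩ := h.expansion (6 * K) (by omega)
  have hEc := continuous_of_mem_polyOrder hE
  set e : ℂ → ℂ := fun θ => φ θ - 1 + c * ‖θ‖ ^ 2 with he
  have hec : Continuous e := by fun_prop
  -- a cubic bound for `e`
  obtain ⟨B₁, hB₁, he3⟩ : ∃ B₁, 0 ≤ B₁ ∧ ∀ θ ∈ D, ‖e θ‖ ≤ B₁ * ‖θ‖ ^ 3 := by
    obtain ⟨E₃, hE₃, B₃, hB₃, h₃⟩ := h.expansion 3 le_rfl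
    obtain ⟨B', hB', h'⟩ := exists_bound_of_mem_polyOrder hE₃ h.isCompact
    refine ⟨B₃ + B', by positivity, fun θ hθ => ?_⟩
    have := norm_add_le (e θ - E₃ θ) (E₃ θ)
    rw [sub_add_cancel] at this
    refine this.trans ?_
    rw [add_mul]
    exact add_le_add (h₃ θ) (h' θ hθ)
  obtain ⟨b₁, hb₁⟩ := h.isCompact.exists_bound_of_continuousOn hec.continuousOn
  obtain ⟨b₂, hb₂⟩ := h.isCompact.exists_bound_of_continuousOn hEc.continuousOn
  have hpd : ∀ m : ℕ, ∃ C, 0 ≤ C ∧ ∀ θ ∈ D, ‖e θ ^ m - E θ ^ m‖ ≤ C * ‖θ‖ ^ (6 * K) :=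
    exists_pow_sub_pow_le (r := fun θ : ℂ => ‖θ‖ ^ (6 * K)) hB (abs_nonneg b₁)
      (fun θ => by positivity) (fun θ _ => hEB θ)
      (fun θ hθ => (hb₁ θ hθ).trans (le_abs_self _)) hb₂
  choose G hG hGle using hpd
  -- the polynomial part of `exp (t e)`, without and with its constant term
  let Q : ℝ → ℂ → ℂ := ∑ i ∈ Finset.range (2 * K - 1),
    (((i + 1).factorial : ℂ)⁻¹) • fun (t : ℝ) (θ : ℂ) => (t : ℂ) ^ (i + 1) * (E ^ (i + 1)) θ
  have hQ : Q ∈ timePoly 1 := Submodule.sum_mem _ fun i _ => Submodule.smul_mem _ _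
    (mul_mem_timePoly (by omega) (by rw [mul_comm]; exact polyOrder_pow hE (i + 1)))
  let Q₁ : ℝ → ℂ → ℂ := (fun (t : ℝ) (θ : ℂ) => (t : ℂ) ^ 0 * (θ ^ 0 * conj θ ^ 0)) + Q
  have hQ₁ : Q₁ ∈ timePoly 0 := Submodule.add_mem _
    (Submodule.subset_span ⟨0, 0, 0, le_rfl, le_rfl, rfl⟩) (timePoly_mono zero_le_one hQ)
  have hQ₁eq : ∀ t θ, Q₁ t θ = ∑ m ∈ Finset.range (2 * K), (t * E θ) ^ m / (m.factorial : ℂ) := by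
    intro t θ
    obtain ⟨n, hn⟩ := Nat.exists_eq_add_of_le' (show 1 ≤ 2 * K by omega)
    simp only [Q₁, Q, hn, Nat.add_sub_cancel]
    rw [Finset.sum_range_succ', add_comm]
    simp only [Pi.add_apply, Finset.sum_apply, Pi.smul_apply, smul_eq_mul, Pi.pow_apply]
    congr 1
    · refine Finset.sum_congr rfl fun i _ => ?_
      ring
    · simp
  obtain ⟨δ, hδ, hball⟩ := Metric.mem_nhds_iff.1 h.mem_nhds
  obtain ⟨C₂, hC₂, htail⟩ := exists_setIntegral_timePoly_le hQ₁ hc hδ hDm.compl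
    (fun θ hθ => by
      by_contra! hlt
      exact hθ (hball (by simpa using hlt))) (K + 1)
  set C₁ : ℝ := B₁ ^ (2 * K) + ∑ m ∈ Finset.range (2 * K), G m with hC₁
  have hC₁0 : 0 ≤ C₁ := add_nonneg (by positivity) (Finset.sum_nonneg fun m _ => hG m)
  -- the pointwise estimate on the cell: Taylor's formula of order `2 K` for `exp (t e)` and the
  -- error of order `6 K` of `E` both give `t ^ (2 K) |θ| ^ (6 K)`, which integrates to
  -- `t ^ (-K - 1)`
  have hpt : ∀ t : ℝ, 1 ≤ t → ∀ z, ∀ θ ∈ D,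
      ‖Complex.exp (-⟪z, θ⟫ * Complex.I) * Complex.exp (-(t * (1 - φ θ))) -
        Q₁ t θ * Complex.exp (-⟪z, θ⟫ * Complex.I - (c * t : ℝ) * ‖θ‖ ^ 2)‖ ≤
      C₁ * t ^ (2 * K) * (‖θ‖ ^ (6 * K) * Real.exp (-(κ * t) * ‖θ‖ ^ 2)) := by
    intro t ht z θ hθ
    have ht0 : 0 < t := by linarith
    have e1 : Complex.exp (-⟪z, θ⟫ * Complex.I) * Complex.exp (-(t * (1 - φ θ))) -
        Q₁ t θ * Complex.exp (-⟪z, θ⟫ * Complex.I - (c * t : ℝ) * ‖θ‖ ^ 2) =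
        Complex.exp (-⟪z, θ⟫ * Complex.I - (c * t : ℝ) * ‖θ‖ ^ 2) *
          ((Complex.exp (t * e θ) - ∑ m ∈ Finset.range (2 * K), (t * e θ) ^ m / (m.factorial : ℂ)) +
          ∑ m ∈ Finset.range (2 * K), (t : ℂ) ^ m * (e θ ^ m - E θ ^ m) / (m.factorial : ℂ)) := by
      have e2 : Complex.exp (-⟪z, θ⟫ * Complex.I) * Complex.exp (-(t * (1 - φ θ))) =
          Complex.exp (-⟪z, θ⟫ * Complex.I - (c * t : ℝ) * ‖θ‖ ^ 2) * Complex.exp (t * e θ) := by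
        rw [← Complex.exp_add, ← Complex.exp_add]
        congr 1
        simp only [he]
        push_cast
        ring
      have e3 : ∑ m ∈ Finset.range (2 * K), (t : ℂ) ^ m * (e θ ^ m - E θ ^ m) / (m.factorial : ℂ) =
          (∑ m ∈ Finset.range (2 * K), (t * e θ) ^ m / (m.factorial : ℂ)) - Q₁ t θ := by
        rw [hQ₁eq, ← Finset.sum_sub_distrib]
        refine Finset.sum_congr rfl fun m _ => ?_
        ring_nf
      rw [e2, e3]
      ring
    rw [e1, norm_mul, norm_exp_gauss]
    have hx : 0 ≤ ‖θ‖ ^ 2 := by positivity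
    have hexp1 : Real.exp (-(c * t) * ‖θ‖ ^ 2) ≤ Real.exp (-(κ * t) * ‖θ‖ ^ 2) := by
      have := h.le
      gcongr
    have hexp2 : Real.exp (-(c * t) * ‖θ‖ ^ 2) * Real.exp (t * e θ).re ≤
        Real.exp (-(κ * t) * ‖θ‖ ^ 2) := by
      rw [← Real.exp_add]
      refine Real.exp_le_exp.2 ?_
      have hre : (e θ).re = (φ θ).re - 1 + c * ‖θ‖ ^ 2 := by
        simp only [he]
        rw [← Complex.ofReal_pow, ← Complex.ofReal_mul, Complex.add_re, Complex.sub_re,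
          Complex.ofReal_re, Complex.one_re]
      rw [Complex.re_ofReal_mul, hre]
      have := mul_le_mul_of_nonneg_left (h.re_ge θ hθ) ht0.le
      linarith
    have hA : Real.exp (-(c * t) * ‖θ‖ ^ 2) * ‖Complex.exp (t * e θ) -
        ∑ m ∈ Finset.range (2 * K), (t * e θ) ^ m / (m.factorial : ℂ)‖ ≤
        B₁ ^ (2 * K) * t ^ (2 * K) * (‖θ‖ ^ (6 * K) * Real.exp (-(κ * t) * ‖θ‖ ^ 2)) := by
      have h1 := norm_exp_sub_sum_le_pow_mul_max (2 * K) (t * e θ)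
      have h2 : Real.exp (-(c * t) * ‖θ‖ ^ 2) * max 1 (Real.exp (t * e θ).re) ≤
          Real.exp (-(κ * t) * ‖θ‖ ^ 2) := by
        rw [mul_max_of_nonneg _ _ (Real.exp_nonneg _), mul_one]
        exact max_le hexp1 hexp2
      have h3 : ‖(t : ℂ) * e θ‖ ^ (2 * K) ≤ B₁ ^ (2 * K) * t ^ (2 * K) * ‖θ‖ ^ (6 * K) := by
        rw [norm_mul, Complex.norm_real, Real.norm_of_nonneg ht0.le]
        have := he3 θ hθ
        calc (t * ‖e θ‖) ^ (2 * K) ≤ (t * (B₁ * ‖θ‖ ^ 3)) ^ (2 * K) := by gcongr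
          _ = _ := by rw [show 6 * K = 3 * (2 * K) by ring, pow_mul ‖θ‖ 3]; ring
      calc _ ≤ Real.exp (-(c * t) * ‖θ‖ ^ 2) *
            (‖(t : ℂ) * e θ‖ ^ (2 * K) * max 1 (Real.exp (t * e θ).re)) := by gcongr
        _ = ‖(t : ℂ) * e θ‖ ^ (2 * K) *
            (Real.exp (-(c * t) * ‖θ‖ ^ 2) * max 1 (Real.exp (t * e θ).re)) := by ring
        _ ≤ (B₁ ^ (2 * K) * t ^ (2 * K) * ‖θ‖ ^ (6 * K)) * Real.exp (-(κ * t) * ‖θ‖ ^ 2) := by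
            gcongr
        _ = _ := by ring
    have hBd : ‖∑ m ∈ Finset.range (2 * K), (t : ℂ) ^ m * (e θ ^ m - E θ ^ m) / (m.factorial : ℂ)‖
        ≤ (∑ m ∈ Finset.range (2 * K), G m) * t ^ (2 * K) * ‖θ‖ ^ (6 * K) := by
      rw [Finset.sum_mul, Finset.sum_mul]
      refine (norm_sum_le _ _).trans (Finset.sum_le_sum fun m hm => ?_)
      rw [norm_div, norm_mul, norm_pow, Complex.norm_real, Real.norm_of_nonneg ht0.le,
        Complex.norm_natCast]
      have h1 : (1 : ℝ) ≤ m.factorial := by exact_mod_cast m.factorial_pos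
      have h2 : t ^ m ≤ t ^ (2 * K) := pow_le_pow_right₀ ht (Finset.mem_range.1 hm).le
      have h3 := hGle m θ hθ
      calc _ ≤ t ^ m * ‖e θ ^ m - E θ ^ m‖ := div_le_self (by positivity) h1
        _ ≤ t ^ (2 * K) * (G m * ‖θ‖ ^ (6 * K)) := by gcongr
        _ = _ := by ring
    calc _ ≤ Real.exp (-(c * t) * ‖θ‖ ^ 2) * (‖Complex.exp (t * e θ) -
          ∑ m ∈ Finset.range (2 * K), (t * e θ) ^ m / (m.factorial : ℂ)‖ +
          ‖∑ m ∈ Finset.range (2 * K), (t : ℂ) ^ m * (e θ ^ m - E θ ^ m) / (m.factorial : ℂ)‖) := by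
          gcongr
          exact norm_add_le _ _
      _ ≤ B₁ ^ (2 * K) * t ^ (2 * K) * (‖θ‖ ^ (6 * K) * Real.exp (-(κ * t) * ‖θ‖ ^ 2)) +
          Real.exp (-(κ * t) * ‖θ‖ ^ 2) *
            ((∑ m ∈ Finset.range (2 * K), G m) * t ^ (2 * K) * ‖θ‖ ^ (6 * K)) := by
          rw [mul_add]
          gcongr
      _ = _ := by rw [hC₁]; ring
  have hGam : 0 < Real.Gamma ((((6 * K : ℕ) : ℝ) + 2) / 2) := Real.Gamma_pos_of_pos (by positivity)
  have hpi := Real.pi_pos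
  set C₃ : ℝ := C₁ * (Real.pi * Real.Gamma ((((6 * K : ℕ) : ℝ) + 2) / 2)) * (κ ^ (3 * K + 1))⁻¹
    with hC₃
  refine ⟨Q, hQ, C₃ + C₂, by positivity, fun t ht z => ?_⟩
  have ht0 : 0 < t := by linarith
  have hQint := integrable_timePoly (timePoly_mono zero_le_one hQ) hc ht0 z
  have hQ₁int := integrable_timePoly hQ₁ hc ht0 z
  have hfull : gaussInt 0 0 (c * t) z + polyInt Q c t z =
      (∫ θ in D, Q₁ t θ * Complex.exp (-⟪z, θ⟫ * Complex.I - (c * t : ℝ) * ‖θ‖ ^ 2)) +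
      ∫ θ in Dᶜ, Q₁ t θ * Complex.exp (-⟪z, θ⟫ * Complex.I - (c * t : ℝ) * ‖θ‖ ^ 2) := by
    rw [integral_add_compl hDm hQ₁int, gaussInt, polyInt,
      ← integral_add (integrable_gaussInt_integrand 0 0 (mul_pos hc ht0) z) hQint]
    congr 1
    ext θ
    simp only [Q₁, Pi.add_apply, pow_zero, mul_zero, mul_one, one_mul, add_mul]
  have hsub : heatKernel φ D t z - gaussInt 0 0 (c * t) z - polyInt Q c t z =
      (∫ θ in D, (Complex.exp (-⟪z, θ⟫ * Complex.I) * Complex.exp (-(t * (1 - φ θ))) -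
        Q₁ t θ * Complex.exp (-⟪z, θ⟫ * Complex.I - (c * t : ℝ) * ‖θ‖ ^ 2))) -
      ∫ θ in Dᶜ, Q₁ t θ * Complex.exp (-⟪z, θ⟫ * Complex.I - (c * t : ℝ) * ‖θ‖ ^ 2) := by
    rw [integral_sub (h.integrableOn_heatKernel t z) hQ₁int.integrableOn, sub_sub, hfull,
      heatKernel]
    ring
  rw [hsub, add_mul]
  refine (norm_sub_le _ _).trans (add_le_add ?_ (htail t ht z))
  have hdom := (integrable_norm_pow_mul_exp (6 * K) (mul_pos hκ ht0)).const_mul (C₁ * t ^ (2 * K))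
  refine (norm_integral_le_of_norm_le hdom.integrableOn ?_).trans
    ((setIntegral_le_integral hdom (Eventually.of_forall fun θ => by positivity)).trans
      (le_of_eq ?_))
  · filter_upwards [ae_restrict_mem hDm] with θ hθ
    exact hpt t ht z θ hθ
  · rw [integral_const_mul, integral_norm_pow_mul_exp _ (mul_pos hκ ht0),
      show -(((6 * K : ℕ) : ℝ) + 2) / 2 = -((3 * K + 1 : ℕ) : ℝ) by push_cast; ring,
      Real.rpow_neg (by positivity), Real.rpow_natCast, mul_pow, mul_inv, hC₃]
    have : t ^ (3 * K + 1) = t ^ (2 * K) * t ^ (K + 1) := by rw [← pow_add]; ring_nf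
    rw [this, mul_inv]
    field_simp

/-! ### The corrections to the Gaussian approximation -/

theorem conj_mul_self_pow (θ : ℂ) (b : ℕ) : θ ^ b * conj θ ^ b = (‖θ‖ : ℂ) ^ (2 * b) := by
  rw [← mul_pow, Complex.mul_conj, Complex.normSq_eq_norm_sq, pow_mul, Complex.ofReal_pow]

theorem polyInt_monomial_of_le {a b : ℕ} (hab : b ≤ a) (m : ℕ) (c t : ℝ) (z : ℂ) :
    polyInt (fun (t : ℝ) (θ : ℂ) => (t : ℂ) ^ m * (θ ^ a * conj θ ^ b)) c t z =
      (t : ℂ) ^ m * gaussInt (a - b) b (c * t) z := by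
  rw [polyInt, gaussInt, ← integral_const_mul]
  congr 1
  ext θ
  rw [← conj_mul_self_pow, ← mul_assoc (θ ^ (a - b)), ← pow_add, Nat.sub_add_cancel hab]
  ring

theorem polyInt_monomial_of_ge {a b : ℕ} (hab : a ≤ b) (m : ℕ) (c t : ℝ) (z : ℂ) :
    polyInt (fun (t : ℝ) (θ : ℂ) => (t : ℂ) ^ m * (θ ^ a * conj θ ^ b)) c t z =
      conj ((t : ℂ) ^ m * gaussInt (b - a) a (c * t) (-z)) := by
  rw [polyInt, gaussInt, ← integral_const_mul, ← integral_conj]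
  congr 1
  ext θ
  rw [← conj_mul_self_pow, ← mul_assoc (θ ^ (b - a)), ← pow_add, Nat.sub_add_cancel hab]
  simp only [map_mul, map_pow, Complex.conj_ofReal, Complex.conj_conj, ← Complex.exp_conj, map_sub,
    map_neg, Complex.conj_I, inner_neg_left, Complex.ofReal_neg]
  ring_nf

theorem polyInt_add {f g : ℝ → ℂ → ℂ} (hf : f ∈ timePoly 0) (hg : g ∈ timePoly 0) {c t : ℝ}
    (hc : 0 < c) (ht : 0 < t) (z : ℂ) :
    polyInt (f + g) c t z = polyInt f c t z + polyInt g c t z := by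
  rw [polyInt, polyInt, polyInt,
    ← integral_add (integrable_timePoly hf hc ht z) (integrable_timePoly hg hc ht z)]
  congr 1
  ext θ
  simp only [Pi.add_apply, add_mul]

theorem polyInt_smul (a : ℂ) (f : ℝ → ℂ → ℂ) (c t : ℝ) (z : ℂ) :
    polyInt (a • f) c t z = a * polyInt f c t z := by
  rw [polyInt, polyInt, ← integral_const_mul]
  congr 1
  ext θ
  simp only [Pi.smul_apply, smul_eq_mul, mul_assoc]

theorem integrableOn_polyInt {Q : ℝ → ℂ → ℂ} (hQ : Q ∈ timePoly 1) {c T : ℝ} (hc : 0 < c)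
    (hT : 0 < T) (z : ℂ) : IntegrableOn (fun t => polyInt Q c t z) (Set.Ioi T) := by
  induction hQ using Submodule.span_induction with
  | mem f h =>
    obtain ⟨m, a, b, hm, hab, rfl⟩ := h
    rcases le_total b a with hba | hba
    · simp_rw [polyInt_monomial_of_le hba]
      exact integrableOn_pow_mul_gaussInt (by omega) hc hT z
    · simp_rw [polyInt_monomial_of_ge hba]
      exact (Complex.conjLIE.integrable_comp_iff (μ := volume.restrict (Set.Ioi T))).2
        (integrableOn_pow_mul_gaussInt (by omega) hc hT (-z))
  | zero => simp [polyInt]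
  | add f g hf' hg' hf hg =>
    refine (hf.add hg).congr_fun (fun t ht => ?_) measurableSet_Ioi
    exact (polyInt_add (timePoly_mono zero_le_one hf') (timePoly_mono zero_le_one hg') hc
      (hT.trans ht) z).symm
  | smul a f _ hf =>
    simp_rw [polyInt_smul]
    exact hf.const_mul a

/-- The sum of the terms `α z ^ l / |z| ^ k` with the given coefficients. -/
noncomputable def homSum (c : ℕ × ℕ →₀ ℂ) (z : ℂ) : ℂ :=
  c.sum fun p a => a * (z ^ p.1 / (‖z‖ : ℂ) ^ p.2)

theorem homSum_add (c c' : ℕ × ℕ →₀ ℂ) (z : ℂ) : homSum (c + c') z = homSum c z + homSum c' z :=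
  Finsupp.sum_add_index' (by simp) (by intros; ring)

theorem homSum_neg (c : ℕ × ℕ →₀ ℂ) (z : ℂ) : homSum (-c) z = -homSum c z := by
  rw [homSum, homSum, Finsupp.sum_neg_index (by simp), Finsupp.sum, Finsupp.sum,
    ← Finset.sum_neg_distrib]
  exact Finset.sum_congr rfl fun p _ => by ring

theorem homSum_single (p : ℕ × ℕ) (a z : ℂ) :
    homSum (Finsupp.single p a) z = a * (z ^ p.1 / (‖z‖ : ℂ) ^ p.2) :=
  Finsupp.sum_single_index (by simp)

/-- The coefficient families without radial terms, all of whose terms decay at infinity. -/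
def nonradial : Submodule ℂ (ℕ × ℕ →₀ ℂ) :=
  Finsupp.supported ℂ ℂ {p : ℕ × ℕ | 1 ≤ p.1 ∧ p.1 + 1 ≤ p.2}

theorem RapidDecay.re {f : ℂ → ℂ} (hf : RapidDecay f) : RapidDecay fun z => ((f z).re : ℂ) := by
  intro N
  refine IsBigO.trans (IsBigO.of_bound 1 (Eventually.of_forall fun z => ?_)) (hf N)
  rw [Complex.norm_real, one_mul]
  exact Complex.abs_re_le_norm _

theorem RapidDecay.comp_neg {f : ℂ → ℂ} (hf : RapidDecay f) : RapidDecay fun z => f (-z) := by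
  intro N
  have := (hf N).comp_tendsto (tendsto_neg_cobounded (E := ℂ))
  simpa [Function.comp_def] using this

/-- The contribution of the corrections to the heat kernel to the potential: a sum of homogeneous
terms, none of them radial. -/
theorem exists_integral_polyInt_expansion {Q : ℝ → ℂ → ℂ} (hQ : Q ∈ timePoly 1) {c ε : ℝ}
    (hc : 0 < c) (hε : 0 < ε) : ∀ s : ℂ, ∃ α ∈ nonradial, RapidDecay fun z =>
      (((s * ∫ t in Set.Ioi (ε * ‖z‖), polyInt Q c t z) - homSum α z).re : ℂ) := by
  have hpos : ∀ᶠ z : ℂ in Bornology.cobounded ℂ, 1 ≤ ‖z‖ :=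
    tendsto_norm_cobounded_atTop.eventually_ge_atTop 1
  induction hQ using Submodule.span_induction with
  | mem f h =>
    intro s
    obtain ⟨m, a, b, hm, hab, rfl⟩ := h
    -- a radial coefficient vanishes, so a single term can always be chosen nonradial
    have hmem : ∀ (l k : ℕ) (β : ℂ), (l = 0 → β = 0) → l + 1 ≤ k →
        Finsupp.single (l, k) β ∈ nonradial := by
      intro l k β hβ hk
      by_cases hl : l = 0
      · rw [hβ hl, Finsupp.single_zero]
        exact Submodule.zero_mem _
      · exact Finsupp.single_mem_supported ℂ β ⟨by simp only; omega, hk⟩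
    rcases le_total b a with hba | hba
    · obtain ⟨β, hβ, hr⟩ := exists_integral_gaussInt_expansion hc hε b (a - b) m (by omega)
      refine ⟨Finsupp.single (a - b, 2 * (a - b) + 2 * b - 2 * m) (s * β),
        hmem _ _ _ (fun h0 => by rw [hβ h0, mul_zero]) (by omega), ?_⟩
      simp_rw [polyInt_monomial_of_le hba, homSum_single, mul_assoc s, ← mul_sub]
      exact (hr.const_mul s).re
    · obtain ⟨β, hβ, hr⟩ := exists_integral_gaussInt_expansion hc hε a (b - a) m (by omega)
      refine ⟨Finsupp.single (b - a, 2 * (b - a) + 2 * a - 2 * m) (conj s * β * (-1) ^ (b - a)),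
        hmem _ _ _ (fun h0 => by rw [hβ h0, mul_zero, zero_mul]) (by omega), ?_⟩
      have hr' := (hr.comp_neg.const_mul (conj s)).re
      convert! hr' using 3 with z
      simp_rw [polyInt_monomial_of_ge hba]
      rw [integral_conj, Complex.sub_re, homSum_single, mul_sub, Complex.sub_re, norm_neg]
      congr 1
      · rw [← Complex.conj_re (conj s * _), map_mul, Complex.conj_conj]
      · rw [neg_pow z]
        ring_nf
  | zero =>
    intro s
    refine ⟨0, Submodule.zero_mem _, fun N => ?_⟩
    simp only [polyInt, homSum, Pi.zero_apply, zero_mul, integral_zero, mul_zero,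
      Finsupp.sum_zero_index, sub_self, Complex.zero_re, Complex.ofReal_zero]
    exact isBigO_zero _ _
  | add f g hf' hg' hf hg =>
    intro s
    obtain ⟨α, hα, hr⟩ := hf s
    obtain ⟨α', hα', hr'⟩ := hg s
    refine ⟨α + α', Submodule.add_mem _ hα hα', fun N =>
      ((hr.add hr') N).congr' ?_ EventuallyEq.rfl⟩
    filter_upwards [hpos] with z hz
    have hT : 0 < ε * ‖z‖ := by positivity
    have : ∫ t in Set.Ioi (ε * ‖z‖), polyInt (f + g) c t z =
        ∫ t in Set.Ioi (ε * ‖z‖), (polyInt f c t z + polyInt g c t z) :=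
      setIntegral_congr_fun measurableSet_Ioi fun t ht =>
        polyInt_add (timePoly_mono zero_le_one hf') (timePoly_mono zero_le_one hg') hc
          (hT.trans ht) z
    rw [this, integral_add (integrableOn_polyInt hf' hc hT z) (integrableOn_polyInt hg' hc hT z),
      homSum_add, ← Complex.ofReal_add, ← Complex.add_re]
    congr 2
    ring
  | smul a f _ hf =>
    intro s
    obtain ⟨α, hα, hr⟩ := hf (s * a)
    refine ⟨α, hα, ?_⟩
    simp_rw [polyInt_smul, integral_const_mul, ← mul_assoc]
    exact hr

/-! ### The leading, logarithmic term -/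

theorem gaussInt_zero_zero_eq {c t : ℝ} (hc : 0 < c) (ht : 0 < t) (z : ℂ) :
    gaussInt 0 0 (c * t) z =
      ((Real.pi / c * (t⁻¹ * Real.exp (-(‖z‖ ^ 2 / (4 * c) / t))) : ℝ) : ℂ) := by
  rw [gaussInt_zero_zero (mul_pos hc ht)]
  push_cast
  rw [show (‖z‖ : ℂ) ^ 2 / (4 * (c * t)) = (‖z‖ : ℂ) ^ 2 / (4 * c) / t by
    rw [div_div, mul_assoc]]
  have hc' : (c : ℂ) ≠ 0 := by exact_mod_cast hc.ne'
  have ht' : (t : ℂ) ≠ 0 := by exact_mod_cast ht.ne'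
  field_simp

theorem tendsto_exp_neg_div_nhdsGT {A : ℝ} (hA : 0 < A) :
    Tendsto (fun t : ℝ => Real.exp (-(A / t))) (𝓝[>] 0) (𝓝 0) := by
  refine Real.tendsto_exp_atBot.comp ?_
  exact tendsto_neg_atTop_atBot.comp (tendsto_inv_nhdsGT_zero.const_mul_atTop hA)

theorem tendsto_exp_neg_div_atTop (A : ℝ) :
    Tendsto (fun t : ℝ => Real.exp (-(A / t))) atTop (𝓝 1) := by
  have : Tendsto (fun t : ℝ => -(A / t)) atTop (𝓝 (-0)) := (tendsto_id.const_div_atTop A).neg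
  rw [neg_zero] at this
  simpa [Function.comp_def] using (Real.continuous_exp.tendsto 0).comp this

theorem continuousOn_exp_neg_div (A : ℝ) :
    ContinuousOn (fun t : ℝ => Real.exp (-(A / t))) (Set.Ioi 0) := by
  intro t ht
  have : t ≠ 0 := (Set.mem_Ioi.1 ht).ne'
  refine ContinuousAt.continuousWithinAt ?_
  fun_prop (disch := assumption)

theorem exp_neg_div_le {A t : ℝ} (hA : 0 < A) (ht : 0 < t) (N : ℕ) :
    Real.exp (-(A / t)) ≤ N.factorial * (t / A) ^ N := by
  have h1 := Real.pow_div_factorial_le_exp (x := A / t) (by positivity) N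
  rw [Real.exp_neg]
  refine (inv_anti₀ (by positivity) h1).trans_eq ?_
  rw [inv_div, div_eq_mul_inv, ← inv_pow, inv_div]

theorem integrableOn_inv_mul_exp_sub {A B : ℝ} (hA : 0 < A) (hB : 0 < B) :
    IntegrableOn (fun t : ℝ => t⁻¹ * (Real.exp (-(A / t)) - Real.exp (-(B / t)))) (Set.Ioi 0) := by
  have hcts : ContinuousOn (fun t : ℝ => t⁻¹ * (Real.exp (-(A / t)) - Real.exp (-(B / t))))
      (Set.Ioi 0) :=
    (continuousOn_inv₀.mono fun t ht => (Set.mem_Ioi.1 ht).ne').mul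
      ((continuousOn_exp_neg_div A).sub (continuousOn_exp_neg_div B))
  have hexp : ∀ {A t : ℝ}, 0 < A → 0 < t → t⁻¹ * Real.exp (-(A / t)) ≤ A⁻¹ := by
    intro A t hA ht
    have := exp_neg_div_le hA ht 1
    simp only [Nat.factorial_one, Nat.cast_one, one_mul, pow_one] at this
    calc t⁻¹ * Real.exp (-(A / t)) ≤ t⁻¹ * (t / A) := by gcongr
      _ = A⁻¹ := by field_simp
  rw [← Set.Ioc_union_Ioi_eq_Ioi zero_le_one, integrableOn_union]
  constructor
  · refine IntegrableOn.of_bound (by simp) ((hcts.mono Set.Ioc_subset_Ioi_self).aestronglyMeasurable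
      measurableSet_Ioc) (A⁻¹ + B⁻¹) ?_
    filter_upwards [ae_restrict_mem measurableSet_Ioc] with t ht
    have ht0 := ht.1
    rw [mul_sub]
    refine (norm_sub_le _ _).trans (add_le_add ?_ ?_)
    · rw [Real.norm_of_nonneg (by positivity)]; exact hexp hA ht0
    · rw [Real.norm_of_nonneg (by positivity)]; exact hexp hB ht0
  · refine ((integrableOn_Ioi_rpow_of_lt (show (-2 : ℝ) < -1 by norm_num) one_pos).const_mul
      (A + B)).mono' ((hcts.mono (Set.Ioi_subset_Ioi zero_le_one)).aestronglyMeasurable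
      measurableSet_Ioi) ?_
    filter_upwards [ae_restrict_mem measurableSet_Ioi] with t ht
    have ht0 : 0 < t := one_pos.trans ht
    have h1 : ∀ {A : ℝ}, 0 < A → 1 - A / t ≤ Real.exp (-(A / t)) := fun {A} _ => by
      linarith [Real.add_one_le_exp (-(A / t))]
    have h2 : ∀ {A : ℝ}, 0 < A → Real.exp (-(A / t)) ≤ 1 := fun hA =>
      Real.exp_le_one_iff.2 (by rw [neg_nonpos]; positivity)
    have h3 : |Real.exp (-(A / t)) - Real.exp (-(B / t))| ≤ (A + B) / t := by
      rw [add_div, abs_le]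
      have hA' : 0 < A / t := by positivity
      have hB' : 0 < B / t := by positivity
      constructor <;> linarith [h1 hA, h1 hB, h2 hA, h2 hB]
    rw [norm_mul, Real.norm_of_nonneg (by positivity), Real.norm_eq_abs, Real.rpow_neg ht0.le,
      Real.rpow_two]
    calc t⁻¹ * _ ≤ t⁻¹ * ((A + B) / t) := by gcongr
      _ = _ := by field_simp

theorem integral_inv_mul_exp_sub {A B : ℝ} (hA : 0 < A) (hB : 0 < B) :
    ∫ t in Set.Ioi 0, t⁻¹ * (Real.exp (-(A / t)) - Real.exp (-(B / t))) = Real.log (B / A) := by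
  have key := Frullani.integral_Ioi_eq (f := fun t : ℝ => Real.exp (-(1 / t))) (a := A⁻¹)
    (b := B⁻¹) (L := 0) (R := 1)
    ((continuousOn_exp_neg_div 1).locallyIntegrableOn measurableSet_Ioi) (by positivity)
    (by positivity) (tendsto_exp_neg_div_nhdsGT one_pos) (tendsto_exp_neg_div_atTop 1)
  have e : ∀ A t : ℝ, 1 / (A⁻¹ * t) = A / t := fun A t => by
    rw [one_div, mul_inv, inv_inv, div_eq_mul_inv]
  simp only [e, smul_eq_mul] at key
  rw [key (integrableOn_inv_mul_exp_sub hA hB), inv_div_inv, ← inv_div, Real.log_inv]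
  ring

/-- Frullani's integral for the Gaussian kernel in time: the source of the logarithm. -/
theorem integral_gaussInt_sub {c : ℝ} (hc : 0 < c) {z w : ℂ} (hw : w ≠ 0) (hz : z ≠ 0) :
    IntegrableOn (fun t => gaussInt 0 0 (c * t) w - gaussInt 0 0 (c * t) z) (Set.Ioi 0) ∧
      ∫ t in Set.Ioi 0, (gaussInt 0 0 (c * t) w - gaussInt 0 0 (c * t) z) =
        ((2 * Real.pi / c * (Real.log ‖z‖ - Real.log ‖w‖) : ℝ) : ℂ) := by
  have hz0 : 0 < ‖z‖ := norm_pos_iff.2 hz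
  have hw0 : 0 < ‖w‖ := norm_pos_iff.2 hw
  have hA : 0 < ‖w‖ ^ 2 / (4 * c) := by positivity
  have hB : 0 < ‖z‖ ^ 2 / (4 * c) := by positivity
  have e : ∀ t ∈ Set.Ioi (0 : ℝ), ((Real.pi / c * (t⁻¹ * (Real.exp (-(‖w‖ ^ 2 / (4 * c) / t)) -
      Real.exp (-(‖z‖ ^ 2 / (4 * c) / t)))) : ℝ) : ℂ) =
      gaussInt 0 0 (c * t) w - gaussInt 0 0 (c * t) z := by
    intro t ht
    rw [gaussInt_zero_zero_eq hc ht, gaussInt_zero_zero_eq hc ht, ← Complex.ofReal_sub]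
    congr 1
    ring
  constructor
  · exact IntegrableOn.congr_fun
      ((integrableOn_inv_mul_exp_sub hA hB).const_mul (Real.pi / c)).ofReal e measurableSet_Ioi
  · rw [← setIntegral_congr_fun measurableSet_Ioi e, integral_complex_ofReal, integral_const_mul,
      integral_inv_mul_exp_sub hA hB, div_div_div_cancel_right₀ (by positivity),
      Real.log_div (by positivity) (by positivity), Real.log_pow, Real.log_pow]
    congr 1
    push_cast
    ring

/-- The Gaussian kernel contributes little at times up to `ε |z|`. -/
theorem rapidDecay_integral_gaussInt {c ε : ℝ} (hc : 0 < c) (hε : 0 < ε) :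
    RapidDecay fun z => ∫ t in Set.Ioc 0 (ε * ‖z‖), gaussInt 0 0 (c * t) z := by
  intro N
  have hpos : ∀ᶠ z : ℂ in Bornology.cobounded ℂ, 1 ≤ ‖z‖ :=
    tendsto_norm_cobounded_atTop.eventually_ge_atTop 1
  refine IsBigO.of_bound (Real.pi / c * ((N + 1).factorial * (4 * c) ^ (N + 1)) * ε ^ (N + 1)) ?_
  filter_upwards [hpos] with z hz
  have hz0 : 0 < ‖z‖ := by linarith
  have hT : 0 < ε * ‖z‖ := by positivity
  have hA : 0 < ‖z‖ ^ 2 / (4 * c) := by positivity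
  have h1 := norm_setIntegral_le_of_norm_le_const (μ := volume) (s := Set.Ioc 0 (ε * ‖z‖))
    (f := fun t : ℝ => gaussInt 0 0 (c * t) z)
    (C := Real.pi / c * ((N + 1).factorial * (4 * c / ‖z‖ ^ 2) ^ (N + 1) * (ε * ‖z‖) ^ N))
    (by simp) (fun t ht => by
      have ht0 := ht.1
      rw [gaussInt_zero_zero_eq hc ht0, Complex.norm_real, Real.norm_of_nonneg (by
        have := Real.pi_pos
        positivity)]
      have h2 := exp_neg_div_le hA ht0 (N + 1)
      have := Real.pi_pos
      have h3 : t ^ N ≤ (ε * ‖z‖) ^ N := pow_le_pow_left₀ ht0.le ht.2 N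
      calc _ ≤ Real.pi / c * (t⁻¹ * ((N + 1).factorial *
            (t / (‖z‖ ^ 2 / (4 * c))) ^ (N + 1))) := by gcongr
        _ = Real.pi / c * ((N + 1).factorial * (4 * c / ‖z‖ ^ 2) ^ (N + 1) * t ^ N) := by
          rw [show t / (‖z‖ ^ 2 / (4 * c)) = 4 * c / ‖z‖ ^ 2 * t by field_simp, mul_pow, pow_succ t]
          field_simp
        _ ≤ _ := by gcongr)
  have e : (‖z‖ ^ 2) ^ (N + 1) = ‖z‖ ^ (N + 1) * ‖z‖ ^ (N + 1) := by rw [sq, mul_pow]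
  have h4 : (‖z‖ ^ (N + 1))⁻¹ ≤ (‖z‖ ^ N)⁻¹ :=
    inv_anti₀ (by positivity) (pow_le_pow_right₀ hz N.le_succ)
  have := Real.pi_pos
  calc _ ≤ _ := h1
    _ = Real.pi / c * ((N + 1).factorial * (4 * c) ^ (N + 1)) * ε ^ (N + 1) *
        (‖z‖ ^ (N + 1))⁻¹ := by
      rw [Real.volume_real_Ioc_of_le hT.le, sub_zero, div_pow, e, mul_pow ε]
      field_simp
      ring
    _ ≤ _ := by
      rw [Real.norm_of_nonneg (by positivity)]
      gcongr

/-! ### Integrals over time of the heat kernel -/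

theorem integrableOn_inv_pow {K : ℕ} (hK : 1 ≤ K) {T : ℝ} (hT : 0 < T) :
    IntegrableOn (fun t : ℝ => (t ^ (K + 1))⁻¹) (Set.Ioi T) := by
  have hlt : (-(K + 1 : ℕ) : ℝ) < -1 := by
    have : (1 : ℝ) ≤ K := by exact_mod_cast hK
    push_cast
    linarith
  refine (integrableOn_Ioi_rpow_of_lt hlt hT).congr_fun (fun t ht => ?_) measurableSet_Ioi
  simp only
  rw [Real.rpow_neg (hT.trans ht).le, Real.rpow_natCast]

theorem integral_inv_pow_le {K : ℕ} (hK : 1 ≤ K) {T : ℝ} (hT : 0 < T) :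
    ∫ t in Set.Ioi T, (t ^ (K + 1))⁻¹ ≤ (T ^ K)⁻¹ := by
  have hK' : (1 : ℝ) ≤ K := by exact_mod_cast hK
  have hlt : (-(K + 1 : ℕ) : ℝ) < -1 := by
    push_cast
    linarith
  have e : ∫ t in Set.Ioi T, (t ^ (K + 1))⁻¹ = ∫ t in Set.Ioi T, t ^ (-(K + 1 : ℕ) : ℝ) :=
    setIntegral_congr_fun measurableSet_Ioi fun t ht => by
      rw [Real.rpow_neg (hT.trans ht).le, Real.rpow_natCast]
  rw [e, integral_Ioi_rpow_of_lt hlt hT,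
    show (-(K + 1 : ℕ) : ℝ) + 1 = -(K : ℝ) by push_cast; ring, Real.rpow_neg hT.le,
    Real.rpow_natCast, neg_div_neg_eq]
  exact div_le_self (by positivity) hK'

theorem integrableOn_gaussInt_Ioc {c T : ℝ} (hc : 0 < c) {z : ℂ} (hz : z ≠ 0) :
    IntegrableOn (fun t => gaussInt 0 0 (c * t) z) (Set.Ioc 0 T) := by
  have hz0 : 0 < ‖z‖ := norm_pos_iff.2 hz
  have hA : 0 < ‖z‖ ^ 2 / (4 * c) := by positivity
  have hcts : ContinuousOn (fun t => gaussInt 0 0 (c * t) z) (Set.Ioi 0) := by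
    simpa using continuousOn_gaussInt 0 0 0 hc z
  refine IntegrableOn.of_bound (by simp) ((hcts.mono Set.Ioc_subset_Ioi_self).aestronglyMeasurable
    measurableSet_Ioc) (Real.pi / c * (‖z‖ ^ 2 / (4 * c))⁻¹) ?_
  filter_upwards [ae_restrict_mem measurableSet_Ioc] with t ht
  have ht0 := ht.1
  have hπ := Real.pi_pos
  rw [gaussInt_zero_zero_eq hc ht0, Complex.norm_real, Real.norm_of_nonneg (by positivity)]
  have := exp_neg_div_le hA ht0 1
  simp only [Nat.factorial_one, Nat.cast_one, one_mul, pow_one] at this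
  calc _ ≤ Real.pi / c * (t⁻¹ * (t / (‖z‖ ^ 2 / (4 * c)))) := by gcongr
    _ = _ := by field_simp

section

variable {φ : ℂ → ℂ} {D : Set ℂ} {c κ : ℝ}

theorem IsStepCharFun.integrableOn_heatKernel_Ioc (h : IsStepCharFun φ D c κ) (z : ℂ) (T : ℝ) :
    IntegrableOn (fun t => heatKernel φ D t z) (Set.Ioc 0 T) :=
  ((h.continuous_heatKernel z).continuousOn.integrableOn_Icc (a := 0) (b := T)).mono_set
    Set.Ioc_subset_Icc_self

theorem IsStepCharFun.integrableOn_expansion_error (h : IsStepCharFun φ D c κ) {K : ℕ}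
    (hK : 1 ≤ K) {Q : ℝ → ℂ → ℂ} (hQ : Q ∈ timePoly 1) {C : ℝ}
    (hC : ∀ t : ℝ, 1 ≤ t → ∀ z,
      ‖heatKernel φ D t z - gaussInt 0 0 (c * t) z - polyInt Q c t z‖ ≤ C * (t ^ (K + 1))⁻¹)
    {T : ℝ} (hT : 1 ≤ T) (z : ℂ) :
    IntegrableOn (fun t => heatKernel φ D t z - gaussInt 0 0 (c * t) z - polyInt Q c t z)
      (Set.Ioi T) := by
  have hc : 0 < c := h.pos.trans_le h.le
  have hT0 : 0 < T := by linarith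
  have hcts : ContinuousOn (fun t => gaussInt 0 0 (c * t) z) (Set.Ioi T) := by
    simpa using (continuousOn_gaussInt 0 0 0 hc z).mono (Set.Ioi_subset_Ioi hT0.le)
  refine ((integrableOn_inv_pow hK hT0).const_mul C).mono' ?_ ?_
  · exact (((h.continuous_heatKernel z).continuousOn.sub hcts).aestronglyMeasurable
      measurableSet_Ioi).sub (integrableOn_polyInt hQ hc hT0 z).aestronglyMeasurable
  · filter_upwards [ae_restrict_mem measurableSet_Ioi] with t ht
    exact hC t (hT.trans (Set.mem_Ioi.1 ht).le) z

/-- The difference between the heat kernel and its Gaussian approximation is integrable in time. -/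
theorem IsStepCharFun.integrableOn_heatKernel_sub_gaussInt (h : IsStepCharFun φ D c κ) {z : ℂ}
    (hz : z ≠ 0) :
    IntegrableOn (fun t => heatKernel φ D t z - gaussInt 0 0 (c * t) z) (Set.Ioi 0) := by
  have hc : 0 < c := h.pos.trans_le h.le
  obtain ⟨Q, hQ, C, -, hC⟩ := h.exists_heatKernel_expansion 1 le_rfl
  rw [← Set.Ioc_union_Ioi_eq_Ioi zero_le_one, integrableOn_union]
  refine ⟨(h.integrableOn_heatKernel_Ioc z 1).sub (integrableOn_gaussInt_Ioc hc hz), ?_⟩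
  have := (h.integrableOn_expansion_error le_rfl hQ hC le_rfl z).add
    (integrableOn_polyInt hQ hc one_pos z)
  exact this.congr_fun (fun t _ => sub_add_cancel _ _) measurableSet_Ioi

/-- The integral over time of the difference between the heat kernel and its Gaussian
approximation, up to the contribution of the heat kernel at times up to `ε |z|`, is a sum of
nonradial homogeneous terms. -/
theorem IsStepCharFun.exists_integral_sub_expansion (h : IsStepCharFun φ D c κ) {ε : ℝ}
    (hε : 0 < ε) {K : ℕ} (hK : 1 ≤ K) (s : ℂ) : ∃ α ∈ nonradial,
      (fun z => (s * ((∫ t in Set.Ioi 0, (heatKernel φ D t z - gaussInt 0 0 (c * t) z)) -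
        ∫ t in Set.Ioc 0 (ε * ‖z‖), heatKernel φ D t z) - homSum α z).re)
        =O[Bornology.cobounded ℂ] fun z => (‖z‖ ^ K)⁻¹ := by
  have hc : 0 < c := h.pos.trans_le h.le
  obtain ⟨Q, hQ, C, hC0, hC⟩ := h.exists_heatKernel_expansion K hK
  obtain ⟨α, hα, hr⟩ := exists_integral_polyInt_expansion hQ hc hε s
  refine ⟨α, hα, ?_⟩
  have hnorm : Tendsto (fun z : ℂ => ‖z‖) (Bornology.cobounded ℂ) atTop :=
    tendsto_norm_cobounded_atTop
  have hE : (fun z : ℂ => (s * ∫ t in Set.Ioi (ε * ‖z‖),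
      (heatKernel φ D t z - gaussInt 0 0 (c * t) z - polyInt Q c t z)).re)
      =O[Bornology.cobounded ℂ] fun z => (‖z‖ ^ K)⁻¹ := by
    refine IsBigO.of_bound (‖s‖ * (C * (ε ^ K)⁻¹)) ?_
    filter_upwards [hnorm.eventually_ge_atTop 1, hnorm.eventually_ge_atTop ε⁻¹] with z hz hzε
    have hT : 1 ≤ ε * ‖z‖ := by rwa [inv_le_iff_one_le_mul₀' hε] at hzε
    have hT0 : 0 < ε * ‖z‖ := by linarith
    have h1 : ‖∫ t in Set.Ioi (ε * ‖z‖),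
        (heatKernel φ D t z - gaussInt 0 0 (c * t) z - polyInt Q c t z)‖ ≤
          C * ((ε * ‖z‖) ^ K)⁻¹ := by
      refine (norm_integral_le_of_norm_le ((integrableOn_inv_pow hK hT0).const_mul C) ?_).trans ?_
      · filter_upwards [ae_restrict_mem measurableSet_Ioi] with t ht
        exact hC t (hT.trans (Set.mem_Ioi.1 ht).le) z
      · rw [integral_const_mul]
        exact mul_le_mul_of_nonneg_left (integral_inv_pow_le hK hT0) hC0
    rw [Real.norm_eq_abs]
    calc _ ≤ _ := Complex.abs_re_le_norm _
      _ ≤ ‖s‖ * (C * ((ε * ‖z‖) ^ K)⁻¹) := by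
        rw [norm_mul]
        exact mul_le_mul_of_nonneg_left h1 (norm_nonneg s)
      _ = _ := by
        rw [mul_pow, mul_inv, Real.norm_of_nonneg (by positivity)]
        ring
  have hP := IsBigO.norm_left (hr K)
  simp only [Complex.norm_real] at hP
  have hG := IsBigO.norm_left
    ((((rapidDecay_integral_gaussInt hc hε).const_mul s).re) K)
  simp only [Complex.norm_real] at hG
  refine ((hE.add hP.of_norm_left).sub hG.of_norm_left).congr' ?_ EventuallyEq.rfl
  filter_upwards [hnorm.eventually_ge_atTop 1, hnorm.eventually_ge_atTop ε⁻¹] with z hz hzε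
  have hT : 1 ≤ ε * ‖z‖ := by rwa [inv_le_iff_one_le_mul₀' hε] at hzε
  have hT0 : 0 < ε * ‖z‖ := by linarith
  have hz0 : z ≠ 0 := norm_pos_iff.1 (by linarith)
  have hJ := h.integrableOn_heatKernel_sub_gaussInt hz0
  have e1 : ∫ t in Set.Ioi 0, (heatKernel φ D t z - gaussInt 0 0 (c * t) z) =
      ((∫ t in Set.Ioc 0 (ε * ‖z‖), heatKernel φ D t z) -
        ∫ t in Set.Ioc 0 (ε * ‖z‖), gaussInt 0 0 (c * t) z) +
      ((∫ t in Set.Ioi (ε * ‖z‖),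
        (heatKernel φ D t z - gaussInt 0 0 (c * t) z - polyInt Q c t z)) +
        ∫ t in Set.Ioi (ε * ‖z‖), polyInt Q c t z) := by
    rw [← Set.Ioc_union_Ioi_eq_Ioi hT0.le, setIntegral_union (Set.Ioc_disjoint_Ioi le_rfl)
      measurableSet_Ioi (hJ.mono_set Set.Ioc_subset_Ioi_self)
      (hJ.mono_set (Set.Ioi_subset_Ioi hT0.le)),
      integral_sub (h.integrableOn_heatKernel_Ioc z _) (integrableOn_gaussInt_Ioc hc hz0),
      ← integral_add (h.integrableOn_expansion_error hK hQ hC hT z)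
        (integrableOn_polyInt hQ hc hT0 z)]
    simp
  rw [← Complex.add_re, ← Complex.sub_re, e1]
  congr 1
  ring

/-- The potential splits into a constant, a logarithm, and the difference between the heat kernel
at `z` and its Gaussian approximation. The point `1` serves as a base point, because the Gaussian
kernel at `0` is not integrable at time `0`. -/
theorem integral_heatKernel_decomposition (h : IsStepCharFun φ D c κ) {z : ℂ} (hz : z ≠ 0) :
    ∫ t in Set.Ioi 0, (heatKernel φ D t 0 - heatKernel φ D t z) =
      (∫ t in Set.Ioi 0, (heatKernel φ D t 0 - heatKernel φ D t 1)) +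
      (∫ t in Set.Ioi 0, (heatKernel φ D t 1 - gaussInt 0 0 (c * t) 1)) +
      ((2 * Real.pi / c * Real.log ‖z‖ : ℝ) : ℂ) -
      ∫ t in Set.Ioi 0, (heatKernel φ D t z - gaussInt 0 0 (c * t) z) := by
  have hc : 0 < c := h.pos.trans_le h.le
  obtain ⟨hg, eg⟩ := integral_gaussInt_sub hc one_ne_zero hz
  have h1 := (h.integral_heatKernel 1).1
  have h2 := h.integrableOn_heatKernel_sub_gaussInt (z := 1) one_ne_zero
  have h3 := h.integrableOn_heatKernel_sub_gaussInt hz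
  rw [norm_one, Real.log_one, sub_zero] at eg
  have h12 : IntegrableOn (fun t => heatKernel φ D t 0 - heatKernel φ D t 1 +
    (heatKernel φ D t 1 - gaussInt 0 0 (c * t) 1)) (Set.Ioi 0) := h1.add h2
  have h123 : IntegrableOn (fun t => heatKernel φ D t 0 - heatKernel φ D t 1 +
    (heatKernel φ D t 1 - gaussInt 0 0 (c * t) 1) +
    (gaussInt 0 0 (c * t) 1 - gaussInt 0 0 (c * t) z)) (Set.Ioi 0) := h12.add hg
  rw [← eg, ← integral_add h1 h2, ← integral_add h12 hg, ← integral_sub h123 h3]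
  refine setIntegral_congr_fun measurableSet_Ioi fun t _ => ?_
  ring

end

theorem isBigO_re {ι : Type*} {l : Filter ι} {f : ι → ℂ} {g : ι → ℝ} (h : f =O[l] g) :
    (fun x => (f x).re) =O[l] g :=
  IsBigO.trans (IsBigO.of_bound 1 (Eventually.of_forall fun x => by
    rw [one_mul]; exact Complex.abs_re_le_norm _)) h

theorem homSum_isBigO {α : ℕ × ℕ →₀ ℂ} {K : ℕ} (hα : ∀ p ∈ α.support, p.1 + K ≤ p.2) :
    homSum α =O[Bornology.cobounded ℂ] fun z => (‖z‖ ^ K)⁻¹ := by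
  have H : ∀ p ∈ α.support, (fun z : ℂ => α p * (z ^ p.1 / (‖z‖ : ℂ) ^ p.2))
      =O[Bornology.cobounded ℂ] fun z => (‖z‖ ^ K)⁻¹ := by
    intro p hp
    have hp' := hα p hp
    refine IsBigO.const_mul_left (f := fun z : ℂ => z ^ p.1 / (‖z‖ : ℂ) ^ p.2)
      (IsBigO.of_bound 1 ?_) _
    filter_upwards [tendsto_norm_cobounded_atTop.eventually_ge_atTop (1 : ℝ)] with z hz
    have hz0 : 0 < ‖z‖ := by linarith
    rw [norm_div, norm_pow, norm_pow, Complex.norm_real, norm_norm,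
      Real.norm_of_nonneg (by positivity), one_mul, div_le_iff₀ (by positivity),
      inv_mul_eq_div, le_div_iff₀ (by positivity), ← pow_add]
    exact pow_le_pow_right₀ hz hp'
  have := IsBigO.sum H
  rwa [Finset.sum_fn] at this

/-- Dropping the terms of degree below `-K` costs `O(|z| ^ (-K))`. -/
theorem homSum_filter_isBigO (α : ℕ × ℕ →₀ ℂ) (K : ℕ) :
    (fun z => homSum α z - homSum (α.filter fun p => p.2 ≤ p.1 + K) z)
      =O[Bornology.cobounded ℂ] fun z => (‖z‖ ^ K)⁻¹ := by
  have e : ∀ z, homSum α z - homSum (α.filter fun p => p.2 ≤ p.1 + K) z =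
      homSum (α.filter fun p => ¬ p.2 ≤ p.1 + K) z := by
    intro z
    rw [sub_eq_iff_eq_add', ← homSum_add, Finsupp.filter_add_filter_not]
  simp_rw [e]
  refine homSum_isBigO fun p hp => ?_
  rw [Finsupp.support_filter, Finset.mem_filter] at hp
  omega

/-! ### Expansions of the harmonic potential -/

theorem exists_basis_span_eq (Z : Submodule ℤ ℂ) [DiscreteTopology Z] [IsZLattice ℝ Z] :
    ∃ b : Module.Basis (Fin 2) ℝ ℂ, Submodule.span ℤ (Set.range b) = Z := by
  have : Module.Finite ℤ Z := ZLattice.module_finite ℝ Z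
  have : Module.Free ℤ Z := ZLattice.module_free ℝ Z
  have hr : Module.finrank ℤ Z = 2 := by
    rw [ZLattice.rank ℝ Z, Complex.finrank_real_complex]
  exact ⟨(Module.finBasisOfFinrankEq ℤ Z hr).ofZLatticeBasis ℝ Z,
    Module.Basis.ofZLatticeBasis_span ℝ Z _⟩

theorem Expansion.eval_eq (E : Expansion) (z : ℂ) :
    E.eval z = E.logCoeff * Real.log ‖z‖ + E.const + (homSum E.coeff z).re := rfl

theorem tendsto_coe_cobounded (Z : Submodule ℤ ℂ) :
    Tendsto (fun z : Z => (z : ℂ)) (Bornology.cobounded Z) (Bornology.cobounded ℂ) := by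
  rw [tendsto_norm_atTop_iff_cobounded.symm]
  exact tendsto_norm_cobounded_atTop (E := Z)

section Walk

variable {Ω : Type*} [MeasurableSpace Ω] {μ : Measure Ω} [IsProbabilityMeasure μ]
  {Z : Submodule ℤ ℂ} {R : ℕ → Ω → ℂ}

/-- The harmonic potential as a Fourier integral over the dual cell. -/
theorem isHarmonicPotential_fourier (hR : IsRandomWalk μ Z R) (b : Module.Basis (Fin 2) ℝ ℂ)
    (hb : Submodule.span ℤ (Set.range b) = Z) {c κ : ℝ}
    (h : IsStepCharFun (charFun (μ.map (R 1))) (dualCell b) c κ)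
    (hlt : ∀ᵐ θ : ℂ, ‖charFun (μ.map (R 1)) θ‖ < 1) :
    IsHarmonicPotential μ Z R fun z => (volume.real (dualCell b))⁻¹ *
      (∫ θ in dualCell b, (1 - Complex.exp (-⟪(z : ℂ), θ⟫ * Complex.I)) /
        (1 - charFun (μ.map (R 1)) θ)).re := by
  intro z
  have hV : 0 < volume.real (dualCell b) :=
    ENNReal.toReal_pos (volume.measure_pos_of_mem_nhds h.mem_nhds).ne' h.isCompact.measure_lt_top.ne
  have key := ((Complex.continuous_re.tendsto _).comp (h.tendsto_sum hlt z)).const_mul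
    (volume.real (dualCell b))⁻¹
  refine key.congr fun N => ?_
  simp only [Function.comp_apply]
  rw [Complex.re_sum, Finset.mul_sum]
  refine Finset.sum_congr rfl fun n _ => ?_
  rw [← hR.hitProb_eq_integral b hb n 0 Z.zero_mem, ← hR.hitProb_eq_integral b hb n z z.2,
    ← Complex.ofReal_sub, Complex.ofReal_re, ← mul_sub, inv_mul_cancel_left₀ hV.ne']

/-- On the lattice the heat kernel contributes little at times up to a small multiple of `|z|`. -/
theorem IsRandomWalk.integral_heatKernel_isBigO (hR : IsRandomWalk μ Z R)
    (b : Module.Basis (Fin 2) ℝ ℂ) (hb : Submodule.span ℤ (Set.range b) = Z) {M : ℝ}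
    (hM0 : 0 < M) (hM : ∀ᵐ x ∂(μ.map (R 1)), ‖x‖ ≤ M) (s : ℂ) (K : ℕ) :
    (fun z : Z => s * ∫ t in Set.Ioc 0 ((4 * M)⁻¹ * ‖(z : ℂ)‖),
      heatKernel (charFun (μ.map (R 1))) (dualCell b) t z) =O[Bornology.cobounded Z]
      fun z : Z => (‖(z : ℂ)‖ ^ K)⁻¹ := by
  set V := volume.real (dualCell b)
  have hV : 0 ≤ V := measureReal_nonneg
  have hrap : RapidDecay fun z => ((V * ((4 * M)⁻¹ * (1 + ‖z‖) ^ 1 *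
      Real.exp (-(2 * M)⁻¹ * ‖z‖)) : ℝ) : ℂ) := by
    refine rapidDecay_of_norm_le (C := V * (4 * M)⁻¹) (η := (2 * M)⁻¹) (ρ := 0) (k := 1)
      (by positivity) fun z _ => ?_
    rw [Complex.norm_real, Real.norm_of_nonneg (by positivity)]
    exact le_of_eq (by ring)
  refine IsBigO.const_mul_left (IsBigO.trans (IsBigO.of_bound 1 ?_)
    ((hrap K).comp_tendsto (tendsto_coe_cobounded Z))) s
  refine Eventually.of_forall fun z => ?_
  have hT : 0 ≤ (4 * M)⁻¹ * ‖(z : ℂ)‖ := by positivity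
  have h1 := norm_setIntegral_le_of_norm_le_const (μ := volume)
    (s := Set.Ioc 0 ((4 * M)⁻¹ * ‖(z : ℂ)‖))
    (f := fun t : ℝ => heatKernel (charFun (μ.map (R 1))) (dualCell b) t z)
    (C := V * Real.exp (-(2 * M)⁻¹ * ‖(z : ℂ)‖)) (by simp) (fun t ht => by
      refine (hR.norm_heatKernel_le_exp b hb hM0 hM ht.1.le z.2).trans ?_
      refine mul_le_mul_of_nonneg_left (Real.exp_le_exp.2 ?_) hV
      have h2 := ht.2
      calc 2 * t - ‖(z : ℂ)‖ / M ≤ 2 * ((4 * M)⁻¹ * ‖(z : ℂ)‖) - ‖(z : ℂ)‖ / M := by linarith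
        _ = _ := by field_simp; ring)
  refine h1.trans ?_
  rw [Real.volume_real_Ioc_of_le hT, sub_zero, one_mul, Function.comp_apply, Complex.norm_real,
    Real.norm_of_nonneg (by positivity), pow_one]
  calc _ = V * ((4 * M)⁻¹ * ‖(z : ℂ)‖ * Real.exp (-(2 * M)⁻¹ * ‖(z : ℂ)‖)) := by ring
    _ ≤ _ := by
      gcongr
      linarith

/-- The harmonic potential has expansions of all orders, with the same logarithmic and constant
terms, and without further radial terms. -/
theorem exists_nonradial_expansion [DiscreteTopology Z] [IsZLattice ℝ Z]
    (hR : IsRandomWalk μ Z R) (hS : IsSpherical μ R) :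
    ∃ a : Z → ℝ, IsHarmonicPotential μ Z R a ∧ ∃ A B : ℝ, ∀ K : ℕ, ∃ E : Expansion,
      E.IsExpansionOf K a ∧ E.logCoeff = A ∧ E.const = B ∧ E.coeff ∈ nonradial := by
  obtain ⟨b, hb⟩ := exists_basis_span_eq Z
  obtain ⟨⟨c, κ, h⟩, hlt⟩ := hS.isStepCharFun hR b hb
  obtain ⟨M, hM0, hM⟩ := hS.ae_norm_le hR
  set φ := charFun (μ.map (R 1))
  set D := dualCell b
  set V := volume.real D
  set B : ℂ := (∫ t in Set.Ioi 0, (heatKernel φ D t 0 - heatKernel φ D t 1)) +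
    ∫ t in Set.Ioi 0, (heatKernel φ D t 1 - gaussInt 0 0 (c * t) 1)
  refine ⟨_, isHarmonicPotential_fourier hR b hb h hlt, V⁻¹ * (2 * Real.pi / c), V⁻¹ * B.re,
    fun K => ?_⟩
  -- up to time `|z| / (4 M)` a walk with steps bounded by `M` rarely reaches `z`
  obtain ⟨α, hα, hJ⟩ := h.exists_integral_sub_expansion (ε := (4 * M)⁻¹) (by positivity)
    (K := K + 1) (by omega) (-(V : ℂ)⁻¹)
  have hα' : (α.filter fun p => p.2 ≤ p.1 + K) ∈ nonradial := by
    rw [nonradial, Finsupp.mem_supported] at hα ⊢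
    intro p hp
    rw [Finset.mem_coe, Finsupp.support_filter, Finset.mem_filter] at hp
    exact hα hp.1
  refine ⟨⟨_, _, α.filter fun p => p.2 ≤ p.1 + K⟩, ⟨fun p hp => ?_, ?_⟩, rfl, rfl, hα'⟩
  · refine ⟨((Finsupp.mem_supported _ _).1 hα' hp).2, ?_⟩
    rw [Finsupp.support_filter, Finset.mem_filter] at hp
    exact hp.2
  have hcoe := tendsto_coe_cobounded Z
  have hnorm : Tendsto (fun z : Z => ‖(z : ℂ)‖) (Bornology.cobounded Z) atTop :=
    tendsto_norm_cobounded_atTop (E := Z)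
  have hKK : (fun z : ℂ => (‖z‖ ^ (K + 1))⁻¹) =O[Bornology.cobounded ℂ]
      fun z => (‖z‖ ^ K)⁻¹ := by
    refine IsBigO.of_bound 1 ?_
    filter_upwards [tendsto_norm_cobounded_atTop.eventually_ge_atTop (1 : ℝ)] with z hz
    rw [one_mul, Real.norm_of_nonneg (by positivity), Real.norm_of_nonneg (by positivity)]
    exact inv_anti₀ (by positivity) (pow_le_pow_right₀ hz K.le_succ)
  have h1 := ((hJ.trans hKK).add (isBigO_re (homSum_filter_isBigO α K))).comp_tendsto hcoe
  have h2 := isBigO_re (hR.integral_heatKernel_isBigO b hb hM0 hM (-(V : ℂ)⁻¹) K)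
  refine (h1.add h2).congr' ?_ EventuallyEq.rfl
  filter_upwards [hnorm.eventually_ge_atTop 1] with z hz
  have hz0 : (z : ℂ) ≠ 0 := norm_pos_iff.1 (by linarith)
  simp only [Function.comp_apply]
  rw [Expansion.eval_eq, ← (h.integral_heatKernel z).2, integral_heatKernel_decomposition h hz0]
  simp only [Complex.add_re, Complex.sub_re, Complex.ofReal_re, ← Complex.ofReal_inv,
    ← Complex.ofReal_neg, Complex.re_ofReal_mul, B]
  ring

end Walk

/-! ### Uniqueness of expansions and means over circles -/

/-- In every direction there are lattice points going to infinity. -/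
theorem exists_seq_mem_tendsto (Z : Submodule ℤ ℂ) [DiscreteTopology Z] [IsZLattice ℝ Z] {u : ℂ}
    (hu : u ≠ 0) : ∃ x : ℕ → Z, Tendsto x atTop (Bornology.cobounded Z) ∧
      Tendsto (fun n : ℕ => (n : ℂ)⁻¹ * (x n : ℂ)) atTop (𝓝 u) := by
  obtain ⟨b, hb⟩ := exists_basis_span_eq Z
  let x : ℕ → Z := fun n => ⟨ZSpan.floor b ((n : ℂ) * u), hb.le (ZSpan.floor b _).2⟩
  have h1 : Tendsto (fun n : ℕ => (n : ℂ)⁻¹ * ZSpan.fract b ((n : ℂ) * u)) atTop (𝓝 0) := by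
    rw [tendsto_zero_iff_norm_tendsto_zero]
    have h2 : Tendsto (fun n : ℕ => (n : ℝ)⁻¹ * ∑ i, ‖b i‖) atTop (𝓝 0) := by
      simpa using (tendsto_inv_atTop_nhds_zero_nat (𝕜 := ℝ)).mul_const (∑ i, ‖b i‖)
    refine squeeze_zero (fun n => norm_nonneg _) (fun n => ?_) h2
    rw [norm_mul, norm_inv, Complex.norm_natCast]
    exact mul_le_mul_of_nonneg_left (ZSpan.norm_fract_le (K := ℝ) b _) (by positivity)
  have hx : Tendsto (fun n : ℕ => (n : ℂ)⁻¹ * (x n : ℂ)) atTop (𝓝 u) := by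
    have h3 := (tendsto_const_nhds (x := u)).sub h1
    rw [sub_zero] at h3
    refine h3.congr' ?_
    filter_upwards [eventually_gt_atTop 0] with n hn
    have hn' : (n : ℂ) ≠ 0 := by exact_mod_cast hn.ne'
    rw [ZSpan.fract_apply, mul_sub, inv_mul_cancel_left₀ hn', sub_sub_cancel]
  refine ⟨x, ?_, hx⟩
  rw [← tendsto_norm_atTop_iff_cobounded]
  refine ((tendsto_natCast_atTop_atTop (R := ℝ)).atTop_mul_pos (norm_pos_iff.2 hu)
    hx.norm).congr' ?_
  filter_upwards [eventually_gt_atTop 0] with n hn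
  have hn' : (n : ℝ) ≠ 0 := by exact_mod_cast hn.ne'
  rw [norm_mul, norm_inv, Complex.norm_natCast, mul_inv_cancel_left₀ hn']
  rfl

theorem homSum_continuousAt (c : ℕ × ℕ →₀ ℂ) {z : ℂ} (hz : z ≠ 0) : ContinuousAt (homSum c) z := by
  have : ∀ p : ℕ × ℕ, (‖z‖ : ℂ) ^ p.2 ≠ 0 := fun p =>
    pow_ne_zero _ (Complex.ofReal_ne_zero.2 (norm_ne_zero_iff.2 hz))
  unfold homSum Finsupp.sum
  refine tendsto_finsetSum _ fun p _ => ?_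
  have h : ContinuousAt (fun z : ℂ => c p * (z ^ p.1 / (‖z‖ : ℂ) ^ p.2)) z := by
    fun_prop (disch := exact this p)
  exact h

theorem homSum_smul {c : ℕ × ℕ →₀ ℂ} {i : ℕ} (hc : ∀ p ∈ c.support, p.2 = p.1 + i) {r : ℝ}
    (hr : 0 < r) (z : ℂ) : homSum c (r * z) = ((r ^ i)⁻¹ : ℝ) * homSum c z := by
  have hr' : (r : ℂ) ≠ 0 := Complex.ofReal_ne_zero.2 hr.ne'
  unfold homSum Finsupp.sum
  rw [Finset.mul_sum]
  refine Finset.sum_congr rfl fun p hp => ?_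
  simp only
  rw [norm_mul, Complex.norm_real, Real.norm_of_nonneg hr.le, hc p hp]
  push_cast
  rw [mul_pow, mul_pow, pow_add (r : ℂ)]
  field_simp

/-- A homogeneous term of degree `-i` that is `o(|z| ^ (-i))` on a lattice vanishes, since the
directions of the lattice points are dense. -/
theorem homSum_re_eq_zero (Z : Submodule ℤ ℂ) [DiscreteTopology Z] [IsZLattice ℝ Z]
    {c : ℕ × ℕ →₀ ℂ} {i : ℕ} (hc : ∀ p ∈ c.support, p.2 = p.1 + i)
    (h : Tendsto (fun z : Z => ‖(z : ℂ)‖ ^ i * (homSum c z).re) (Bornology.cobounded Z) (𝓝 0))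
    {u : ℂ} (hu : u ≠ 0) : (homSum c u).re = 0 := by
  obtain ⟨x, hcob, hx⟩ := exists_seq_mem_tendsto Z hu
  have hn : ∀ᶠ n : ℕ in atTop, 0 < n := eventually_gt_atTop 0
  have h1 : Tendsto (fun n : ℕ => ‖(n : ℂ)⁻¹ * (x n : ℂ)‖ ^ i *
      (homSum c ((n : ℂ)⁻¹ * (x n : ℂ))).re) atTop (𝓝 (‖u‖ ^ i * (homSum c u).re)) :=
    (hx.norm.pow i).mul ((Complex.continuous_re.tendsto _).comp
      ((homSum_continuousAt c hu).tendsto.comp hx))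
  have h2 : Tendsto (fun n : ℕ => ‖(n : ℂ)⁻¹ * (x n : ℂ)‖ ^ i *
      (homSum c ((n : ℂ)⁻¹ * (x n : ℂ))).re) atTop (𝓝 0) := by
    refine (h.comp hcob).congr' ?_
    filter_upwards [hn] with n hn
    have hn' : 0 < ((n : ℝ))⁻¹ := by positivity
    have e := homSum_smul hc hn' (x n : ℂ)
    push_cast at e
    rw [Function.comp_apply, e, norm_mul, norm_inv, Complex.norm_natCast, mul_pow,
      show (((n : ℂ)⁻¹ ^ i)⁻¹ * homSum c (x n)).re = ((n : ℝ)⁻¹ ^ i)⁻¹ * (homSum c (x n)).re by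
        rw [← Complex.re_ofReal_mul]; push_cast; rfl]
    field_simp
  have h3 := tendsto_nhds_unique h1 h2
  exact (mul_eq_zero.1 h3).resolve_left (pow_ne_zero _ (norm_ne_zero_iff.2 hu))

/-- An expression that is `O(|z| ^ (-K))` on a lattice is so on the plane. -/
theorem isBigO_of_isBigO_lattice (Z : Submodule ℤ ℂ) [DiscreteTopology Z] [IsZLattice ℝ Z] {A : ℝ}
    {c : ℕ × ℕ →₀ ℂ} (hc : ∀ p ∈ c.support, p.1 ≤ p.2) {K : ℕ}
    (h : (fun z : Z => A * Real.log ‖(z : ℂ)‖ + (homSum c z).re) =O[Bornology.cobounded Z]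
      fun z : Z => (‖(z : ℂ)‖ ^ K)⁻¹) :
    (fun z : ℂ => A * Real.log ‖z‖ + (homSum c z).re) =O[Bornology.cobounded ℂ]
      fun z => (‖z‖ ^ K)⁻¹ := by
  obtain ⟨x, hx, -⟩ := exists_seq_mem_tendsto Z one_ne_zero
  have := hx.neBot
  have hcoe := tendsto_coe_cobounded Z
  have hnorm : Tendsto (fun z : Z => ‖(z : ℂ)‖) (Bornology.cobounded Z) atTop :=
    tendsto_norm_cobounded_atTop (E := Z)
  have hle : ∀ {i j : ℕ}, i ≤ j → (fun z : Z => (‖(z : ℂ)‖ ^ j)⁻¹) =O[Bornology.cobounded Z]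
      fun z : Z => (‖(z : ℂ)‖ ^ i)⁻¹ := fun {i j} hij => by
    refine IsBigO.of_bound 1 ?_
    filter_upwards [hnorm.eventually_ge_atTop 1] with z hz
    rw [one_mul, Real.norm_of_nonneg (by positivity), Real.norm_of_nonneg (by positivity)]
    exact inv_anti₀ (by positivity) (pow_le_pow_right₀ hz hij)
  have hscale : ∀ {f : Z → ℝ} {i : ℕ},
      (f =O[Bornology.cobounded Z] fun z : Z => (‖(z : ℂ)‖ ^ (i + 1))⁻¹) →
      Tendsto (fun z : Z => ‖(z : ℂ)‖ ^ i * f z) (Bornology.cobounded Z) (𝓝 0) := by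
    intro f i hf
    have h1 := (isBigO_refl (fun z : Z => ‖(z : ℂ)‖ ^ i) _).mul hf
    refine h1.trans_tendsto ((tendsto_inv_atTop_zero.comp hnorm).congr' ?_)
    filter_upwards [hnorm.eventually_gt_atTop 0] with z hz
    rw [Function.comp_apply, pow_succ]
    field_simp
  -- the logarithm is the only unbounded term
  have hA : A = 0 := by
    by_contra hA
    have h1 : (fun z : Z => (homSum c z).re) =O[Bornology.cobounded Z]
        fun z : Z => (‖(z : ℂ)‖ ^ 0)⁻¹ :=
      isBigO_re ((homSum_isBigO (K := 0) (by simpa using hc)).comp_tendsto hcoe)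
    have h2 := (h.trans (hle (Nat.zero_le K))).sub h1
    simp only [add_sub_cancel_right, pow_zero, inv_one] at h2
    have h3 := (isBigO_const_mul_left_iff hA).1 h2
    have h4 : Tendsto (fun z : Z => ‖Real.log ‖(z : ℂ)‖‖) (Bornology.cobounded Z) atTop :=
      tendsto_norm_atTop_atTop.comp (Real.tendsto_log_atTop.comp hnorm)
    have h5 := (isBigO_one_iff ℝ).1 h3
    exact not_isBoundedUnder_of_tendsto_atTop h4 h5
  subst hA
  simp only [zero_mul, zero_add] at h ⊢
  -- the terms of degree above `-K` vanish, one degree after the other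
  have hvan : ∀ i ≤ K, ∀ z : ℂ, z ≠ 0 →
      (homSum (c.filter fun p => p.2 < p.1 + i) z).re = 0 := by
    intro i
    induction i with
    | zero =>
      intro _ z _
      have : c.filter (fun p => p.2 < p.1 + 0) = 0 := by
        refine (Finsupp.filter_eq_zero_iff _ _).2 fun p hp => ?_
        by_contra hcp
        have := hc p (Finsupp.mem_support_iff.2 hcp)
        omega
      rw [this, homSum, Finsupp.sum_zero_index, Complex.zero_re]
    | succ i ih =>
      intro hi z hz
      have ih' := ih (by omega)
      have e1 : c.filter (fun p => p.2 < p.1 + (i + 1)) =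
          c.filter (fun p => p.2 < p.1 + i) + c.filter (fun p => p.2 = p.1 + i) := by
        ext p
        simp only [Finsupp.add_apply, Finsupp.filter_apply]
        split_ifs <;> first | omega | simp
      have e2 : c = c.filter (fun p => p.2 < p.1 + (i + 1)) +
          c.filter (fun p => ¬ p.2 < p.1 + (i + 1)) := (Finsupp.filter_add_filter_not _ _).symm
      rw [e1, homSum_add, Complex.add_re, ih' z hz, zero_add]
      refine homSum_re_eq_zero Z (i := i) (fun p hp => ?_) ?_ hz
      · rw [Finsupp.support_filter, Finset.mem_filter] at hp
        exact hp.2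
      · have h1 : (fun z : Z => (homSum (c.filter fun p => ¬ p.2 < p.1 + (i + 1)) z).re)
            =O[Bornology.cobounded Z] fun z : Z => (‖(z : ℂ)‖ ^ (i + 1))⁻¹ :=
          isBigO_re ((homSum_isBigO fun p hp => by
            rw [Finsupp.support_filter, Finset.mem_filter] at hp
            omega).comp_tendsto hcoe)
        refine (hscale ((h.trans (hle hi)).sub h1)).congr' ?_
        filter_upwards [hnorm.eventually_gt_atTop 0] with w hw
        have e3 := congrArg (fun c => (homSum c w).re) e2
        simp only [homSum_add, Complex.add_re] at e3
        rw [e3, add_sub_cancel_right, e1, homSum_add, Complex.add_re, ih' w (norm_pos_iff.1 hw),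
          zero_add]
  have e2 : c = c.filter (fun p => p.2 < p.1 + K) + c.filter (fun p => ¬ p.2 < p.1 + K) :=
    (Finsupp.filter_add_filter_not _ _).symm
  refine (isBigO_re (homSum_isBigO (α := c.filter fun p => ¬ p.2 < p.1 + K) (K := K)
    fun p hp => ?_)).congr' ?_ EventuallyEq.rfl
  · rw [Finsupp.support_filter, Finset.mem_filter] at hp
    omega
  · filter_upwards [tendsto_norm_cobounded_atTop.eventually_gt_atTop (0 : ℝ)] with z hz
    conv_rhs => rw [e2]
    rw [homSum_add, Complex.add_re, hvan K le_rfl z (norm_pos_iff.1 hz), zero_add]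

theorem norm_mul_exp_I {r : ℝ} (hr : 0 < r) (t : ℝ) :
    ‖(r : ℂ) * Complex.exp (Complex.I * t)‖ = r := by
  rw [norm_mul, mul_comm Complex.I, Complex.norm_exp_ofReal_mul_I, mul_one, Complex.norm_real,
    Real.norm_of_nonneg hr.le]

theorem continuous_homSum_circle (c : ℕ × ℕ →₀ ℂ) {r : ℝ} (hr : 0 < r) :
    Continuous fun t : ℝ => homSum c ((r : ℂ) * Complex.exp (Complex.I * t)) := by
  refine continuous_iff_continuousAt.2 fun t => ?_
  have hz : (r : ℂ) * Complex.exp (Complex.I * t) ≠ 0 :=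
    norm_pos_iff.1 (by rwa [norm_mul_exp_I hr])
  exact ContinuousAt.comp (f := fun t : ℝ => (r : ℂ) * Complex.exp (Complex.I * t))
    (homSum_continuousAt c hz) (by fun_prop)

theorem Expansion.continuous_eval_circle (E : Expansion) {r : ℝ} (hr : 0 < r) :
    Continuous fun t : ℝ => E.eval ((r : ℂ) * Complex.exp (Complex.I * t)) := by
  simp_rw [Expansion.eval_eq, norm_mul_exp_I hr]
  exact continuous_const.add (Complex.continuous_re.comp (continuous_homSum_circle E.coeff hr))

theorem integral_homSum_circle {c : ℕ × ℕ →₀ ℂ} (hc : c ∈ nonradial) {r : ℝ} (hr : 0 < r) :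
    ∫ t in (0 : ℝ)..(2 * Real.pi), (homSum c ((r : ℂ) * Complex.exp (Complex.I * t))).re = 0 := by
  have h0 : ∫ t in (0 : ℝ)..(2 * Real.pi),
      homSum c ((r : ℂ) * Complex.exp (Complex.I * t)) = 0 := by
    simp_rw [homSum, Finsupp.sum, norm_mul_exp_I hr]
    rw [intervalIntegral.integral_finsetSum fun p _ =>
      Continuous.intervalIntegrable (by fun_prop) _ _]
    refine Finset.sum_eq_zero fun p hp => ?_
    have hp1 := ((Finsupp.mem_supported _ _).1 hc hp).1
    have hne : (p.1 : ℂ) * Complex.I ≠ 0 :=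
      mul_ne_zero (by exact_mod_cast (by omega : p.1 ≠ 0)) Complex.I_ne_zero
    have e : ∀ t : ℝ, c p * (((r : ℂ) * Complex.exp (Complex.I * t)) ^ p.1 / (r : ℂ) ^ p.2) =
        c p * ((r : ℂ) ^ p.1 / (r : ℂ) ^ p.2) * Complex.exp (p.1 * Complex.I * t) := by
      intro t
      rw [mul_pow, ← Complex.exp_nat_mul]
      ring_nf
    simp_rw [e]
    rw [intervalIntegral.integral_const_mul, integral_exp_mul_complex hne]
    have e2 : Complex.exp (p.1 * Complex.I * (2 * Real.pi : ℝ)) = 1 := by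
      rw [← Complex.exp_nat_mul_two_pi_mul_I p.1]
      congr 1
      push_cast
      ring
    rw [e2]
    simp
  have h1 := Complex.reCLM.intervalIntegral_comp_comm
    ((continuous_homSum_circle c hr).intervalIntegrable (μ := volume) 0 (2 * Real.pi))
  simp only [Complex.reCLM_apply] at h1
  rw [h1, h0, Complex.zero_re]

/-- Only the radial terms of an expansion survive averaging over circles. -/
theorem Expansion.integral_circle {E : Expansion} (hE : E.coeff ∈ nonradial) {r : ℝ} (hr : 0 < r) :
    ∫ t in (0 : ℝ)..(2 * Real.pi), E.eval ((r : ℂ) * Complex.exp (Complex.I * t)) =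
      2 * Real.pi * E.logCoeff * Real.log r + 2 * Real.pi * E.const := by
  simp_rw [Expansion.eval_eq, norm_mul_exp_I hr]
  have hi : IntervalIntegrable
      (fun t : ℝ => (homSum E.coeff ((r : ℂ) * Complex.exp (Complex.I * t))).re) volume 0
      (2 * Real.pi) :=
    (Complex.continuous_re.comp (continuous_homSum_circle E.coeff hr)).intervalIntegrable _ _
  rw [intervalIntegral.integral_add (by simp) hi, integral_homSum_circle hE hr,
    intervalIntegral.integral_const, smul_eq_mul]
  ring

/-- Two expansions of order `K` of one function on a lattice agree up to `O(|z| ^ (-K))` on the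
plane. -/
theorem Expansion.IsExpansionOf.sub_isBigO {Z : Submodule ℤ ℂ} [DiscreteTopology Z]
    [IsZLattice ℝ Z] {K : ℕ} {a : Z → ℝ} {E E' : Expansion} (hE : E.IsExpansionOf K a)
    (hE' : E'.IsExpansionOf K a) :
    (fun z => E.eval z - E'.eval z) =O[Bornology.cobounded ℂ] fun z => (‖z‖ ^ K)⁻¹ := by
  -- the constant term is recorded as the coefficient of `z ^ 0 / |z| ^ 0`
  set c : ℕ × ℕ →₀ ℂ :=
    Finsupp.single (0, 0) ((E.const - E'.const : ℝ) : ℂ) + (E.coeff + -E'.coeff) with hc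
  have e : ∀ z : ℂ, E.eval z - E'.eval z =
      (E.logCoeff - E'.logCoeff) * Real.log ‖z‖ + (homSum c z).re := by
    intro z
    rw [Expansion.eval_eq, Expansion.eval_eq, hc, homSum_add, homSum_single, homSum_add, homSum_neg,
      Complex.add_re, Complex.add_re, Complex.neg_re]
    simp only [pow_zero, div_one, mul_one, Complex.ofReal_re]
    ring
  simp_rw [e]
  refine isBigO_of_isBigO_lattice Z (fun p hp => ?_) ?_
  · by_contra hlt
    have h1 : p ∉ E.coeff.support := fun h => by have := (hE.degrees p h).1; omega
    have h2 : p ∉ E'.coeff.support := fun h => by have := (hE'.degrees p h).1; omega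
    have h3 : (0, 0) ≠ p := by rintro rfl; simp at hlt
    rw [Finsupp.mem_support_iff] at hp
    rw [Finsupp.notMem_support_iff] at h1 h2
    exact hp (by simp [hc, h1, h2, h3])
  · refine (hE'.approx.sub hE.approx).congr_left fun z => ?_
    rw [← e]
    ring

end PlanarWalk

theorem mainTheorem6 {Ω : Type*} [MeasurableSpace Ω] (μ : Measure Ω) [IsProbabilityMeasure μ]
    (Z : Submodule ℤ ℂ) [DiscreteTopology Z] [IsZLattice ℝ Z]
    (R : ℕ → Ω → ℂ) (hR : PlanarWalk.IsRandomWalk μ Z R) (hS : PlanarWalk.IsSpherical μ R) :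
    ∃ a : Z → ℝ, PlanarWalk.IsHarmonicPotential μ Z R a ∧
      ∃ A B : ℝ, ∀ K : ℕ,
        (∃ E : PlanarWalk.Expansion, E.IsExpansionOf K a) ∧
        ∀ E : PlanarWalk.Expansion, E.IsExpansionOf K a →
          (fun r : ℝ =>
            (∫ t in (0 : ℝ)..(2 * Real.pi), E.eval ((r : ℂ) * Complex.exp (Complex.I * (t : ℂ))))
              - (A * Real.log r + B)) =O[atTop] (fun r : ℝ => (r ^ K)⁻¹) := by
  obtain ⟨a, ha, α, lam, hex⟩ := PlanarWalk.exists_nonradial_expansion hR hS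
  refine ⟨a, ha, 2 * Real.pi * α, 2 * Real.pi * lam, fun K => ?_⟩
  obtain ⟨E₀, hE₀, rfl, rfl, hnr⟩ := hex K
  refine ⟨⟨E₀, hE₀⟩, fun E hE => ?_⟩
  obtain ⟨C, hC⟩ := (hE.sub_isBigO hE₀).bound
  obtain ⟨ρ, -, hρ⟩ := (Filter.hasBasis_cobounded_norm (E := ℂ)).eventually_iff.1 hC
  refine IsBigO.of_bound (C * (2 * Real.pi)) ?_
  filter_upwards [eventually_ge_atTop ρ, eventually_gt_atTop 0] with r hr hr0
  have hint := fun E : PlanarWalk.Expansion =>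
    (E.continuous_eval_circle hr0).intervalIntegrable (μ := volume) 0 (2 * Real.pi)
  rw [← PlanarWalk.Expansion.integral_circle hnr hr0,
    ← intervalIntegral.integral_sub (hint E) (hint E₀)]
  refine (intervalIntegral.norm_integral_le_of_norm_le_const (C := C * ‖(r ^ K)⁻¹‖)
    fun t _ => ?_).trans (le_of_eq ?_)
  · have := hρ (x := (r : ℂ) * Complex.exp (Complex.I * t))
      (by simpa only [Set.mem_ofPred_eq, PlanarWalk.norm_mul_exp_I hr0] using hr)
    simpa only [PlanarWalk.norm_mul_exp_I hr0] using this
  · rw [sub_zero, abs_of_pos Real.two_pi_pos]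
    ring
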